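/- For every $\varepsilon\in(0,1/15)$ there is a constant $C_\varepsilon>0$, depending only on $\varepsilon$, such that the following holds. Let $x>1$ be real, let $a$ and $q$ be coprime positive integers with $q\le x^{2/3-\varepsilon}$, let $D\ge 2$ be an integer, and let $\chi$ be a real primitive Dirichlet character modulo $D$. Write $\lambda=1*\chi$, i.e. $\lambda(n)=\sum_{d\mid n}\chi(d)$, let $L(s,\chi)$ be the Dirichlet $L$-function of $\chi$, and let $\mathbf 1_{D\mid q}$ be $1$ if $D\mid q$ and $0$ otherwise. Then $$\left|\sum_{\substack{1\le n\le x\\ n\equiv a\ (\mathrm{mod}\ q)}}\lambda(n)-\frac{x\,(1+\mathbf 1_{D\mid q}\,\chi(a))}{q}\prod_{p\mid q}\left(1-\frac{\chi(p)}{p}\right)L(1,\chi)\right|\le C_\varepsilon\,\frac{D\,x^{1-\varepsilon/2}}{q},$$ where the product runs over the primes $p$ dividing $q$. -/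

import Mathlib

/-- A complex Dirichlet character is real if all its values are real. -/
def DirichletCharacter.IsReal {D : ℕ} (χ : DirichletCharacter ℂ D) : Prop :=
  ∀ m : ZMod D, (χ m).im = 0

/-- The sum of `λ(n)` over the positive integers `n ≤ x` with `n ≡ a (mod q)`, where
`λ = 1 * χ` is the Dirichlet convolution `DirichletCharacter.zetaMul χ`. -/
noncomputable def lamSumAP {D : ℕ} (χ : DirichletCharacter ℂ D) (x : ℝ) (q a : ℕ) : ℂ :=
  ∑ n ∈ Finset.Icc 1 ⌊x⌋₊ with n ≡ a [MOD q], DirichletCharacter.zetaMul χ n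

/-! Write `λ(n)` as the sum of `χ(d)` over factorisations `n = d m`, so that the congruence becomes
a modular hyperbola `d m ≡ a (mod q)`. `hyperbolaWeight` is its `χ`-weighted indicator minus two
averages. One is `χ(d) / q` on `d` coprime to `q`. The other, present when `D ∣ q`, is `χ(a) χ(m) /
q` on `m` coprime to `q`: then `d m ≡ a` forces `χ(d) = χ(a) χ(m)`, as `χ` is real. Summed over `d m
≤ x`, both averages lead to the sum of `χ(d) ⌊x / d⌋` over `d` coprime to `q`. Since partial sums of
`χ` are bounded by `D`, it is the stated multiple of `L(1, χ)` up to `O(D τ(q) √x)`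
(`norm_sum_mul_div_sub_le`).

It remains to bound the sum of `hyperbolaWeight` under the hyperbola. On a box where `d` runs over
whole blocks of length `D`, Fourier inversion on `ZMod q` produces Kloosterman sums. The frequencies
`k` with `k D = 0` contribute nothing: if `D ∤ q` a Gauss sum vanishes, and if `D ∣ q` the second
average removes them. For the others, geometric sums and Weil's bound give `D q ^ (1 / 2 + o(1))`
(`norm_sum_box_hyperbolaWeight_le`). The region is cut into about `k log x` boxes whose `d`-ranges
grow by a factor `1 + 1 / k` (`norm_sum_hyperbola_le`). The points left over have `d m` in a short
interval ending at `N`, and the divisor bound makes them `O(x ^ (1 + η) / (k q) + x ^ η)`. For `k`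
about `x ^ (ε / 2 + η)` everything fits as long as `q ≤ x ^ (2 / 3 - ε)`.

Weil's bound is itself proved. Modulo a prime, Stepanov's method bounds from below the number of
points on the covers `w ^ p - w = x + β / x`, which bounds from above an average of even moments of
the reciprocal roots of the Kloosterman L-functions. These are quadratic polynomials with real
coefficients, so no moment is very negative, each is therefore bounded, and high powers yield the
exact bound (`norm_sum_addChar_add_inv_le`). Higher prime powers are treated by stationary phase,
general moduli by the Chinese remainder theorem (`norm_kloosterman_le`). -/

/-! ### Stepanov's method for nonsquare values of a polynomial. -/

open Polynomial in
/-- A polynomial `∑ (uⱼ) X ^ (j Q)` vanishes only if the first nonzero `uⱼ` is divisible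
by `X ^ Q`. -/
theorem X_pow_dvd_of_sum_mul_X_pow_eq_zero {F : Type*} [Field F] {J Q : ℕ} (u : Fin J → F[X])
    (h : ∑ j, u j * X ^ (j.1 * Q) = 0) (i : Fin J) (hi : ∀ j < i, u j = 0) : X ^ Q ∣ u i := by
  have h1 : u i * X ^ (i.1 * Q) = - ∑ j ∈ Finset.univ.erase i, u j * X ^ (j.1 * Q) := by
    rw [eq_neg_iff_add_eq_zero,
      Finset.add_sum_erase _ (fun j : Fin J => u j * X ^ (j.1 * Q)) (Finset.mem_univ i), h]
  have h2 : (X : F[X]) ^ (Q + i.1 * Q) ∣ u i * X ^ (i.1 * Q) := by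
    rw [h1, dvd_neg]
    refine Finset.dvd_sum fun j hj => ?_
    rcases lt_or_gt_of_ne (Finset.ne_of_mem_erase hj) with hlt | hgt
    · simp [hi j hlt]
    · refine Dvd.dvd.mul_left (pow_dvd_pow _ ?_) _
      have : i.1 + 1 ≤ j.1 := hgt
      nlinarith
  rw [pow_add] at h2
  exact (mul_dvd_mul_iff_right (pow_ne_zero _ X_ne_zero)).1 h2

open Polynomial in
/-- The independence statement in Stepanov's method. -/
theorem eq_zero_of_X_pow_dvd_add_mul_pow {F : Type*} [Field F] {p k : ℕ} [Fact p.Prime] [CharP F p]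
    {A e : ℕ} (hA : p ^ k = 2 * A + 1) (he : 0 < e) (heA : e ≤ A) {g r s : F[X]}
    (hg : g.natDegree = 2 * e) (hsq : Squarefree g) (hg0 : g.eval 0 ≠ 0)
    (hr : r.natDegree ≤ A) (hs : s.natDegree ≤ A - e)
    (h : X ^ (p ^ k) ∣ r + s * g ^ (A + 1)) : r = 0 ∧ s = 0 := by
  set Q := p ^ k with hQ
  -- In characteristic `p` the `Q`-th power of `g` is constant modulo `X ^ Q`.
  have hgQ : (X : F[X]) ^ Q ∣ g ^ Q - C (g.eval 0 ^ Q) := by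
    have h1 : (X : F[X]) ∣ g - C (g.eval 0) := by
      rw [X_dvd_iff]; simp [coeff_zero_eq_eval_zero]
    have h2 : g ^ Q - C (g.eval 0 ^ Q) = (g - C (g.eval 0)) ^ Q := by
      rw [hQ, sub_pow_char_pow, C_pow]
    rw [h2]
    exact pow_dvd_pow_of_dvd h1 _
  -- Multiplying by the conjugate `r - s * g ^ (A + 1)` creates `g ^ (Q + 1)`, in which `g ^ Q` is a
  -- constant modulo `X ^ Q`. What is left has degree at most `2 * A < Q`, so it vanishes
  -- identically.
  have h1 : X ^ Q ∣ r ^ 2 - C (g.eval 0 ^ Q) * (s ^ 2 * g) := by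
    have : r ^ 2 - C (g.eval 0 ^ Q) * (s ^ 2 * g) =
      (r + s * g ^ (A + 1)) * (r - s * g ^ (A + 1)) + s ^ 2 * g * (g ^ Q - C (g.eval 0 ^ Q)) := by
      rw [hA]; ring
    rw [this]
    exact dvd_add (h.mul_right _) (hgQ.mul_left _)
  have h2 : r ^ 2 - C (g.eval 0 ^ Q) * (s ^ 2 * g) = 0 := by
    refine eq_zero_of_dvd_of_natDegree_lt h1 ?_
    rw [natDegree_X_pow]
    have a1 : (r ^ 2).natDegree ≤ 2 * A := natDegree_pow_le.trans (by omega)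
    have a2 : (C (g.eval 0 ^ Q) * (s ^ 2 * g)).natDegree ≤ 2 * A := by
      refine (natDegree_C_mul_le _ _).trans (natDegree_mul_le.trans ?_)
      have : (s ^ 2).natDegree ≤ 2 * (A - e) := natDegree_pow_le.trans (by omega)
      omega
    have := natDegree_sub_le_of_le a1 a2
    rw [max_self] at this; omega
  rw [sub_eq_zero] at h2
  have hc : g.eval 0 ^ Q ≠ 0 := pow_ne_zero _ hg0
  -- Otherwise `g` is a constant times a square, impossible for a squarefree polynomial of positive
  -- degree.
  have hs0 : s = 0 := by
    by_contra hs0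
    have h3 : s ^ 2 ∣ r ^ 2 := by
      rw [h2]; exact ⟨C (g.eval 0 ^ Q) * g, by ring⟩
    obtain ⟨t, rfl⟩ := (UniqueFactorizationMonoid.pow_dvd_pow_iff_dvd two_ne_zero).1 h3
    have h4 : t ^ 2 = C (g.eval 0 ^ Q) * g := by
      have : s ^ 2 * t ^ 2 = s ^ 2 * (C (g.eval 0 ^ Q) * g) := by rw [← mul_pow, h2]; ring
      exact mul_left_cancel₀ (pow_ne_zero _ hs0) this
    have h5 : t * t ∣ g := by
      refine ⟨C (g.eval 0 ^ Q)⁻¹, ?_⟩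
      rw [← pow_two, h4, mul_right_comm, ← C_mul, mul_inv_cancel₀ hc, C_1, one_mul]
    have h6 := natDegree_eq_zero_of_isUnit (hsq t h5)
    have h7 : (t ^ 2).natDegree = 2 * e := by
      rw [h4, natDegree_C_mul hc, hg]
    rw [natDegree_pow, h6] at h7
    omega
  refine ⟨?_, hs0⟩
  rw [hs0] at h2
  simpa using h2

open Polynomial in
/-- **Stepanov's bound**: over a field with `Q ^ 2` elements, `Q = 2 A + 1`, a squarefree polynomial
of degree `2 e` takes nonsquare values at most `(A + 2 e) Q` times. -/
theorem card_eval_pow_eq_neg_one_le {F : Type*} [Field F] [Fintype F] [DecidableEq F] {p k : ℕ}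
    [Fact p.Prime] [CharP F p] {A e : ℕ} (hA : p ^ k = 2 * A + 1)
    (hF : Fintype.card F = (p ^ k) ^ 2) (he : 0 < e) (heA : e < A) {g : F[X]}
    (hg : g.natDegree = 2 * e) (hsq : Squarefree g) (hg0 : g.eval 0 ≠ 0) :
    (Finset.univ.filter fun w : F => g.eval w ^ (2 * A * (A + 1)) = -1).card
      ≤ (A + 2 * e) * p ^ k := by
  set Q := p ^ k with hQ
  set J := A + e with hJ
  -- All auxiliary sums have degree below `M`, so `M` counts the linear conditions for one of them
  -- to vanish.
  set M := Q * A + e + J with hM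
  have hQ0 : Q ≠ 0 := by omega
  have aux : ∀ (ρ σ : F[X]) (j : ℕ), j < J → ρ ∈ degreeLT F (A + 1) → σ ∈ degreeLT F (A + 1 - e) →
      (expand F Q ρ - expand F Q σ * g ^ (A + 1)) * X ^ j ∈ degreeLT F M := by
    intro ρ σ j hj hρ hσ
    rw [mem_degreeLT] at *
    have h1 : ρ.natDegree ≤ A := by
      by_contra! hlt
      rw [degree_eq_natDegree (by rintro rfl; simp at hlt)] at hρ
      norm_cast at hρ; omega
    have h2 : σ.natDegree ≤ A - e := by
      by_contra! hlt
      rw [degree_eq_natDegree (by rintro rfl; simp at hlt)] at hσ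
      norm_cast at hσ; omega
    have h3 : (expand F Q ρ).natDegree ≤ Q * A + e := by
      rw [natDegree_expand]; nlinarith
    have h4 : (expand F Q σ * g ^ (A + 1)).natDegree ≤ Q * A + e := by
      refine natDegree_mul_le.trans ?_
      rw [natDegree_expand]
      have : (g ^ (A + 1)).natDegree ≤ (A + 1) * (2 * e) := by
        rw [← hg]; exact natDegree_pow_le
      obtain ⟨d, rfl⟩ : ∃ d, A = e + d := ⟨A - e, by omega⟩
      simp only [Nat.add_sub_cancel_left] at h2
      nlinarith
    refine (degree_le_natDegree).trans_lt ?_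
    norm_cast
    refine (natDegree_mul_le).trans_lt ?_
    have h5 := natDegree_sub_le_of_le h3 h4
    simp only [max_self] at h5
    rw [natDegree_X_pow]
    omega
  let Φ : ((Fin J → degreeLT F (A + 1)) × (Fin J → degreeLT F (A + 1 - e))) →ₗ[F]
      degreeLT F M :=
    { toFun := fun x => ⟨∑ j : Fin J, (expand F Q (x.1 j).1 -
          expand F Q (x.2 j).1 * g ^ (A + 1)) * X ^ j.1,
        Submodule.sum_mem _ fun j _ => aux _ _ _ j.2 (x.1 j).2 (x.2 j).2⟩
      map_add' := fun x y => by
        ext1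
        simp only [Prod.fst_add, Prod.snd_add, Pi.add_apply, Submodule.coe_add, map_add,
          ← Finset.sum_add_distrib]
        exact Finset.sum_congr rfl fun j _ => by ring
      map_smul' := fun c x => by
        ext1
        simp only [Prod.smul_fst, Prod.smul_snd, Pi.smul_apply, SetLike.val_smul, map_smul,
          RingHom.id_apply, Finset.smul_sum]
        refine Finset.sum_congr rfl fun j _ => ?_
        simp only [smul_eq_C_mul]
        ring }
  have fr : ∀ n, Module.finrank F (degreeLT F n) = n := fun n => by
    rw [(degreeLTEquiv F n).finrank_eq]; simp
  -- There are `J * (2 * A + 2 - e)` unknown coefficients against `M` conditions; the surplus is `e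
  -- * (A - e)`, positive because `e < A`.
  have hker : LinearMap.ker Φ ≠ ⊥ := by
    have : FiniteDimensional F (degreeLT F M) := Module.Finite.equiv (degreeLTEquiv F M).symm
    have i1 : ∀ n, FiniteDimensional F (degreeLT F n) :=
      fun n => Module.Finite.equiv (degreeLTEquiv F n).symm
    apply LinearMap.ker_ne_bot_of_finrank_lt
    rw [fr, Module.finrank_prod, Module.finrank_pi_fintype, Module.finrank_pi_fintype]
    simp only [fr, Finset.sum_const, Finset.card_univ, Fintype.card_fin, smul_eq_mul]
    obtain ⟨d, rfl⟩ : ∃ d, A = e + 1 + d := ⟨A - (e + 1), by omega⟩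
    have : e + 1 + d + 1 - e = d + 2 := by omega
    rw [this, hM, hJ, hA]
    nlinarith
  obtain ⟨x, hx, hx0⟩ := Submodule.exists_mem_ne_zero_of_ne_bot hker
  have hE : ∑ j : Fin J, (expand F Q (x.1 j).1 -
      expand F Q (x.2 j).1 * g ^ (A + 1)) * X ^ j.1 = 0 := by
    have := congrArg Subtype.val (LinearMap.mem_ker.1 hx)
    exact this
  -- `F` is perfect, so coefficients have `Q`-th roots and `R f` is a `Q`-th root of `expand F Q f`.
  let φ := iterateFrobeniusEquiv F p k
  let R : F[X] → F[X] := fun f => f.map (φ.symm : F →+* F)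
  have hR : ∀ f, R f ^ Q = expand F Q f := by
    intro f
    rw [hQ, ← map_iterateFrobenius_expand, ← map_expand, Polynomial.map_map]
    have : (iterateFrobenius F p k).comp (φ.symm : F →+* F) = RingHom.id F := by
      ext y
      exact φ.apply_symm_apply y
    rw [this, Polynomial.map_id]
  have hRd : ∀ f n, f ∈ degreeLT F (n + 1) → (R f).natDegree ≤ n := by
    intro f n hf
    refine natDegree_map_le.trans ?_
    rw [mem_degreeLT] at hf
    by_contra! hlt
    rw [degree_eq_natDegree (by rintro rfl; simp at hlt)] at hf
    norm_cast at hf; omega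
  have hR0 : ∀ f, R f = 0 → f = 0 := fun f hf => by
    have := hR f
    rw [hf, zero_pow hQ0] at this
    exact (expand_eq_zero (Nat.pos_of_ne_zero hQ0)).1 this.symm
  -- At a counted point `w ^ (Q * Q) = w` and `g(w) ^ ((A + 1) * Q) = -g(w) ^ (A + 1)`, so `T(w) ^
  -- Q` is the value at `w` of the sum that vanishes by `hE`. Thus every counted point is a root of
  -- `T`, and no multiplicities are needed.
  set T : F[X] := ∑ j : Fin J, (R (x.1 j).1 + R (x.2 j).1 * g ^ (A + 1)) * X ^ (j.1 * Q) with hT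
  have hd1 : ∀ j, (R (x.1 j).1).natDegree ≤ A := fun j => hRd _ _ (x.1 j).2
  have hd2 : ∀ j, (R (x.2 j).1).natDegree ≤ A - e := fun j => by
    refine hRd _ _ ?_
    rw [← show A + 1 - e = A - e + 1 by omega]
    exact (x.2 j).2
  have hT0 : T ≠ 0 := by
    intro hT0
    -- Once the earlier coefficients vanish, `X ^ Q` divides the next one, and independence kills
    -- both of its parts.
    have key : ∀ n, ∀ j : Fin J, j.1 = n → (x.1 j).1 = 0 ∧ (x.2 j).1 = 0 := by
      intro n
      induction n using Nat.strong_induction_on with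
      | _ n ih =>
        intro i hin
        have hdvd := X_pow_dvd_of_sum_mul_X_pow_eq_zero
          (fun j => R (x.1 j).1 + R (x.2 j).1 * g ^ (A + 1)) hT0 i (fun j hj => by
            obtain ⟨h1, h2⟩ := ih j.1 (hin ▸ hj) j rfl
            simp [h1, h2, R])
        obtain ⟨h1, h2⟩ := eq_zero_of_X_pow_dvd_add_mul_pow (hQ ▸ hA) he heA.le hg hsq hg0
          (hd1 i) (hd2 i) hdvd
        exact ⟨hR0 _ h1, hR0 _ h2⟩
    apply hx0
    ext j : 2
    · exact Subtype.ext (key j.1 j rfl).1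
    · exact Subtype.ext (key j.1 j rfl).2
  have hTd : T.natDegree ≤ (A + 2 * e) * Q := by
    refine natDegree_sum_le_of_forall_le _ _ fun j _ => ?_
    refine natDegree_mul_le.trans ?_
    rw [natDegree_X_pow]
    have h1 : (R (x.2 j).1 * g ^ (A + 1)).natDegree ≤ A - e + (A + 1) * (2 * e) := by
      refine natDegree_mul_le.trans (add_le_add (hd2 j) ?_)
      rw [← hg]; exact natDegree_pow_le
    have h2 : (R (x.1 j).1 + R (x.2 j).1 * g ^ (A + 1)).natDegree ≤
        A + (A + 1) * (2 * e) - e := by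
      refine (natDegree_add_le_of_le (hd1 j) h1).trans (max_le ?_ ?_)
      · have : e ≤ (A + 1) * (2 * e) := by nlinarith
        omega
      · omega
    have h3 : j.1 * Q ≤ (A + e - 1) * Q := Nat.mul_le_mul_right _ (by have := j.2; omega)
    have h5 : (A + e - 1) * Q + A + (A + 1) * (2 * e) - e ≤ (A + 2 * e) * Q := by
      obtain ⟨d, rfl⟩ : ∃ d, A = 1 + d := ⟨A - 1, by omega⟩
      have : 1 + d + e - 1 = d + e := by omega
      rw [this]
      apply Nat.sub_le_of_le_add
      rw [hA]
      nlinarith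
    have h6 : e ≤ (A + 1) * (2 * e) := by nlinarith
    omega
  have hroot : ∀ w : F, g.eval w ^ (2 * A * (A + 1)) = -1 → T.eval w = 0 := by
    intro w hw
    have h1 : T.eval w ^ Q = 0 := by
      have hw2 : w ^ (Q * Q) = w := by
        have := FiniteField.pow_card w
        rwa [hF, pow_two] at this
      rw [hT, eval_finsetSum, hQ, sum_pow_char_pow, ← hQ]
      have h2 := congrArg (eval w) hE
      rw [eval_zero, eval_finsetSum] at h2
      rw [← h2]
      refine Finset.sum_congr rfl fun j _ => ?_
      have e1 : eval w (expand F Q (x.1 j).1) = eval w (R (x.1 j).1) ^ Q := by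
        rw [← hR, eval_pow]
      have e2 : eval w (expand F Q (x.2 j).1) = eval w (R (x.2 j).1) ^ Q := by
        rw [← hR, eval_pow]
      simp only [eval_mul, eval_add, eval_sub, eval_pow, eval_X, e1, e2]
      rw [mul_pow, hQ, add_pow_char_pow, ← hQ, mul_pow, ← pow_mul w, mul_assoc, mul_comm j.1,
        pow_mul w, hw2, ← pow_mul (eval w g)]
      have : (A + 1) * Q = 2 * A * (A + 1) + (A + 1) := by rw [hA]; ring
      rw [this, pow_add (eval w g), hw]
      ring
    exact pow_eq_zero_iff hQ0 |>.1 h1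
  refine le_trans ?_ hTd
  refine le_trans (Finset.card_le_card fun w hw => ?_) (T.roots.toFinset_card_le.trans
    (card_roots' T))
  rw [Multiset.mem_toFinset, mem_roots hT0]
  exact hroot w (Finset.mem_filter.1 hw).2

/-! ### Points on Artin–Schreier covers. -/

open Polynomial in
/-- The discriminant `(X ^ p - X) ^ 2 - 4 β` of `x ^ 2 - (w ^ p - w) x + β`, as a polynomial
in `w`. -/
noncomputable def artinSchreierDisc {F : Type*} [Field F] (p : ℕ) (β : F) : F[X] :=
  (X ^ p - X) ^ 2 - C (4 * β)

open Polynomial in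
theorem natDegree_artinSchreierDisc {F : Type*} [Field F] {p : ℕ} (hp : 1 < p) (β : F) :
    (artinSchreierDisc p β).natDegree = 2 * p := by
  have h1 : ((X : F[X]) ^ p - X).natDegree = p := FiniteField.X_pow_card_sub_X_natDegree_eq F hp
  unfold artinSchreierDisc
  rw [natDegree_sub_C, natDegree_pow, h1]

-- The derivative is `-2 * (X ^ p - X)`, modulo which the polynomial is the nonzero constant `-4 *
-- β`; this gives a Bézout identity.
open Polynomial in
theorem squarefree_artinSchreierDisc {F : Type*} [Field F] {p : ℕ} [Fact p.Prime] [CharP F p]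
    (hp : p ≠ 2) {β : F} (hβ : β ≠ 0) : Squarefree (artinSchreierDisc p β) := by
  have h2 : (2 : F) ≠ 0 := Ring.two_ne_zero (by rwa [ringChar.eq F p])
  refine Separable.squarefree ?_
  have hd : derivative (artinSchreierDisc p β) = - C 2 * (X ^ p - X) := by
    unfold artinSchreierDisc
    simp [derivative_pow]
  have h4 : (4 * β : F) ≠ 0 := by
    have : (4 : F) = 2 * 2 := by norm_num
    rw [this]; exact mul_ne_zero (mul_ne_zero h2 h2) hβ
  refine ⟨- C (4 * β)⁻¹, - C (4 * β)⁻¹ * C 2⁻¹ * (X ^ p - X), ?_⟩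
  rw [hd]
  have e1 : (C (2 : F)⁻¹ : F[X]) * C 2 = 1 := by rw [← C_mul, inv_mul_cancel₀ h2, C_1]
  have e2 : (C (4 * β)⁻¹ : F[X]) * C (4 * β) = 1 := by rw [← C_mul, inv_mul_cancel₀ h4, C_1]
  unfold artinSchreierDisc
  linear_combination e2 + C (4 * β)⁻¹ * (X ^ p - X) ^ 2 * e1

theorem trace_pow_card_sub_self {p : ℕ} [Fact p.Prime] {F : Type*} [Field F] [Finite F]
    [Algebra (ZMod p) F] (w : F) : Algebra.trace (ZMod p) F (w ^ p - w) = 0 := by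
  have := Algebra.trace_eq_of_algEquiv (FiniteField.frobeniusAlgEquivOfAlgebraic (ZMod p) F) w
  rw [map_sub, sub_eq_zero, ← this]
  congr 1
  simp

/-- Points on the Artin–Schreier cover `w ^ p - w = x + β / x` over an even degree extension of
`ZMod p`, counted from below by Stepanov's method. -/
theorem card_trace_eq_zero_ge {p k : ℕ} [Fact p.Prime] (hp : p ≠ 2) (hk : 2 ≤ k)
    {F : Type*} [Field F] [Fintype F] [DecidableEq F] [Algebra (ZMod p) F]
    (hF : Fintype.card F = (p ^ k) ^ 2) {β : F} (hβ : β ≠ 0) :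
    (p ^ k) ^ 2 ≤ p * (Finset.univ.filter fun x : Fˣ =>
      Algebra.trace (ZMod p) F (x + β * (x⁻¹ : Fˣ)) = 0).card + 8 * p * p ^ k := by
  classical
  have : CharP F p := charP_of_injective_algebraMap (algebraMap (ZMod p) F).injective p
  have hp1 : 1 < p := (Fact.out : p.Prime).one_lt
  have hp3 : 3 ≤ p := by omega
  have hodd : Odd p := (Fact.out : p.Prime).odd_of_ne_two hp
  have h2 : (2 : F) ≠ 0 := Ring.two_ne_zero (by rwa [ringChar.eq F p])
  obtain ⟨A, hA⟩ := hodd.pow (n := k)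
  have hpA : p < A := by
    have : p ^ 2 ≤ p ^ k := Nat.pow_le_pow_right (by omega) hk
    nlinarith
  set g := artinSchreierDisc p β with hg
  have hgdeg := natDegree_artinSchreierDisc hp1 β
  have hgsq := squarefree_artinSchreierDisc hp hβ
  have hgev : ∀ w, g.eval w = (w ^ p - w) ^ 2 - 4 * β := fun w => by
    simp [hg, artinSchreierDisc]
  have hg0 : g.eval 0 ≠ 0 := by
    rw [hgev, zero_pow (by omega)]
    have : (4 : F) = 2 * 2 := by norm_num
    rw [this]
    simp [h2, hβ]
  have hS := card_eval_pow_eq_neg_one_le hA hF (by omega) hpA hgdeg hgsq hg0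
  have hcard2 : Fintype.card F / 2 = 2 * A * (A + 1) := by
    rw [hF, hA]
    have : (2 * A + 1) ^ 2 = 2 * (2 * A * (A + 1)) + 1 := by ring
    rw [this]; omega
  have hsquare : ∀ y : F, y ≠ 0 → y ^ (2 * A * (A + 1)) ≠ -1 → IsSquare y := by
    intro y hy hy1
    rw [FiniteField.isSquare_iff (by rwa [ringChar.eq F p]) hy, hcard2]
    exact (FiniteField.pow_dichotomy (by rwa [ringChar.eq F p]) hy |> fun h => by
      rw [hcard2] at h; exact h.resolve_right hy1)
  set S := Finset.univ.filter fun w : F => g.eval w ^ (2 * A * (A + 1)) = -1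
  set Z := Finset.univ.filter fun w : F => g.eval w = 0
  set G := Finset.univ.filter fun w : F => g.eval w ≠ 0 ∧ IsSquare (g.eval w)
  have hZ : Z.card ≤ 2 * p := by
    rw [← hgdeg]
    have hgne : g ≠ 0 := by rintro h; rw [h] at hg0; simp at hg0
    refine le_trans (Finset.card_le_card fun w hw => ?_) (g.roots.toFinset_card_le.trans
      (Polynomial.card_roots' g))
    rw [Multiset.mem_toFinset, Polynomial.mem_roots hgne]
    exact (Finset.mem_filter.1 hw).2
  have hcov : Fintype.card F ≤ S.card + Z.card + G.card := by
    rw [← Finset.card_univ]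
    refine le_trans (Finset.card_le_card (t := S ∪ Z ∪ G) fun w _ => ?_)
      ((Finset.card_union_le _ _).trans (by gcongr; exact Finset.card_union_le _ _))
    simp only [S, Z, G, Finset.mem_union, Finset.mem_filter, Finset.mem_univ, true_and]
    by_cases h0 : g.eval w = 0
    · exact Or.inl (Or.inr h0)
    by_cases h1 : g.eval w ^ (2 * A * (A + 1)) = -1
    · exact Or.inl (Or.inl h1)
    · exact Or.inr ⟨h0, hsquare _ h0 h1⟩
  set X := Finset.univ.filter fun x : Fˣ =>
      Algebra.trace (ZMod p) F (x + β * (x⁻¹ : Fˣ)) = 0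
  set r : F → Fˣ → Prop := fun w x => w ^ p - w = x + β * (x⁻¹ : Fˣ) with hr
  -- Double counting of pairs `(w, x)` with `w ^ p - w = x + β / x`. For `w ∈ G` the quadratic in
  -- `x` has two distinct roots, which lie in `X` because `w ^ p - w` has trace zero; for fixed `x`
  -- there are at most `p` values of `w`.
  have hdc : G.card * 2 ≤ X.card * p := by
    refine Finset.card_mul_le_card_mul r (fun w hw => ?_) (fun x _ => ?_)
    · obtain ⟨h0, s, hs⟩ := (Finset.mem_filter.1 hw).2
      have hs0 : s ≠ 0 := by rintro rfl; simp at hs; exact h0 hs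
      rw [hgev] at hs
      set y := w ^ p - w with hy
      have hprod : ((y + s) / 2) * ((y - s) / 2) = β := by
        field_simp
        linear_combination hs
      have hx1 : (y + s) / 2 ≠ 0 := fun h => hβ (by rw [← hprod, h, zero_mul])
      have hx2 : (y - s) / 2 ≠ 0 := fun h => hβ (by rw [← hprod, h, mul_zero])
      have hr1 : r w (Units.mk0 _ hx1) := by
        simp only [hr, Units.val_mk0, Units.val_inv_eq_inv_val]
        rw [← hy, ← hprod, mul_right_comm, mul_inv_cancel₀ hx1, one_mul]
        field_simp
        ring
      have hr2 : r w (Units.mk0 _ hx2) := by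
        simp only [hr, Units.val_mk0, Units.val_inv_eq_inv_val]
        rw [← hy, ← hprod, mul_assoc, mul_inv_cancel₀ hx2, mul_one]
        field_simp
        ring
      have hmem : ∀ x, r w x → x ∈ Finset.bipartiteAbove r X w := fun x hx => by
        rw [Finset.mem_bipartiteAbove]
        refine ⟨Finset.mem_filter.2 ⟨Finset.mem_univ _, ?_⟩, hx⟩
        rw [← hx]
        exact trace_pow_card_sub_self w
      rw [← Finset.card_pair (a := Units.mk0 _ hx1) (b := Units.mk0 _ hx2)]
      · refine Finset.card_le_card fun x hx => ?_
        rcases Finset.mem_insert.1 hx with rfl | hx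
        · exact hmem _ hr1
        · rw [Finset.mem_singleton.1 hx]; exact hmem _ hr2
      · intro h
        rw [Units.mk0_inj, div_left_inj' h2] at h
        have : 2 * s = 0 := by linear_combination h
        exact hs0 ((mul_eq_zero.1 this).resolve_left h2)
    · set c := (x : F) + β * (x⁻¹ : Fˣ)
      have hdeg : ((Polynomial.X : Polynomial F) ^ p - Polynomial.X - Polynomial.C c).natDegree
          = p := by
        rw [Polynomial.natDegree_sub_C, FiniteField.X_pow_card_sub_X_natDegree_eq F hp1]
      have hne : ((Polynomial.X : Polynomial F) ^ p - Polynomial.X - Polynomial.C c) ≠ 0 := by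
        intro h; rw [h] at hdeg; simp at hdeg; omega
      refine le_trans (Finset.card_le_card fun w hw => ?_)
        ((Multiset.toFinset_card_le _).trans ((Polynomial.card_roots' _).trans hdeg.le))
      rw [Multiset.mem_toFinset, Polynomial.mem_roots hne]
      rw [Finset.mem_bipartiteBelow] at hw
      have hw2 : w ^ p - w = c := hw.2
      simp [Polynomial.IsRoot, hw2]
  rw [hF] at hcov
  have hQ1 : 1 ≤ p ^ k := Nat.one_le_pow _ _ (by omega)
  -- With `Q = p ^ k`, the sets `S` and `Z` cost after doubling at most `Q ^ 2 + 4 * p * Q + 4 * p`,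
  -- which leaves room for the constant `8`.
  have h3 : 2 * (A * p ^ k) ≤ (p ^ k) ^ 2 := by rw [hA]; nlinarith
  nlinarith

/-! ### Monic polynomials over a finite field and Newton's identities. -/

section MonicPolynomials

open Polynomial UniqueFactorizationMonoid

variable {k : Type*} [Field k] [Fintype k]

open Classical in
/-- The monic polynomials of degree `n` over a finite field. -/
noncomputable def monicsOfDegree (k : Type*) [Field k] [Fintype k] (n : ℕ) : Finset k[X] :=
  Finset.univ.image fun c : Fin n → k => X ^ n + ∑ i, C (c i) * X ^ (i : ℕ)

theorem mem_monicsOfDegree {n : ℕ} {f : k[X]} :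
    f ∈ monicsOfDegree k n ↔ f.Monic ∧ f.natDegree = n := by
  classical
  simp only [monicsOfDegree, Finset.mem_image, Finset.mem_univ, true_and]
  constructor
  · rintro ⟨c, rfl⟩
    have hd : (∑ i, C (c i) * X ^ (i : ℕ) : k[X]).degree < n := by
      refine (degree_sum_le _ _).trans_lt ((Finset.sup_lt_iff (WithBot.bot_lt_coe n)).2 ?_)
      intro i _
      exact (degree_C_mul_X_pow_le _ _).trans_lt (WithBot.coe_lt_coe.2 i.2)
    refine ⟨monic_X_pow_add hd, ?_⟩
    rw [natDegree_add_eq_left_of_degree_lt (by rwa [degree_X_pow]), natDegree_X_pow]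
  · rintro ⟨hm, hn⟩
    refine ⟨fun i => f.coeff i, ?_⟩
    conv_rhs => rw [hm.as_sum, hn]
    rw [Finset.sum_range]

/-- The monic irreducible polynomials of degree at most `n` over a finite field. -/
noncomputable def monicIrreducibles (k : Type*) [Field k] [Fintype k] (n : ℕ) : Finset k[X] := by
  classical exact
    ((Finset.range (n + 1)).biUnion fun d => monicsOfDegree k d).filter Irreducible

theorem mem_monicIrreducibles {n : ℕ} {P : k[X]} :
    P ∈ monicIrreducibles k n ↔ P.Monic ∧ Irreducible P ∧ P.natDegree ≤ n := by
  classical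
  simp only [monicIrreducibles, Finset.mem_filter, Finset.mem_biUnion, Finset.mem_range,
    mem_monicsOfDegree]
  constructor
  · rintro ⟨⟨d, hd, hm, rfl⟩, hi⟩
    exact ⟨hm, hi, by omega⟩
  · rintro ⟨hm, hi, hd⟩
    exact ⟨⟨_, by omega, hm, rfl⟩, hi⟩

open Classical in
/-- The degree of a monic polynomial, as a sum over the prime powers dividing it. -/
theorem sum_natDegree_of_pow_dvd {n : ℕ} {f : k[X]} (hf : f ∈ monicsOfDegree k n) :
    ∑ P ∈ monicIrreducibles k n,
      ((Finset.Icc 1 n).filter fun j => P.natDegree ∣ j ∧ P ^ (j / P.natDegree) ∣ f).card *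
        P.natDegree = n := by
  obtain ⟨hm, hn⟩ := mem_monicsOfDegree.1 hf
  have hf0 : f ≠ 0 := hm.ne_zero
  have hprod : (normalizedFactors f).prod = f := by
    have h1 := prod_normalizedFactors_eq hf0
    rwa [hm.normalize_eq_self] at h1
  have hmonic : ∀ P ∈ normalizedFactors f, P.Monic := fun P hP => by
    have h1 := normalize_normalized_factor P hP
    have h2 := (irreducible_of_normalized_factor P hP).ne_zero
    rw [← h1]; exact monic_normalize h2
  have hdeg : ∑ P ∈ (normalizedFactors f).toFinset,
      (normalizedFactors f).count P * P.natDegree = n := by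
    conv_rhs => rw [← hn, ← hprod, natDegree_multiset_prod_of_monic _ hmonic,
      Finset.sum_multiset_map_count]
    simp
  have hsub : (normalizedFactors f).toFinset ⊆ monicIrreducibles k n := fun P hP => by
    rw [Multiset.mem_toFinset] at hP
    refine mem_monicIrreducibles.2 ⟨hmonic P hP, irreducible_of_normalized_factor P hP, ?_⟩
    rw [← hn]
    exact natDegree_le_of_dvd (dvd_of_mem_normalizedFactors hP) hf0
  rw [Finset.sum_subset hsub (f := fun P => (normalizedFactors f).count P * P.natDegree)
    (fun P _ hP => by
      rw [Multiset.mem_toFinset] at hP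
      simp [Multiset.count_eq_zero_of_notMem hP])] at hdeg
  refine Eq.trans (Finset.sum_congr rfl fun P hP => ?_) hdeg
  obtain ⟨hPm, hPi, hPd⟩ := mem_monicIrreducibles.1 hP
  have hd := hPi.natDegree_pos
  congr 1
  have hdvd : ∀ j, P ^ j ∣ f ↔ j ≤ (normalizedFactors f).count P := fun j => by
    rw [pow_dvd_iff_le_emultiplicity, emultiplicity_eq_count_normalizedFactors hPi hf0,
      hPm.normalize_eq_self]
    norm_cast
  -- The admissible `j` are the multiples `P.natDegree * i` with `i` up to the multiplicity of `P`
  -- in `f`; the bound `j ≤ n` is then automatic.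
  have hset : (Finset.Icc 1 n).filter (fun j => P.natDegree ∣ j ∧ P ^ (j / P.natDegree) ∣ f) =
      (Finset.Icc 1 ((normalizedFactors f).count P)).image fun i => P.natDegree * i := by
    ext j
    simp only [Finset.mem_filter, Finset.mem_Icc, Finset.mem_image, hdvd]
    constructor
    · rintro ⟨⟨h1, h2⟩, ⟨i, rfl⟩, h3⟩
      rw [Nat.mul_div_cancel_left _ hd] at h3
      exact ⟨i, ⟨Nat.pos_of_mul_pos_left h1, h3⟩, rfl⟩
    · rintro ⟨i, ⟨h1, h2⟩, rfl⟩
      have h3 := natDegree_le_of_dvd ((hdvd i).2 h2) hf0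
      rw [natDegree_pow, hn] at h3
      refine ⟨⟨Nat.mul_pos hd h1, by linarith⟩, dvd_mul_right _ _, ?_⟩
      rwa [Nat.mul_div_cancel_left _ hd]
  rw [hset, Finset.card_image_of_injective _ (fun a b hab => Nat.eq_of_mul_eq_mul_left hd hab)]
  simp

variable (χ : k[X] → ℂ)

/-- The sum of a function over the monic polynomials of degree `n`. -/
noncomputable def monicSum (n : ℕ) : ℂ := ∑ f ∈ monicsOfDegree k n, χ f

open Classical in
/-- The sum over the powers of monic irreducibles of degree `n`, weighted by the degree of the
irreducible. -/
noncomputable def primePowerSum (n : ℕ) : ℂ :=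
  ∑ P ∈ (monicIrreducibles k n).filter (fun P => P.natDegree ∣ n),
    (P.natDegree : ℂ) * χ P ^ (n / P.natDegree)

open Classical in
/-- Newton's identities for a multiplicative function on monic polynomials. -/
theorem natCast_mul_monicSum (hχ : ∀ f g : k[X], f.Monic → g.Monic → χ (f * g) = χ f * χ g)
    (h1 : χ 1 = 1) (n : ℕ) :
    (n : ℂ) * monicSum χ n =
      ∑ j ∈ Finset.Icc 1 n, primePowerSum χ j * monicSum χ (n - j) := by
  have hpow : ∀ (P : k[X]), P.Monic → ∀ j, χ (P ^ j) = χ P ^ j := fun P hP j => by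
    induction j with
    | zero => simp [h1]
    | succ j ih => rw [pow_succ, hχ _ _ (hP.pow j) hP, ih, pow_succ]
  -- The degree of `f` is distributed over the prime powers `P ^ i` dividing it; writing `f = P ^ i
  -- * h` then splits the sum.
  have hL : (n : ℂ) * monicSum χ n = ∑ P ∈ monicIrreducibles k n, ∑ j ∈ Finset.Icc 1 n,
      ∑ f ∈ monicsOfDegree k n,
        if P.natDegree ∣ j ∧ P ^ (j / P.natDegree) ∣ f then (P.natDegree : ℂ) * χ f else 0 := by
    rw [monicSum, Finset.mul_sum]
    conv_rhs => enter [2, P]; rw [Finset.sum_comm]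
    rw [Finset.sum_comm]
    refine Finset.sum_congr rfl fun f hf => ?_
    conv_lhs => rw [← sum_natDegree_of_pow_dvd hf]
    rw [Nat.cast_sum, Finset.sum_mul]
    refine Finset.sum_congr rfl fun P _ => ?_
    rw [← Finset.sum_filter, Finset.sum_const, nsmul_eq_mul]
    push_cast
    ring
  have hR : ∀ j ∈ Finset.Icc 1 n, primePowerSum χ j * monicSum χ (n - j) =
      ∑ P ∈ monicIrreducibles k n, if P.natDegree ∣ j then
        (P.natDegree : ℂ) * χ P ^ (j / P.natDegree) * monicSum χ (n - j) else 0 := by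
    intro j hj
    rw [Finset.mem_Icc] at hj
    rw [primePowerSum, Finset.sum_mul, ← Finset.sum_filter]
    refine Finset.sum_congr ?_ fun _ _ => rfl
    ext P
    simp only [Finset.mem_filter, mem_monicIrreducibles]
    constructor
    · rintro ⟨⟨a, b, c⟩, d⟩
      exact ⟨⟨a, b, by omega⟩, d⟩
    · rintro ⟨⟨a, b, c⟩, d⟩
      exact ⟨⟨a, b, Nat.le_of_dvd (by omega) d⟩, d⟩
  rw [hL, Finset.sum_congr rfl hR, Finset.sum_comm]
  refine Finset.sum_congr rfl fun j hj => Finset.sum_congr rfl fun P hP => ?_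
  rw [Finset.mem_Icc] at hj
  by_cases hd : P.natDegree ∣ j
  · obtain ⟨hPm, hPi, hPd⟩ := mem_monicIrreducibles.1 hP
    have hd0 := hPi.natDegree_pos
    obtain ⟨i, rfl⟩ := hd
    simp only [dvd_mul_right, true_and, if_true, Nat.mul_div_cancel_left i hd0]
    rw [← Finset.sum_filter, monicSum, Finset.mul_sum]
    symm
    refine Finset.sum_bij (fun h _ => P ^ i * h) (fun h hh => ?_) (fun a _ b _ hab => ?_)
      (fun f hf => ?_) (fun h hh => ?_)
    · obtain ⟨a, b⟩ := mem_monicsOfDegree.1 hh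
      refine Finset.mem_filter.2 ⟨mem_monicsOfDegree.2 ⟨(hPm.pow i).mul a, ?_⟩, dvd_mul_right _ _⟩
      rw [(hPm.pow i).natDegree_mul a, hPm.natDegree_pow, b, mul_comm i]
      omega
    · exact mul_left_cancel₀ (hPm.pow i).ne_zero hab
    · obtain ⟨hf1, h, rfl⟩ := Finset.mem_filter.1 hf
      obtain ⟨a, b⟩ := mem_monicsOfDegree.1 hf1
      have hh := (hPm.pow i).of_mul_monic_left a
      refine ⟨h, mem_monicsOfDegree.2 ⟨hh, ?_⟩, rfl⟩
      rw [(hPm.pow i).natDegree_mul hh, hPm.natDegree_pow, mul_comm i] at b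
      omega
    · rw [hχ _ _ (hPm.pow i) (mem_monicsOfDegree.1 hh).1, hpow P hPm]
      ring
  · simp [hd]

theorem monicSum_zero (h1 : χ 1 = 1) : monicSum χ 0 = 1 := by
  have : monicsOfDegree k 0 = {1} := by
    ext f
    simp only [mem_monicsOfDegree, Finset.mem_singleton]
    exact ⟨fun ⟨a, b⟩ => a.natDegree_eq_zero.1 b, by rintro rfl; simp⟩
  rw [monicSum, this, Finset.sum_singleton, h1]

end MonicPolynomials

/-! ### The L-function of a Kloosterman sum. -/

section KloostermanLFunction

open Polynomial

variable {k : Type*} [Field k]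

open Classical in
/-- For a monic polynomial `f = ∏ (X - xᵢ)` with `f(0) ≠ 0`, the value
`ψ (∑ xᵢ + b ∑ xᵢ⁻¹)`; for `f(0) = 0`, zero. -/
noncomputable def kloostermanChar (ψ : AddChar k ℂ) (b : k) (f : k[X]) : ℂ :=
  if f.coeff 0 = 0 then 0 else ψ (-f.nextCoeff - b * (f.coeff 1 / f.coeff 0))

/-- For `f = ∏ (X - xᵢ)`, `f.nextCoeff` and `f.coeff 1 / f.coeff 0` are `-∑ xᵢ` and `-∑ xᵢ⁻¹`, hence
additive under products. -/
theorem kloostermanChar_mul (ψ : AddChar k ℂ) (b : k) (f g : k[X]) (hf : f.Monic) (hg : g.Monic) :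
    kloostermanChar ψ b (f * g) = kloostermanChar ψ b f * kloostermanChar ψ b g := by
  unfold kloostermanChar
  rw [mul_coeff_zero]
  by_cases h1 : f.coeff 0 = 0
  · simp [h1]
  by_cases h2 : g.coeff 0 = 0
  · simp [h2]
  rw [if_neg (mul_ne_zero h1 h2), if_neg h1, if_neg h2, ← AddChar.map_add_eq_mul,
    hf.nextCoeff_mul hg, mul_coeff_one]
  congr 1
  field_simp
  ring

theorem kloostermanChar_one (ψ : AddChar k ℂ) (b : k) : kloostermanChar ψ b 1 = 1 := by
  simp [kloostermanChar, coeff_one, nextCoeff]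

/-- The reversed minimal polynomial of `x`, made monic, vanishes at `x⁻¹`; it is minimal there
because `x` and `x⁻¹` generate the same field. -/
theorem coeff_one_div_coeff_zero_minpoly {F : Type*} [Field F] [Finite F] [Algebra k F] {x : F} (hx : x ≠ 0) :
    (minpoly k x⁻¹).nextCoeff = (minpoly k x).coeff 1 / (minpoly k x).coeff 0 := by
  have hint : IsIntegral k x := .of_finite k x
  have hint' : IsIntegral k x⁻¹ := .of_finite k x⁻¹
  set P := minpoly k x with hP
  have hP0 : P.coeff 0 ≠ 0 := minpoly.coeff_zero_ne_zero hint hx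
  have hd : 0 < P.natDegree := minpoly.natDegree_pos hint
  have htr : P.natTrailingDegree = 0 := natTrailingDegree_eq_zero.2 (Or.inr hP0)
  have hrd : P.reverse.natDegree = P.natDegree := by rw [reverse_natDegree, htr, Nat.sub_zero]
  have hlead : P.reverse.leadingCoeff = P.coeff 0 := by
    rw [reverse_leadingCoeff, trailingCoeff, htr]
  set R := C (P.coeff 0)⁻¹ * P.reverse with hR
  have hRm : R.Monic := by
    rw [hR, Monic, leadingCoeff_mul, leadingCoeff_C, hlead, inv_mul_cancel₀ hP0]
  have hRd : R.natDegree = P.natDegree := by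
    rw [hR, natDegree_C_mul (inv_ne_zero hP0), hrd]
  have hroot : aeval x⁻¹ R = 0 := by
    have : Invertible x := invertibleOfNonzero hx
    have h1 := (eval₂_reverse_eq_zero_iff (algebraMap k F) x P).2 (minpoly.aeval k x)
    rw [invOf_eq_inv] at h1
    rw [hR, map_mul, aeval_def, aeval_def, h1, mul_zero]
  have hdeg : (minpoly k x⁻¹).natDegree = P.natDegree := by
    rw [hP, ← IntermediateField.adjoin.finrank hint, ← IntermediateField.adjoin.finrank hint']
    have : IntermediateField.adjoin k {x⁻¹} = IntermediateField.adjoin k {x} := by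
      apply le_antisymm
      · rw [IntermediateField.adjoin_simple_le_iff]
        exact inv_mem (IntermediateField.mem_adjoin_simple_self k x)
      · rw [IntermediateField.adjoin_simple_le_iff]
        have h := inv_mem (IntermediateField.mem_adjoin_simple_self k x⁻¹)
        rwa [inv_inv] at h
    rw [this]
  have hdvd : minpoly k x⁻¹ ∣ R := minpoly.dvd k _ hroot
  have heq : R = minpoly k x⁻¹ :=
    eq_of_monic_of_dvd_of_natDegree_le (minpoly.monic hint') hRm hdvd (by rw [hdeg, hRd])
  rw [← heq, nextCoeff_of_natDegree_pos (by omega), hRd, hR, coeff_C_mul, coeff_reverse,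
    revAt_le (by omega), Nat.sub_sub_self hd]
  field_simp

/-- The trace from `F` is `[F : k(x)]` times the trace from `k(x)`, which is minus `nextCoeff` of
the minimal polynomial; this degree is the exponent. -/
theorem addChar_trace_eq_kloostermanChar_pow (ψ : AddChar k ℂ) (b : k) {F : Type*} [Field F] [Finite F] [Algebra k F] {x : F} (hx : x ≠ 0) :
    ψ (Algebra.trace k F (x + algebraMap k F b * x⁻¹)) =
      kloostermanChar ψ b (minpoly k x) ^ (Module.finrank k F / (minpoly k x).natDegree) := by
  have hint : IsIntegral k x := .of_finite k x
  have hint' : IsIntegral k x⁻¹ := .of_finite k x⁻¹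
  have hP0 : (minpoly k x).coeff 0 ≠ 0 := minpoly.coeff_zero_ne_zero hint hx
  have hK : IntermediateField.adjoin k {x⁻¹} = IntermediateField.adjoin k {x} := by
    apply le_antisymm
    · rw [IntermediateField.adjoin_simple_le_iff]
      exact inv_mem (IntermediateField.mem_adjoin_simple_self k x)
    · rw [IntermediateField.adjoin_simple_le_iff]
      have h := inv_mem (IntermediateField.mem_adjoin_simple_self k x⁻¹)
      rwa [inv_inv] at h
  have hm : Module.finrank k F / (minpoly k x).natDegree =
      Module.finrank (IntermediateField.adjoin k {x}) F := by
    rw [← IntermediateField.adjoin.finrank hint, ← Module.finrank_mul_finrank k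
      (IntermediateField.adjoin k {x}) F, Nat.mul_div_cancel_left _ Module.finrank_pos]
  rw [hm, kloostermanChar, if_neg hP0, ← AddChar.map_nsmul_eq_pow, map_add, ← Algebra.smul_def,
    map_smul, trace_eq_finrank_mul_minpoly_nextCoeff, trace_eq_finrank_mul_minpoly_nextCoeff, hK,
    coeff_one_div_coeff_zero_minpoly hx, nsmul_eq_mul, smul_eq_mul]
  congr 1
  ring

variable [Fintype k]

/-- Adding `t X ^ (n - 1)` permutes the monic polynomials of degree `n`. For `n ≥ 3` it leaves
coefficients `0` and `1` alone and only shifts `nextCoeff`, so the sum is multiplied by a root of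
unity that can be chosen different from `1`. -/
theorem monicSum_kloostermanChar_of_three_le {ψ : AddChar k ℂ} (hψ : ψ ≠ 1) (b : k) {n : ℕ}
    (hn : 3 ≤ n) : monicSum (kloostermanChar ψ b) n = 0 := by
  obtain ⟨t, ht⟩ : ∃ t, ψ t ≠ 1 := by
    by_contra! h
    exact hψ (DFunLike.ext _ _ fun x => by rw [h x, AddChar.one_apply])
  have hmem : ∀ s, ∀ f ∈ monicsOfDegree k n, f + C s * X ^ (n - 1) ∈ monicsOfDegree k n := by
    intro s f hf
    obtain ⟨a, b⟩ := mem_monicsOfDegree.1 hf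
    have hlt : (C s * X ^ (n - 1) : k[X]).degree < f.degree := by
      rw [degree_eq_natDegree a.ne_zero, b]
      exact (degree_C_mul_X_pow_le _ _).trans_lt (WithBot.coe_lt_coe.2 (Nat.sub_lt (by omega) one_pos))
    exact mem_monicsOfDegree.2 ⟨a.add_of_left hlt, by
      rw [natDegree_add_eq_left_of_degree_lt hlt, b]⟩
  have h1 : monicSum (kloostermanChar ψ b) n = ψ t * monicSum (kloostermanChar ψ b) n := by
    conv_rhs => rw [monicSum, Finset.mul_sum]
    refine Finset.sum_nbij' (fun f => f + C t * X ^ (n - 1)) (fun f => f + C (-t) * X ^ (n - 1))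
      (hmem t) (hmem (-t)) (fun f _ => by simp) (fun f _ => by simp) (fun f hf => ?_)
    obtain ⟨a, b'⟩ := mem_monicsOfDegree.1 hf
    obtain ⟨a2, b2⟩ := mem_monicsOfDegree.1 (hmem t f hf)
    have c0 : (f + C t * X ^ (n - 1)).coeff 0 = f.coeff 0 := by
      rw [coeff_add, coeff_C_mul_X_pow, if_neg (by omega), add_zero]
    have c1 : (f + C t * X ^ (n - 1)).coeff 1 = f.coeff 1 := by
      rw [coeff_add, coeff_C_mul_X_pow, if_neg (by omega), add_zero]
    have c2 : (f + C t * X ^ (n - 1)).nextCoeff = f.nextCoeff + t := by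
      rw [nextCoeff_of_natDegree_pos (by omega), nextCoeff_of_natDegree_pos (by omega), b', b2,
        coeff_add, coeff_C_mul_X_pow, if_pos rfl]
    unfold kloostermanChar
    rw [c0, c1, c2]
    split_ifs
    · simp
    · rw [← AddChar.map_add_eq_mul]; congr 1; ring
  have h2 : (1 - ψ t) * monicSum (kloostermanChar ψ b) n = 0 := by
    rw [sub_mul, one_mul, ← h1, sub_self]
  exact (mul_eq_zero.1 h2).resolve_left (sub_ne_zero.2 ht.symm)

/-- On `X ^ 2 + u X + v` with `v ≠ 0` the value is `ψ (u (-1 - b / v))`; summation over `u` leaves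
only `v = -b`. -/
theorem monicSum_kloostermanChar_two {ψ : AddChar k ℂ} (hψ : ψ ≠ 1) {b : k} (hb : b ≠ 0) :
    monicSum (kloostermanChar ψ b) 2 = Fintype.card k := by
  classical
  have hdeg : ∀ u v : k, (C u * X + C v : k[X]).degree < (2 : ℕ) := fun u v =>
    degree_linear_le.trans_lt (by norm_num)
  have hnat : ∀ u v : k, (X ^ 2 + (C u * X + C v) : k[X]).natDegree = 2 := fun u v => by
    rw [natDegree_add_eq_left_of_degree_lt (by rw [degree_X_pow]; exact hdeg u v), natDegree_X_pow]
  have h1 : monicSum (kloostermanChar ψ b) 2 =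
      ∑ x : k × k, kloostermanChar ψ b (X ^ 2 + (C x.1 * X + C x.2)) := by
    symm
    refine Finset.sum_nbij' (fun x => X ^ 2 + (C x.1 * X + C x.2))
      (fun f => (f.coeff 1, f.coeff 0)) (fun x _ => ?_) (fun f _ => Finset.mem_univ _)
      (fun x _ => ?_) (fun f hf => ?_) (fun x _ => rfl)
    · exact mem_monicsOfDegree.2 ⟨monic_X_pow_add (hdeg _ _), hnat _ _⟩
    · ext <;> simp [coeff_X_pow, coeff_X, coeff_C]
    · obtain ⟨a, b⟩ := mem_monicsOfDegree.1 hf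
      conv_rhs => rw [a.as_sum, b]
      simp [Finset.sum_range_succ]
      ring
  rw [h1, Fintype.sum_prod_type, Finset.sum_comm]
  have h2 : ∀ v : k, ∑ u : k, kloostermanChar ψ b (X ^ 2 + (C u * X + C v)) =
      if v = -b then (Fintype.card k : ℂ) else 0 := by
    intro v
    have c0 : ∀ u, (X ^ 2 + (C u * X + C v) : k[X]).coeff 0 = v := fun u => by simp
    have c1 : ∀ u, (X ^ 2 + (C u * X + C v) : k[X]).coeff 1 = u := fun u => by
      simp [coeff_X_pow, coeff_C]
    have c2 : ∀ u, (X ^ 2 + (C u * X + C v) : k[X]).nextCoeff = u := fun u => by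
      rw [nextCoeff_of_natDegree_pos (by rw [hnat]; norm_num), hnat, c1]
    by_cases hv : v = 0
    · subst hv
      rw [if_neg (by simpa [eq_comm] using hb)]
      exact Finset.sum_eq_zero fun u _ => by unfold kloostermanChar; rw [c0, if_pos rfl]
    have h3 : ∀ u, kloostermanChar ψ b (X ^ 2 + (C u * X + C v)) = ψ (u * (-1 - b / v)) := by
      intro u
      unfold kloostermanChar
      rw [c0, c1, c2, if_neg hv]
      congr 1
      field_simp
    simp_rw [h3]
    rw [AddChar.sum_mulShift _ (AddChar.IsPrimitive.of_ne_one hψ)]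
    have : (-1 - b / v = 0) ↔ v = -b := by
      field_simp
      constructor <;> intro h <;> linear_combination -h
    simp only [this]
    split_ifs <;> simp
  simp_rw [h2]
  simp

variable {F : Type*} [Field F] [Fintype F] [Algebra k F]

-- The degree of `P` divides that of `F`, so `P` divides `X ^ |F| - X` and has as many roots in `F`
-- as its degree.
open Classical in
theorem card_filter_minpoly_eq {P : k[X]} (hm : P.Monic) (hi : Irreducible P)
    (hd : P.natDegree ∣ Module.finrank k F) :
    (Finset.univ.filter fun x : F => minpoly k x = P).card = P.natDegree := by
  have hspl : (P.map (algebraMap k F)).Splits := by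
    have h1 := (hi.natDegree_dvd_iff_dvd_X_pow_card_pow_sub_X).1 hd
    rw [← Module.natCard_eq_pow_finrank, ← Fintype.card_eq_nat_card] at h1
    have h2 := FiniteField.isSplittingField_sub F k
    refine Splits.of_dvd h2.splits ?_ (map_dvd (mapRingHom (algebraMap k F)) h1)
    exact map_ne_zero (FiniteField.X_pow_card_sub_X_ne_zero _ Fintype.one_lt_card)
  have hsep : P.Separable := PerfectField.separable_of_irreducible hi
  rw [← card_rootSet_eq_natDegree hsep hspl, ← Set.toFinset_card]
  congr 1
  ext x
  simp only [Finset.mem_filter, Finset.mem_univ, true_and, Set.mem_toFinset]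
  rw [mem_rootSet_of_ne hm.ne_zero]
  constructor
  · rintro rfl; exact minpoly.aeval k x
  · intro h; exact (minpoly.eq_of_irreducible_of_monic hi h hm).symm

/-- The Kloosterman sum over a finite extension, in terms of irreducible polynomials over the
base field. -/
theorem sum_units_addChar_trace_eq_primePowerSum [DecidableEq F] (ψ : AddChar k ℂ) (b : k) :
    ∑ x : Fˣ, ψ (Algebra.trace k F (x + algebraMap k F b * (x⁻¹ : Fˣ))) =
      primePowerSum (kloostermanChar ψ b) (Module.finrank k F) := by
  classical
  set n := Module.finrank k F with hn
  have hn0 : 0 < n := Module.finrank_pos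
  have hdvd : ∀ x : F, (minpoly k x).natDegree ∣ n := fun x => by
    rw [← IntermediateField.adjoin.finrank (.of_finite k x)]
    exact IntermediateField.finrank_dvd_of_le_right le_top |>.trans (by simp [hn])
  have h1 : ∑ x : Fˣ, ψ (Algebra.trace k F (x + algebraMap k F b * (x⁻¹ : Fˣ))) =
      ∑ x : F, kloostermanChar ψ b (minpoly k x) ^ (n / (minpoly k x).natDegree) := by
    have h2 : kloostermanChar ψ b (minpoly k (0 : F)) ^ (n / (minpoly k (0 : F)).natDegree) = 0 := by
      rw [minpoly.zero]
      simp [kloostermanChar, hn0.ne']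
    rw [← Finset.sum_erase (f := fun x : F => kloostermanChar ψ b (minpoly k x) ^
      (n / (minpoly k x).natDegree)) _ h2]
    refine Finset.sum_bij (fun x _ => (x : F)) (fun x _ => by simp) (fun x _ y _ h => Units.ext h)
      (fun x hx => ⟨Units.mk0 x (Finset.ne_of_mem_erase hx), Finset.mem_univ _, rfl⟩)
      (fun x _ => ?_)
    rw [Units.val_inv_eq_inv_val, addChar_trace_eq_kloostermanChar_pow ψ b x.ne_zero]
  rw [h1, primePowerSum, ← Finset.sum_fiberwise_of_maps_to
    (t := (monicIrreducibles k n).filter (fun P => P.natDegree ∣ n)) (g := minpoly k)]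
  · refine Finset.sum_congr rfl fun P hP => ?_
    obtain ⟨hP1, hP2⟩ := Finset.mem_filter.1 hP
    obtain ⟨hm, hi, hd⟩ := mem_monicIrreducibles.1 hP1
    rw [← card_filter_minpoly_eq (F := F) hm hi hP2, ← nsmul_eq_mul, ← Finset.sum_const]
    refine Finset.sum_congr rfl fun x hx => ?_
    rw [(Finset.mem_filter.1 hx).2, card_filter_minpoly_eq (F := F) hm hi hP2]
  · intro x _
    refine Finset.mem_filter.2 ⟨mem_monicIrreducibles.2 ⟨minpoly.monic (.of_finite k x),
      minpoly.irreducible (.of_finite k x), Nat.le_of_dvd hn0 (hdvd x)⟩, hdvd x⟩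

end KloostermanLFunction

/-! ### Weil's bound for prime moduli. -/

section WeilBound

/-- The L-function is `1 + Λ(1) T + |k| T ^ 2 = (1 - α T) (1 - β T)`, and Newton's identities become
the recurrence satisfied by `-(α ^ n + β ^ n)`. -/
theorem primePowerSum_kloostermanChar_eq {k : Type*} [Field k] [Fintype k] {ψ : AddChar k ℂ}
    (hψ : ψ ≠ 1) {b : k} (hb : b ≠ 0) {α β : ℂ} (hαβ : α * β = Fintype.card k)
    (hsum : α + β = -primePowerSum (kloostermanChar ψ b) 1) {n : ℕ} (hn : 0 < n) :
    primePowerSum (kloostermanChar ψ b) n = -(α ^ n + β ^ n) := by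
  set Λ := primePowerSum (kloostermanChar ψ b)
  have newton := natCast_mul_monicSum (kloostermanChar ψ b) (kloostermanChar_mul ψ b)
    (kloostermanChar_one ψ b)
  have h0 := monicSum_zero (kloostermanChar ψ b) (kloostermanChar_one ψ b)
  have h2 := monicSum_kloostermanChar_two hψ hb
  have h1 : monicSum (kloostermanChar ψ b) 1 = Λ 1 := by
    have := newton 1
    simpa [h0] using this
  induction n using Nat.strong_induction_on with
  | _ n ih =>
    rcases (by omega : n = 1 ∨ n = 2 ∨ 3 ≤ n) with rfl | rfl | h3
    · linear_combination hsum
    · have := newton 2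
      rw [show Finset.Icc 1 2 = {1, 2} by rfl, Finset.sum_pair (by norm_num)] at this
      simp only [Nat.reduceSub, h0, h1, h2, ← hαβ] at this
      push_cast at this
      change 2 * (α * β) = Λ 1 * Λ 1 + Λ 2 * 1 at this
      have h4 : Λ 1 = -(α + β) := by rw [hsum, neg_neg]
      rw [h4] at this
      linear_combination -this
    · obtain ⟨m, rfl⟩ : ∃ m, n = m + 3 := ⟨n - 3, by omega⟩
      have := newton (m + 3)
      rw [monicSum_kloostermanChar_of_three_le hψ b h3, mul_zero, Finset.sum_Icc_succ_top (by omega),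
        Finset.sum_Icc_succ_top (by omega), Finset.sum_Icc_succ_top (by omega),
        Finset.sum_eq_zero (fun j hj => by
          rw [Finset.mem_Icc] at hj
          rw [monicSum_kloostermanChar_of_three_le hψ b (by omega), mul_zero])] at this
      rw [show m + 3 - (m + 0 + 1) = 2 by omega, show m + 3 - (m + 1 + 1) = 1 by omega,
        show m + 3 - (m + 2 + 1) = 0 by omega, h0, h1, h2, ← hαβ] at this
      have e1 := ih (m + 1) (by omega) (by omega)
      have e2 := ih (m + 2) (by omega) (by omega)
      have h4 : Λ 1 = -(α + β) := by rw [hsum, neg_neg]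
      change 0 = 0 + Λ (m + 1) * (α * β) + Λ (m + 2) * Λ 1 + Λ (m + 3) * 1 at this
      rw [e1, e2, h4] at this
      linear_combination -this

/-- The sum of the reciprocal roots has nonnegative even moments, up to their size on the
critical circle. -/
theorem neg_two_mul_pow_le_of_real_sum {t P : ℝ} (hP : 0 ≤ P) {α β : ℂ} (hsum : α + β = t)
    (hprod : α * β = P) (m : ℕ) : -(2 * P ^ m) ≤ (α ^ (2 * m) + β ^ (2 * m)).re := by
  have hdisc : ((α - β) ^ 2 : ℂ) = ((t ^ 2 - 4 * P : ℝ) : ℂ) := by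
    push_cast
    rw [← hsum, ← hprod]; ring
  have hα : α = (t + (α - β)) / 2 := by rw [← hsum]; ring
  have hβ : β = (t - (α - β)) / 2 := by rw [← hsum]; ring
  have him : 2 * ((α - β).re * (α - β).im) = 0 := by
    have := congrArg Complex.im hdisc
    rw [Complex.ofReal_im, pow_two, Complex.mul_im] at this
    linarith
  have hre : (α - β).re ^ 2 - (α - β).im ^ 2 = t ^ 2 - 4 * P := by
    have := congrArg Complex.re hdisc
    rw [Complex.ofReal_re, pow_two, Complex.mul_re] at this
    linarith
  set δ := α - β
  -- A real quadratic: either both roots have squared norm `P`, or both are real and their even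
  -- powers are nonnegative.
  rcases mul_eq_zero.1 ((mul_eq_zero.1 him).resolve_left two_ne_zero) with h | h
  · have key : ∀ s : ℂ, s.re = t / 2 → s.im ^ 2 = (δ.im / 2) ^ 2 →
        -P ^ m ≤ (s ^ (2 * m)).re := by
      intro s h1 h2
      have hn : ‖s‖ ^ 2 = P := by
        rw [← Complex.normSq_eq_norm_sq, Complex.normSq_apply, h1, ← pow_two s.im, h2]
        rw [h] at hre
        linarith
      have h3 : ‖s ^ (2 * m)‖ = P ^ m := by rw [norm_pow, pow_mul, hn]
      have := Complex.abs_re_le_norm (s ^ (2 * m))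
      rw [h3] at this
      exact (abs_le.1 this).1
    have k1 := key α (by rw [hα]; simp [h]) (by rw [hα]; simp)
    have k2 := key β (by rw [hβ]; simp [h]) (by rw [hβ]; simp; ring)
    rw [Complex.add_re]
    linarith
  · have key : ∀ s : ℂ, s.im = 0 → 0 ≤ (s ^ (2 * m)).re := by
      intro s hs
      have : s = (s.re : ℂ) := Complex.ext rfl (by simp [hs])
      rw [this, ← Complex.ofReal_pow, Complex.ofReal_re, pow_mul]
      positivity
    have k1 := key α (by rw [hα]; simp [h])
    have k2 := key β (by rw [hβ]; simp [h])
    have : 0 ≤ P ^ m := pow_nonneg hP m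
    rw [Complex.add_re]
    linarith

theorem star_addChar {G : Type*} [AddGroup G] [Finite G] (ψ : AddChar G ℂ) (x : G) :
    (starRingEnd ℂ) (ψ x) = ψ (-x) := by
  rw [AddChar.map_neg_eq_inv, Complex.inv_eq_conj (AddChar.norm_apply ψ x)]

theorem sum_addChar_add_inv_im {R : Type*} [CommRing R] [Fintype R] [DecidableEq R]
    (ψ : AddChar R ℂ) (b : R) :
    (∑ x : Rˣ, ψ (x + b * (x⁻¹ : Rˣ))).im = 0 := by
  rw [← Complex.conj_eq_iff_im, map_sum]
  refine Fintype.sum_equiv (Equiv.neg _) _ _ fun x => ?_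
  rw [star_addChar]
  congr 1
  simp
  ring

/-- An averaged form of Weil's bound: the even moments of the reciprocal roots of the Kloosterman
L-functions of all nontrivial additive characters. -/
theorem sum_neg_primePowerSum_re_le {p m : ℕ} [Fact p.Prime] (hp : p ≠ 2) (hm : 2 ≤ m)
    {ψ : AddChar (ZMod p) ℂ} (hψ : ψ ≠ 1) {b : ZMod p} (hb : b ≠ 0) :
    ∑ c ∈ Finset.univ.erase (0 : ZMod p),
      -(primePowerSum (kloostermanChar (ψ.mulShift c) b) (2 * m)).re ≤ 8 * p * (p : ℝ) ^ m := by
  classical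
  let F := GaloisField p (2 * m)
  have : Fintype F := Fintype.ofFinite F
  have hfr : Module.finrank (ZMod p) F = 2 * m := GaloisField.finrank p (by omega)
  have hcard : Fintype.card F = (p ^ m) ^ 2 := by
    rw [Fintype.card_eq_nat_card, GaloisField.card p (2 * m) (by omega), ← pow_mul, mul_comm]
  have hβ : algebraMap (ZMod p) F b ≠ 0 := by simpa using hb
  have hst := card_trace_eq_zero_ge hp hm hcard hβ
  set N := (Finset.univ.filter fun x : Fˣ =>
      Algebra.trace (ZMod p) F (x + algebraMap (ZMod p) F b * (x⁻¹ : Fˣ)) = 0).card with hN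
  -- Orthogonality in `c` leaves the `x` of trace zero, whose number Stepanov's method bounds from
  -- below.
  have hall : ∑ c : ZMod p, primePowerSum (kloostermanChar (ψ.mulShift c) b) (2 * m) =
      ((p * N : ℕ) : ℂ) := by
    simp_rw [← hfr, ← sum_units_addChar_trace_eq_primePowerSum (F := F)]
    rw [Finset.sum_comm]
    simp_rw [AddChar.mulShift_apply]
    simp_rw [AddChar.sum_mulShift _ (AddChar.IsPrimitive.of_ne_one hψ), ZMod.card]
    rw [← Nat.cast_sum, ← Finset.sum_filter, Finset.sum_const, smul_eq_mul, mul_comm]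
  have hzero : primePowerSum (kloostermanChar (ψ.mulShift 0) b) (2 * m) =
      (((p ^ m) ^ 2 - 1 : ℕ) : ℂ) := by
    rw [← hfr, ← sum_units_addChar_trace_eq_primePowerSum (F := F)]
    simp only [AddChar.mulShift_zero, AddChar.one_apply, Finset.sum_const, nsmul_eq_mul, mul_one,
      Finset.card_univ]
    rw [Fintype.card_eq_nat_card, Nat.card_units, ← Fintype.card_eq_nat_card, hcard]
  rw [← Finset.add_sum_erase _ _ (Finset.mem_univ (0 : ZMod p)), hzero] at hall
  have hre := congrArg Complex.re hall
  rw [Complex.add_re, Complex.natCast_re, Complex.natCast_re, Complex.re_sum] at hre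
  rw [Finset.sum_neg_distrib]
  have h1 : (((p ^ m) ^ 2 - 1 : ℕ) : ℝ) ≤ ((p : ℝ) ^ m) ^ 2 := by
    calc (((p ^ m) ^ 2 - 1 : ℕ) : ℝ) ≤ (((p ^ m) ^ 2 : ℕ) : ℝ) := by
          exact_mod_cast Nat.sub_le _ _
      _ = _ := by push_cast; ring
  have h2 : ((p : ℝ) ^ m) ^ 2 ≤ ((p * N : ℕ) : ℝ) + 8 * p * (p : ℝ) ^ m := by
    exact_mod_cast hst
  linarith

/-- **Weil's bound** for Kloosterman sums of prime modulus. -/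
theorem norm_sum_addChar_add_inv_le {p : ℕ} [Fact p.Prime] {ψ : AddChar (ZMod p) ℂ} (hψ : ψ ≠ 1)
    {b : ZMod p} (hb : b ≠ 0) :
    ‖∑ x : (ZMod p)ˣ, ψ (x + b * (x⁻¹ : (ZMod p)ˣ))‖ ≤ 2 * √p := by
  classical
  have hp0 : (0 : ℝ) < p := by exact_mod_cast (Fact.out : p.Prime).pos
  rcases eq_or_ne p 2 with rfl | hp
  · refine (norm_sum_le _ _).trans ?_
    simp only [AddChar.norm_apply, Finset.sum_const, Finset.card_univ, ZMod.card_units_eq_totient,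
      Nat.totient_two, one_smul]
    have : (1 : ℝ) ≤ √(2 : ℕ) := Real.one_le_sqrt.2 (by norm_num)
    linarith
  have hL1 : ∀ φ : AddChar (ZMod p) ℂ, primePowerSum (kloostermanChar φ b) 1 =
      ((∑ x : (ZMod p)ˣ, φ (x + b * (x⁻¹ : (ZMod p)ˣ))).re : ℂ) := by
    intro φ
    have h := sum_units_addChar_trace_eq_primePowerSum (F := ZMod p) φ b
    simp only [Module.finrank_self, Algebra.trace_self_apply, Algebra.algebraMap_self,
      RingHom.id_apply] at h
    rw [← h]
    exact Complex.ext (by rw [Complex.ofReal_re])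
      (by rw [Complex.ofReal_im]; exact sum_addChar_add_inv_im φ b)
  set K : AddChar (ZMod p) ℂ → ℝ :=
    fun φ => (∑ x : (ZMod p)ˣ, φ (x + b * (x⁻¹ : (ZMod p)ˣ))).re with hK
  have hnorm : ‖∑ x : (ZMod p)ˣ, ψ (x + b * (x⁻¹ : (ZMod p)ˣ))‖ = |K ψ| := by
    rw [← Real.norm_eq_abs, ← Complex.norm_real]
    congr 1
    exact Complex.ext (by rw [Complex.ofReal_re])
      (by rw [Complex.ofReal_im]; exact sum_addChar_add_inv_im ψ b)
  rw [hnorm]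
  -- If the bound failed, the reciprocal roots would be real, one exceeding `√p` in absolute value.
  -- Its even moments would outgrow the averaged bound, since every other character contributes at
  -- least `-2 * p ^ m`.
  by_contra! hlt
  have hlt2 : 4 * p < K ψ ^ 2 := by
    have h1 : (2 * √p) ^ 2 < |K ψ| ^ 2 := by gcongr
    rwa [mul_pow, Real.sq_sqrt hp0.le, sq_abs, show (2 : ℝ) ^ 2 = 4 by norm_num] at h1
  have hroots : ∀ φ : AddChar (ZMod p) ℂ, ∃ α β : ℂ, α * β = p ∧ α + β = -(K φ : ℂ) := by
    intro φ
    obtain ⟨s, hs⟩ := IsSepClosed.exists_pow_nat_eq ((K φ : ℂ) ^ 2 - 4 * p) 2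
    exact ⟨(-(K φ) + s) / 2, (-(K φ) - s) / 2, by linear_combination -hs / 4, by ring⟩
  have hlower : ∀ φ : AddChar (ZMod p) ℂ, φ ≠ 1 → ∀ m, 0 < m →
      -(2 * (p : ℝ) ^ m) ≤ -(primePowerSum (kloostermanChar φ b) (2 * m)).re := by
    intro φ hφ m hm
    obtain ⟨α, β, h1, h2⟩ := hroots φ
    rw [primePowerSum_kloostermanChar_eq hφ hb (by rw [h1, ZMod.card]) (by rw [h2, hL1])
      (by omega : 0 < 2 * m), Complex.neg_re, neg_neg]
    exact neg_two_mul_pow_le_of_real_sum hp0.le (t := -K φ) (by rw [h2]; push_cast; rfl)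
      (by rw [h1]; simp) m
  set s := √(K ψ ^ 2 - 4 * p) with hs
  have hs2 : s ^ 2 = K ψ ^ 2 - 4 * p := Real.sq_sqrt (by linarith)
  set α : ℝ := (-K ψ + s) / 2 with hα
  set β : ℝ := (-K ψ - s) / 2 with hβ
  have hprod : α * β = p := by rw [hα, hβ]; linear_combination -hs2 / 4
  have hsum : α + β = -K ψ := by rw [hα, hβ]; ring
  -- As `α ^ 2 + β ^ 2 = K ψ ^ 2 - 2 * p > 2 * p`, one of the squares exceeds `p`; `r` is its ratio
  -- to `p`.
  obtain ⟨r, hr, hrle⟩ : ∃ r : ℝ, 1 < r ∧ ∀ m, (p * r) ^ m ≤ α ^ (2 * m) + β ^ (2 * m) := by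
    have hpos : ∀ x : ℝ, ∀ m : ℕ, 0 ≤ x ^ (2 * m) := fun x m => by rw [pow_mul]; positivity
    rcases le_or_gt (α ^ 2) p with h | h
    · refine ⟨β ^ 2 / p, ?_, fun m => ?_⟩
      · rw [one_lt_div hp0]
        have : α ^ 2 + β ^ 2 = K ψ ^ 2 - 2 * p := by rw [hα, hβ]; linear_combination hs2 / 2
        linarith
      · rw [mul_div_cancel₀ _ hp0.ne', ← pow_mul]
        linarith [hpos α m]
    · refine ⟨α ^ 2 / p, by rwa [one_lt_div hp0], fun m => ?_⟩
      rw [mul_div_cancel₀ _ hp0.ne', ← pow_mul]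
      linarith [hpos β m]
  have hbig : ∀ m, 0 < m →
      (p * r) ^ m ≤ -(primePowerSum (kloostermanChar ψ b) (2 * m)).re := by
    intro m hm
    rw [primePowerSum_kloostermanChar_eq hψ hb (α := α) (β := β)
      (by rw [ZMod.card]; exact_mod_cast hprod) (by rw [hL1]; exact_mod_cast hsum)
      (by omega : 0 < 2 * m), Complex.neg_re, neg_neg]
    exact_mod_cast hrle m
  -- Of the `10 * p`, the average accounts for `8 * p` and the at most `p` other characters for `2 *
  -- p`.
  have hbound : ∀ m, 2 ≤ m → r ^ m ≤ 10 * p := by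
    intro m hm
    have h1 := sum_neg_primePowerSum_re_le hp hm hψ hb
    rw [← Finset.add_sum_erase _ _ (show (1 : ZMod p) ∈ Finset.univ.erase 0 by simp),
      AddChar.mulShift_one] at h1
    have h2 : -(p * (2 * (p : ℝ) ^ m)) ≤ ∑ c ∈ (Finset.univ.erase (0 : ZMod p)).erase 1,
        -(primePowerSum (kloostermanChar (ψ.mulShift c) b) (2 * m)).re := by
      have h3 : ∀ c ∈ (Finset.univ.erase (0 : ZMod p)).erase 1, -(2 * (p : ℝ) ^ m) ≤
          -(primePowerSum (kloostermanChar (ψ.mulShift c) b) (2 * m)).re := by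
        intro c hc
        have hc0 : c ≠ 0 := Finset.ne_of_mem_erase (Finset.mem_of_mem_erase hc)
        exact hlower _ ((AddChar.IsPrimitive.of_ne_one hψ) hc0) m (by omega)
      refine le_trans ?_ (Finset.card_nsmul_le_sum _ _ _ h3)
      have h4 : ((Finset.univ.erase (0 : ZMod p)).erase 1).card ≤ p := by
        refine (Finset.card_le_univ _).trans (by rw [ZMod.card])
      have h5 : (((Finset.univ.erase (0 : ZMod p)).erase 1).card : ℝ) ≤ p := by exact_mod_cast h4
      rw [nsmul_eq_mul]
      have : 0 ≤ 2 * (p : ℝ) ^ m := by positivity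
      nlinarith
    have h3 := hbig m (by omega)
    have h4 : (p : ℝ) ^ m * r ^ m ≤ (p : ℝ) ^ m * (10 * p) := by
      rw [← mul_pow]; linarith
    exact le_of_mul_le_mul_left h4 (by positivity)
  obtain ⟨m, hm⟩ := pow_unbounded_of_one_lt (10 * (p : ℝ)) hr
  have h1 := hbound (m + 2) (by omega)
  have h2 : r ^ m ≤ r ^ (m + 2) := pow_le_pow_right₀ hr.le (by omega)
  linarith

end WeilBound

/-! ### Kloosterman sums modulo prime powers by stationary phase. -/

section PrimePowers

theorem card_filter_natCast_mul_eq_zero_le {N : ℕ} [NeZero N] {d : ℕ} (hd : 0 < d) :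
    (Finset.univ.filter fun s : ZMod N => (d : ZMod N) * s = 0).card ≤ d := by
  simpa only [nsmul_eq_mul] using IsAddCyclic.card_nsmul_eq_zero_le (α := ZMod N) hd

theorem star_stdAddChar {N : ℕ} [NeZero N] (x : ZMod N) :
    (starRingEnd ℂ) (ZMod.stdAddChar x) = ZMod.stdAddChar (-x) := star_addChar _ _

/-- Squaring and differencing of a quadratic exponential sum. -/
theorem norm_quadratic_sum_sq_le {N : ℕ} [NeZero N] (A B : ZMod N) :
    ‖∑ t : ZMod N, (ZMod.stdAddChar (A * t + B * t ^ 2) : ℂ)‖ ^ 2 ≤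
      N * (Finset.univ.filter fun s : ZMod N => 2 * B * s = 0).card := by
  have h1 : ((‖∑ t : ZMod N, (ZMod.stdAddChar (A * t + B * t ^ 2) : ℂ)‖ ^ 2 : ℝ) : ℂ) =
      ∑ s : ZMod N, ZMod.stdAddChar (A * s + B * s ^ 2) *
        (if 2 * B * s = 0 then (N : ℂ) else 0) := by
    rw [Complex.ofReal_pow, ← Complex.mul_conj', map_sum, Finset.sum_mul_sum, Finset.sum_comm]
    simp_rw [star_stdAddChar, ← AddChar.map_add_eq_mul]
    have h2 : ∀ t : ZMod N, ∑ t' : ZMod N,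
        (ZMod.stdAddChar (A * t' + B * t' ^ 2 + -(A * t + B * t ^ 2)) : ℂ) =
        ∑ s : ZMod N, ZMod.stdAddChar (A * s + B * s ^ 2) *
          ZMod.stdAddChar (t * (2 * B * s)) := by
      intro t
      refine Fintype.sum_equiv (Equiv.subRight t) _ _ fun t' => ?_
      rw [← AddChar.map_add_eq_mul]
      congr 1
      simp only [Equiv.subRight_apply]
      ring
    simp_rw [h2]
    rw [Finset.sum_comm]
    refine Finset.sum_congr rfl fun s _ => ?_
    rw [← Finset.mul_sum, AddChar.sum_mulShift _ (ZMod.isPrimitive_stdAddChar N), ZMod.card]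
    split_ifs <;> simp
  have h3 : ‖((‖∑ t : ZMod N, (ZMod.stdAddChar (A * t + B * t ^ 2) : ℂ)‖ ^ 2 : ℝ) : ℂ)‖ ≤
      N * (Finset.univ.filter fun s : ZMod N => 2 * B * s = 0).card := by
    rw [h1]
    refine (norm_sum_le _ _).trans ?_
    simp_rw [norm_mul, AddChar.norm_apply, one_mul]
    have h4 : (N : ℝ) * (Finset.univ.filter fun s : ZMod N => 2 * B * s = 0).card =
        ∑ s : ZMod N, if 2 * B * s = 0 then (N : ℝ) else 0 := by
      rw [← Finset.sum_filter, Finset.sum_const, nsmul_eq_mul, mul_comm]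
    rw [h4]
    refine Finset.sum_le_sum fun s _ => ?_
    split_ifs <;> simp
  rwa [Complex.norm_real, Real.norm_of_nonneg (by positivity)] at h3

/-- Since `B * e = 0`, the translation `t ↦ t + e * r` multiplies the sum by the character value at
`A * e * r`, which must therefore be `1` for all `r`. -/
theorem mul_eq_zero_of_quadratic_sum_ne_zero {N : ℕ} [NeZero N] {A B e : ZMod N} (hB : B * e = 0)
    (h : ∑ t : ZMod N, (ZMod.stdAddChar (A * t + B * t ^ 2) : ℂ) ≠ 0) : A * e = 0 := by
  by_contra hA
  refine ZMod.isPrimitive_stdAddChar N hA (DFunLike.ext _ _ fun r => ?_)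
  rw [AddChar.mulShift_apply, AddChar.one_apply]
  refine mul_right_cancel₀ h ?_
  rw [one_mul, Finset.mul_sum]
  refine Fintype.sum_equiv (Equiv.addRight (e * r)) _ _ fun t => ?_
  rw [← AddChar.map_add_eq_mul]
  congr 1
  simp only [Equiv.coe_addRight]
  linear_combination (-2 * t * r - e * r ^ 2) * hB

/-- Split `p ^ j` between `a` and `b`. The smaller power divides both, hence divides `a - b` and so
`2`; the factor `2` absorbs it. It matters only for `p = 2`. -/
theorem pow_dvd_two_mul_of_pow_dvd_mul {p j : ℕ} (hp : p.Prime) {a b : ℤ} (hab : a - b ∣ 2)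
    (h : (p : ℤ) ^ j ∣ a * b) : (p : ℤ) ^ j ∣ 2 * a ∨ (p : ℤ) ^ j ∣ 2 * b := by
  have hp' : Prime (p : ℤ) := Nat.prime_iff_prime_int.1 hp
  obtain ⟨c, d, hc, hd, hcd⟩ := exists_dvd_and_dvd_of_dvd_mul h
  obtain ⟨i, hi, hci⟩ := (dvd_prime_pow hp' j).1 (hcd ▸ dvd_mul_right c d : c ∣ (p : ℤ) ^ j)
  obtain ⟨l, hl, hdl⟩ := (dvd_prime_pow hp' j).1 (hcd ▸ dvd_mul_left d c : d ∣ (p : ℤ) ^ j)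
  have hc' : (p : ℤ) ^ i ∣ a := hci.symm.dvd.trans hc
  have hd' : (p : ℤ) ^ l ∣ b := hdl.symm.dvd.trans hd
  have hdvd : (p : ℤ) ^ j ∣ (p : ℤ) ^ i * (p : ℤ) ^ l := by
    rw [hcd]; exact mul_dvd_mul hci.dvd hdl.dvd
  rcases le_total i l with hil | hil
  · right
    have : (p : ℤ) ^ i ∣ 2 := (dvd_sub hc' ((pow_dvd_pow _ hil).trans hd')).trans hab
    exact hdvd.trans (mul_dvd_mul this hd')
  · left
    have : (p : ℤ) ^ l ∣ 2 := (dvd_sub ((pow_dvd_pow _ hil).trans hc') hd').trans hab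
    refine hdvd.trans ?_
    rw [mul_comm]
    exact mul_dvd_mul this hc'

theorem two_mul_pow_mul_eq_zero_of_sq_eq_one {p k i : ℕ} (hp : p.Prime) (hi : i ≤ k)
    {y : ZMod (p ^ k)} (h : (p : ZMod (p ^ k)) ^ i * (y ^ 2 - 1) = 0) :
    (2 * p ^ i : ZMod (p ^ k)) * (y - 1) = 0 ∨ (2 * p ^ i : ZMod (p ^ k)) * (y + 1) = 0 := by
  obtain ⟨z, rfl⟩ := ZMod.intCast_surjective y
  have key : ∀ w : ℤ, (p : ZMod (p ^ k)) ^ i * w = 0 ↔ (p : ℤ) ^ (k - i) ∣ w := fun w => by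
    have h1 : (p : ZMod (p ^ k)) ^ i * w = (((p : ℤ) ^ i * w : ℤ) : ZMod (p ^ k)) := by
      push_cast; ring
    rw [h1, ZMod.intCast_zmod_eq_zero_iff_dvd]
    push_cast
    conv_lhs => rw [← Nat.add_sub_cancel' hi, pow_add]
    exact mul_dvd_mul_iff_left (pow_ne_zero _ (by exact_mod_cast hp.ne_zero))
  have h1 : (p : ZMod (p ^ k)) ^ i * (((z - 1) * (z + 1) : ℤ) : ZMod (p ^ k)) = 0 := by
    rw [← h]; push_cast; ring
  rw [key] at h1
  rcases pow_dvd_two_mul_of_pow_dvd_mul hp (⟨-1, by ring⟩) h1 with h2 | h2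
  · left
    rw [← key] at h2
    rw [← h2]; push_cast; ring
  · right
    rw [← key] at h2
    rw [← h2]; push_cast; ring

-- The condition says `m x ^ 2 = n` modulo `p ^ (k - i)`. The ratio of two solutions is a square
-- root of `1` there, hence close to `1` or to `-1`, with at most `2 * p ^ i` choices for each sign.
open Classical in
theorem card_units_filter_pow_mul_eq_zero_le {p k i N : ℕ} [NeZero N] (hp : p.Prime) (hN : N = p ^ k)
    (hi : i ≤ k) {m n : ZMod N} (hm : IsUnit m) :
    (Finset.univ.filter fun x : (ZMod N)ˣ =>
      (p : ZMod N) ^ i * (m * x - n * (x⁻¹ : (ZMod N)ˣ)) = 0).card ≤ 4 * p ^ i := by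
  set S := Finset.univ.filter fun x : (ZMod N)ˣ =>
      (p : ZMod N) ^ i * (m * x - n * (x⁻¹ : (ZMod N)ˣ)) = 0 with hS
  rcases S.eq_empty_or_nonempty with h | ⟨x₀, hx₀⟩
  · simp [h]
  have hsq : ∀ x ∈ S, (p : ZMod N) ^ i * (m * x ^ 2 - n) = 0 := fun x hx => by
    have h1 := (Finset.mem_filter.1 hx).2
    have h2 : (x : ZMod N) * (x⁻¹ : (ZMod N)ˣ) = 1 := x.mul_inv
    linear_combination (x : ZMod N) * h1 + (p : ZMod N) ^ i * n * h2
  set Z := Finset.univ.filter fun s : ZMod N => ((2 * p ^ i : ℕ) : ZMod N) * s = 0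
  have hZ : Z.card ≤ 2 * p ^ i :=
    card_filter_natCast_mul_eq_zero_le (Nat.mul_pos two_pos (pow_pos hp.pos i))
  set f : (ZMod N)ˣ → ZMod N := fun x => x * (x₀⁻¹ : (ZMod N)ˣ)
  have hf : Function.Injective f := fun x y hxy => Units.ext ((x₀⁻¹).isUnit.mul_left_injective hxy)
  have hmem : ∀ x ∈ S, f x - 1 ∈ Z ∨ f x + 1 ∈ Z := by
    intro x hx
    have h1 := hsq x hx
    have h2 := hsq x₀ hx₀
    have h3 : (x₀ : ZMod N) * (x₀⁻¹ : (ZMod N)ˣ) = 1 := x₀.mul_inv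
    have h4 : (p : ZMod N) ^ i * (f x ^ 2 - 1) = 0 := by
      have h5 : m * ((p : ZMod N) ^ i * (f x ^ 2 - 1)) = 0 := by
        simp only [f]
        linear_combination ((x₀⁻¹ : (ZMod N)ˣ) : ZMod N) ^ 2 * (h1 - h2) +
          m * (p : ZMod N) ^ i * (1 + x₀ * ((x₀⁻¹ : (ZMod N)ˣ) : ZMod N)) * h3
      exact (hm.mul_right_eq_zero).1 h5
    simp only [Z, Finset.mem_filter, Finset.mem_univ, true_and]
    push_cast
    subst hN
    exact two_mul_pow_mul_eq_zero_of_sq_eq_one hp hi h4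
  have hcov : S.card ≤ (Z.image (fun s => s + 1) ∪ Z.image (fun s => s - 1)).card := by
    rw [← Finset.card_image_of_injective S hf]
    refine Finset.card_le_card fun y hy => ?_
    obtain ⟨x, hx, rfl⟩ := Finset.mem_image.1 hy
    rw [Finset.mem_union]
    rcases hmem x hx with h | h
    · exact Or.inl (Finset.mem_image.2 ⟨_, h, by ring⟩)
    · exact Or.inr (Finset.mem_image.2 ⟨_, h, by ring⟩)
  have h1 := Finset.card_union_le (Z.image (fun s => s + 1)) (Z.image (fun s => s - 1))
  have h2 : (Z.image (fun s => s + 1)).card ≤ Z.card := Finset.card_image_le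
  have h3 : (Z.image (fun s => s - 1)).card ≤ Z.card := Finset.card_image_le
  omega

/-- The Kloosterman sum `∑ e((m u + n u⁻¹) / N)` over the units modulo `N`. -/
noncomputable def kloosterman (N : ℕ) [NeZero N] (m n : ZMod N) : ℂ :=
  ∑ u : (ZMod N)ˣ, ZMod.stdAddChar (m * (u : ZMod N) + n * ((u⁻¹ : (ZMod N)ˣ) : ZMod N))

theorem kloosterman_comm (N : ℕ) [NeZero N] (m n : ZMod N) :
    kloosterman N m n = kloosterman N n m := by
  refine Fintype.sum_equiv (Equiv.inv _) _ _ fun u => ?_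
  simp [add_comm]

/-- Averaging over the substitutions `x ↦ x (1 + P t)`: as `P ^ 3 = 0`, the inverse of `1 + P t` is
`1 - P t + P ^ 2 t ^ 2`, so the phase is quadratic in `t`. -/
theorem natCast_mul_kloosterman {N : ℕ} [NeZero N] (m n : ZMod N) {P : ZMod N} (hP : P ^ 3 = 0) :
    (N : ℂ) * kloosterman N m n = ∑ x : (ZMod N)ˣ,
      ZMod.stdAddChar (m * (x : ZMod N) + n * ((x⁻¹ : (ZMod N)ˣ) : ZMod N)) * ∑ t : ZMod N,
        ZMod.stdAddChar (P * (m * (x : ZMod N) - n * ((x⁻¹ : (ZMod N)ˣ) : ZMod N)) * t +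
          P ^ 2 * (n * ((x⁻¹ : (ZMod N)ˣ) : ZMod N)) * t ^ 2) := by
  let ε : ZMod N → (ZMod N)ˣ := fun t =>
    { val := 1 + P * t
      inv := 1 - P * t + P ^ 2 * t ^ 2
      val_inv := by linear_combination t ^ 3 * hP
      inv_val := by linear_combination t ^ 3 * hP }
  have h1 : ∀ t : ZMod N, kloosterman N m n = ∑ x : (ZMod N)ˣ, ZMod.stdAddChar
      (m * ((x * ε t : (ZMod N)ˣ) : ZMod N) + n * (((x * ε t)⁻¹ : (ZMod N)ˣ) : ZMod N)) := fun t =>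
    (Fintype.sum_equiv (Equiv.mulRight (ε t)) _ _ fun x => rfl).symm
  calc (N : ℂ) * kloosterman N m n = ∑ t : ZMod N, kloosterman N m n := by
        rw [Finset.sum_const, Finset.card_univ, ZMod.card, nsmul_eq_mul]
    _ = ∑ t : ZMod N, ∑ x : (ZMod N)ˣ, ZMod.stdAddChar
      (m * ((x * ε t : (ZMod N)ˣ) : ZMod N) + n * (((x * ε t)⁻¹ : (ZMod N)ˣ) : ZMod N)) :=
        Finset.sum_congr rfl fun t _ => h1 t
    _ = _ := by
        rw [Finset.sum_comm]
        refine Finset.sum_congr rfl fun x _ => ?_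
        rw [Finset.mul_sum]
        refine Finset.sum_congr rfl fun t _ => ?_
        rw [← AddChar.map_add_eq_mul]
        congr 1
        rw [mul_inv, Units.val_mul, Units.val_mul]
        change m * (x * (1 + P * t)) + n * (((x⁻¹ : (ZMod N)ˣ) : ZMod N) * (1 - P * t + P ^ 2 * t ^ 2)) = _
        ring

/-- The stationary phase bound for Kloosterman sums modulo higher prime powers. -/
theorem norm_kloosterman_prime_pow_le {p k N : ℕ} [NeZero N] (hp : p.Prime) (hN : N = p ^ k)
    (hk : 2 ≤ k) {m n : ZMod N} (hm : IsUnit m) :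
    ‖kloosterman N m n‖ ≤ 6 * √(N : ℝ) := by
  classical
  -- `k ≥ 2` gives `3 * j ≥ k`, as the cubic truncation requires, while `2 * j ≤ k`.
  set j := k / 2 with hj
  have hj1 : 1 ≤ j := by omega
  have hpk : (p : ZMod N) ^ k = 0 := by
    have := ZMod.natCast_self N
    rw [← Nat.cast_pow, ← hN]; exact this
  have hpow : ∀ i, k ≤ i → (p : ZMod N) ^ i = 0 := fun i hi => by
    rw [← Nat.add_sub_cancel' hi, pow_add, hpk, zero_mul]
  have hP : ((p : ZMod N) ^ j) ^ 3 = 0 := by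
    rw [← pow_mul]; exact hpow _ (by omega)
  have hpR : (0 : ℝ) < p := by exact_mod_cast hp.pos
  have hNR : (0 : ℝ) < N := by exact_mod_cast Nat.pos_of_ne_zero (NeZero.ne N)
  set S : (ZMod N)ˣ → ℂ := fun x => ∑ t : ZMod N,
        ZMod.stdAddChar ((p : ZMod N) ^ j * (m * (x : ZMod N) - n * ((x⁻¹ : (ZMod N)ˣ) : ZMod N)) * t +
          ((p : ZMod N) ^ j) ^ 2 * (n * ((x⁻¹ : (ZMod N)ˣ) : ZMod N)) * t ^ 2) with hS
  set X := Finset.univ.filter fun x : (ZMod N)ˣ =>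
      (p : ZMod N) ^ (k - j) * (m * (x : ZMod N) - n * ((x⁻¹ : (ZMod N)ˣ) : ZMod N)) = 0 with hX
  have hXcard : X.card ≤ 4 * p ^ (k - j) :=
    card_units_filter_pow_mul_eq_zero_le hp hN (by omega) hm
  have hS0 : ∀ x, S x ≠ 0 → x ∈ X := by
    intro x hx
    refine Finset.mem_filter.2 ⟨Finset.mem_univ _, ?_⟩
    have h1 : ((p : ZMod N) ^ j) ^ 2 * (n * ((x⁻¹ : (ZMod N)ˣ) : ZMod N)) * (p : ZMod N) ^ (k - 2 * j) = 0 := by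
      have : (p : ZMod N) ^ (j * 2) * (p : ZMod N) ^ (k - 2 * j) = 0 := by
        rw [← pow_add]; exact hpow _ (by omega)
      rw [← pow_mul]
      linear_combination (n * ((x⁻¹ : (ZMod N)ˣ) : ZMod N)) * this
    have h2 := mul_eq_zero_of_quadratic_sum_ne_zero h1 hx
    rw [show k - j = j + (k - 2 * j) by omega, pow_add]
    linear_combination h2
  -- If `p ∣ n`, then `m x - n x⁻¹` is a unit plus a nilpotent, hence a unit, and `p ^ (k - j)`
  -- would vanish although `j ≥ 1`.
  have hn : ∀ x ∈ X, IsUnit n := by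
    intro x hx
    by_contra hnu
    have hnil : IsNilpotent (n * ((x⁻¹ : (ZMod N)ˣ) : ZMod N)) := by
      refine (Commute.all _ _).isNilpotent_mul_right ?_
      obtain ⟨z, rfl⟩ := ZMod.natCast_zmod_surjective n
      rw [ZMod.isUnit_iff_coprime, hN, Nat.coprime_pow_right_iff (by omega), Nat.coprime_comm,
        hp.coprime_iff_not_dvd, not_not] at hnu
      obtain ⟨y, rfl⟩ := hnu
      exact ⟨k, by rw [Nat.cast_mul, mul_pow, hpk, zero_mul]⟩
    have hu : IsUnit (m * (x : ZMod N) - n * ((x⁻¹ : (ZMod N)ˣ) : ZMod N)) := by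
      rw [sub_eq_add_neg]
      exact hnil.neg.isUnit_add_left_of_commute (hm.mul x.isUnit) (Commute.all _ _)
    have h1 := (hu.mul_left_eq_zero).1 (Finset.mem_filter.1 hx).2
    have h2 : ((p ^ (k - j) : ℕ) : ZMod N) = 0 := by rw [Nat.cast_pow]; exact h1
    rw [ZMod.natCast_eq_zero_iff, hN, Nat.pow_dvd_pow_iff_le_right hp.one_lt] at h2
    omega
  have hSb : ∀ x ∈ X, ‖S x‖ ≤ p ^ j * √(2 * N) := by
    intro x hx
    have h1 := norm_quadratic_sum_sq_le ((p : ZMod N) ^ j * (m * (x : ZMod N) - n * ((x⁻¹ : (ZMod N)ˣ) : ZMod N)))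
      (((p : ZMod N) ^ j) ^ 2 * (n * ((x⁻¹ : (ZMod N)ˣ) : ZMod N)))
    have h2 : (Finset.univ.filter fun s : ZMod N =>
        2 * (((p : ZMod N) ^ j) ^ 2 * (n * ((x⁻¹ : (ZMod N)ˣ) : ZMod N))) * s = 0).card ≤ 2 * p ^ (2 * j) := by
      refine le_trans (Finset.card_le_card fun s hs => ?_)
        (card_filter_natCast_mul_eq_zero_le (N := N) (Nat.mul_pos two_pos (pow_pos hp.pos _)))
      simp only [Finset.mem_filter, Finset.mem_univ, true_and] at hs ⊢
      refine (((hn x hx).mul (x⁻¹).isUnit).mul_right_eq_zero).1 ?_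
      rw [← hs]
      push_cast
      ring
    have h3 : ‖S x‖ ^ 2 ≤ (p ^ j * √(2 * N)) ^ 2 := by
      refine h1.trans ?_
      rw [mul_pow, Real.sq_sqrt (by positivity)]
      have : ((Finset.univ.filter fun s : ZMod N =>
        2 * (((p : ZMod N) ^ j) ^ 2 * (n * ((x⁻¹ : (ZMod N)ˣ) : ZMod N))) * s = 0).card : ℝ) ≤
          2 * p ^ (2 * j) := by exact_mod_cast h2
      calc (N : ℝ) * _ ≤ N * (2 * p ^ (2 * j)) := by gcongr
        _ = _ := by ring
    exact le_of_sq_le_sq h3 (by positivity)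
  have hfin : (N : ℝ) * ‖kloosterman N m n‖ ≤ N * (6 * √(N : ℝ)) := by
    have h1 : (N : ℝ) * ‖kloosterman N m n‖ = ‖(N : ℂ) * kloosterman N m n‖ := by
      rw [norm_mul, Complex.norm_natCast]
    rw [h1, natCast_mul_kloosterman m n hP]
    calc _ ≤ ∑ x : (ZMod N)ˣ, ‖S x‖ := by
          refine (norm_sum_le _ _).trans (Finset.sum_le_sum fun x _ => ?_)
          rw [norm_mul, AddChar.norm_apply, one_mul]
      _ = ∑ x ∈ X, ‖S x‖ := by
          symm
          refine Finset.sum_subset (Finset.subset_univ _) fun x _ hx => ?_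
          by_contra h
          exact hx (hS0 x (by simpa using h))
      _ ≤ X.card • (p ^ j * √(2 * N)) := Finset.sum_le_card_nsmul _ _ _ hSb
      _ ≤ (4 * p ^ (k - j)) * (p ^ j * √(2 * N)) := by
          rw [nsmul_eq_mul]
          gcongr
          exact_mod_cast hXcard
      -- The `4` counts stationary points and `√2` comes from the quadratic sum; `4 * √2 ≤ 6`.
      _ = N * (4 * √2 * √(N : ℝ)) := by
          rw [Real.sqrt_mul (by norm_num)]
          have : (N : ℝ) = p ^ (k - j) * p ^ j := by
            rw [← pow_add, hN, Nat.cast_pow]; congr 1; omega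
          nth_rewrite 2 [this]
          ring
      _ ≤ _ := by
          gcongr
          have : √2 ≤ 1.5 := by
            rw [Real.sqrt_le_left (by norm_num)]; norm_num
          linarith
  exact le_of_mul_le_mul_left hfin hNR

end PrimePowers

/-! ### Kloosterman sums of arbitrary modulus. -/

section GeneralModulus

/-- Absorbing `m` into the character gives the form of Weil's bound; for `n = 0` the sum is `-1`. -/
theorem norm_kloosterman_prime_le {p : ℕ} [NeZero p] (hp : p.Prime) {m n : ZMod p}
    (hm : IsUnit m) : ‖kloosterman p m n‖ ≤ 6 * √(p : ℝ) := by
  have : Fact p.Prime := ⟨hp⟩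
  have hψ : (ZMod.stdAddChar (N := p)).mulShift m ≠ 1 := ZMod.isPrimitive_stdAddChar p hm.ne_zero
  have h1 : kloosterman p m n = ∑ x : (ZMod p)ˣ, (ZMod.stdAddChar (N := p)).mulShift m
      ((x : ZMod p) + (n * m⁻¹) * ((x⁻¹ : (ZMod p)ˣ) : ZMod p)) := by
    refine Finset.sum_congr rfl fun x _ => ?_
    rw [AddChar.mulShift_apply]
    congr 1
    have : m * m⁻¹ = 1 := mul_inv_cancel₀ hm.ne_zero
    linear_combination (-n * ((x⁻¹ : (ZMod p)ˣ) : ZMod p)) * this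
  have hsq : 1 ≤ √(p : ℝ) := Real.one_le_sqrt.2 (by exact_mod_cast hp.one_lt.le)
  rw [h1]
  by_cases hn : n * m⁻¹ = 0
  · simp only [hn, zero_mul, add_zero]
    have h2 : ∑ x : (ZMod p)ˣ, (ZMod.stdAddChar (N := p)).mulShift m (x : ZMod p) = -1 := by
      have h3 := AddChar.sum_eq_zero_of_ne_one hψ
      rw [← Finset.add_sum_erase _ _ (Finset.mem_univ (0 : ZMod p)), AddChar.map_zero_eq_one] at h3
      rw [← add_eq_zero_iff_eq_neg, add_comm, ← h3]
      congr 1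
      exact Finset.sum_bij (fun x _ => (x : ZMod p)) (fun x _ => by simp)
        (fun x _ y _ h => Units.ext h)
        (fun x hx => ⟨Units.mk0 x (Finset.ne_of_mem_erase hx), Finset.mem_univ _, rfl⟩)
        (fun x _ => rfl)
    rw [h2, norm_neg, norm_one]
    linarith
  · have := norm_sum_addChar_add_inv_le hψ hn
    linarith

theorem stdAddChar_natCast_mul {e d N : ℕ} [NeZero d] [NeZero N] (hN : N = e * d) (x : ZMod N) :
    (ZMod.stdAddChar ((e : ZMod N) * x) : ℂ) =
      ZMod.stdAddChar (ZMod.castHom (Dvd.intro_left e hN.symm) (ZMod d) x) := by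
  obtain ⟨z, rfl⟩ := ZMod.intCast_surjective x
  have h1 : (e : ZMod N) * (z : ZMod N) = ((e * z : ℤ) : ZMod N) := by push_cast; ring
  have he : (e : ℂ) ≠ 0 := by
    rintro h
    rw [Nat.cast_eq_zero] at h
    exact NeZero.ne N (by rw [hN, h, zero_mul])
  have hd : (d : ℂ) ≠ 0 := Nat.cast_ne_zero.2 (NeZero.ne d)
  rw [h1, map_intCast (ZMod.castHom _ (ZMod d)), ZMod.stdAddChar_coe, ZMod.stdAddChar_coe]
  congr 1
  rw [hN]
  push_cast
  field_simp

theorem sum_comp_monoidHom {G H : Type*} [Group G] [Fintype G] [Group H] [Fintype H]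
    [DecidableEq H] (φ : G →* H) (hφ : Function.Surjective φ) (f : H → ℂ) :
    ∑ g, f (φ g) = ((Finset.univ.filter fun g => φ g = 1).card : ℂ) * ∑ h, f h := by
  rw [← Finset.sum_fiberwise_of_maps_to (t := Finset.univ) (g := φ) (fun _ _ => Finset.mem_univ _),
    Finset.mul_sum]
  refine Finset.sum_congr rfl fun h _ => ?_
  rw [Finset.sum_congr rfl (fun g hg => by rw [(Finset.mem_filter.1 hg).2] :
    ∀ g ∈ Finset.univ.filter (fun g => φ g = h), f (φ g) = f h), Finset.sum_const, nsmul_eq_mul]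
  congr 2
  exact MonoidHom.card_fiber_eq_of_mem_range φ (hφ h) (hφ 1)

/-- The summand depends only on the unit modulo `d`, and each such unit has at most `e` lifts. -/
theorem norm_kloosterman_mul_le {e d N : ℕ} [NeZero d] [NeZero N] (hN : N = e * d)
    (m n : ZMod N) :
    ‖kloosterman N (e * m) (e * n)‖ ≤ e *
      ‖kloosterman d (ZMod.castHom (Dvd.intro_left e hN.symm) (ZMod d) m)
        (ZMod.castHom (Dvd.intro_left e hN.symm) (ZMod d) n)‖ := by
  have hdvd : d ∣ N := Dvd.intro_left e hN.symm
  have he : 0 < e := Nat.pos_of_ne_zero fun h => NeZero.ne N (by rw [hN, h, zero_mul])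
  set ρ := ZMod.castHom hdvd (ZMod d) with hρ
  set φ : (ZMod N)ˣ →* (ZMod d)ˣ := ZMod.unitsMap hdvd with hφ
  have hφv : ∀ u, ((φ u : (ZMod d)ˣ) : ZMod d) = ρ u := fun u => by
    rw [hφ, ZMod.unitsMap_val]; rfl
  have h1 : kloosterman N (e * m) (e * n) = ∑ u : (ZMod N)ˣ,
      (ZMod.stdAddChar (ρ m * ((φ u : (ZMod d)ˣ) : ZMod d) +
        ρ n * (((φ u)⁻¹ : (ZMod d)ˣ) : ZMod d)) : ℂ) := by
    refine Finset.sum_congr rfl fun u _ => ?_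
    rw [← map_inv, hφv, hφv, ← map_mul, ← map_mul, ← map_add, ← stdAddChar_natCast_mul hN]
    congr 1
    ring
  rw [h1, sum_comp_monoidHom φ (ZMod.unitsMap_surjective hdvd) (fun v => (ZMod.stdAddChar
    (ρ m * (v : ZMod d) + ρ n * ((v⁻¹ : (ZMod d)ˣ) : ZMod d)) : ℂ)), norm_mul, Complex.norm_natCast]
  change _ * ‖kloosterman d (ρ m) (ρ n)‖ ≤ _
  gcongr
  refine le_trans (Finset.card_le_card_of_injOn (fun u => (u : ZMod N) - 1) (fun u hu => ?_)
    (fun u _ v _ h => Units.ext (sub_left_injective h)))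
    (card_filter_natCast_mul_eq_zero_le (N := N) he)
  have hu1 : φ u = 1 := (Finset.mem_filter.1 hu).2
  have hu2 : ρ ((u : ZMod N) - 1) = 0 := by rw [map_sub, ← hφv, hu1]; simp
  simp only [Finset.coe_filter, Finset.mem_univ, true_and, Set.mem_ofPred_eq]
  obtain ⟨z, hz⟩ := ZMod.intCast_surjective ((u : ZMod N) - 1)
  rw [← hz] at hu2 ⊢
  rw [map_intCast, ZMod.intCast_zmod_eq_zero_iff_dvd] at hu2
  obtain ⟨y, rfl⟩ := hu2
  have : (e : ZMod N) * ((d * y : ℤ) : ZMod N) = ((e * d : ℕ) : ZMod N) * y := by push_cast; ring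
  rw [this, ← hN, ZMod.natCast_self, zero_mul]

theorem natCast_or_isUnit_of_prime_pow {p k N : ℕ} [NeZero N] (hp : p.Prime) (hN : N = p ^ k) (m : ZMod N) :
    IsUnit m ∨ ∃ z : ℕ, m = (p : ZMod N) * z := by
  obtain ⟨z, rfl⟩ := ZMod.natCast_zmod_surjective m
  by_cases h : p ∣ z
  · obtain ⟨y, rfl⟩ := h
    exact Or.inr ⟨y, by push_cast; rfl⟩
  · left
    rw [ZMod.isUnit_iff_coprime, hN]
    exact ((hp.coprime_iff_not_dvd.2 h).symm).pow_right k

theorem gcd_val_natCast (N : ℕ) [NeZero N] (z : ℕ) : Nat.gcd (z : ZMod N).val N = Nat.gcd z N := by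
  rw [ZMod.val_natCast, ← Nat.gcd_rec, Nat.gcd_comm]

theorem norm_kloosterman_of_prime_pow_le {p : ℕ} (hp : p.Prime) (k : ℕ) {N : ℕ} [NeZero N]
    (hN : N = p ^ k) (m n : ZMod N) :
    ‖kloosterman N m n‖ ≤ 6 * √(N : ℝ) * √(Nat.gcd m.val N : ℝ) := by
  induction k generalizing N with
  | zero =>
    rw [pow_zero] at hN
    subst hN
    rw [kloosterman]
    refine (norm_sum_le _ _).trans ?_
    simp only [AddChar.norm_apply, Finset.sum_const, Finset.card_univ, ZMod.card_units_eq_totient]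
    simp
  | succ k ih =>
    have hpN : NeZero (p ^ k) := ⟨pow_ne_zero _ hp.ne_zero⟩
    have hcore : ∀ m' n' : ZMod N, IsUnit m' → ‖kloosterman N m' n'‖ ≤ 6 * √(N : ℝ) := by
      intro m' n' hm'
      rcases Nat.eq_zero_or_pos k with rfl | hk
      · rw [zero_add, pow_one] at hN
        subst hN
        exact norm_kloosterman_prime_le hp hm'
      · exact norm_kloosterman_prime_pow_le hp hN (by omega) hm'
    have hgcd : 1 ≤ √(Nat.gcd m.val N : ℝ) := by
      rw [Real.one_le_sqrt]
      exact_mod_cast Nat.gcd_pos_of_pos_right _ (Nat.pos_of_ne_zero (NeZero.ne N))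
    have hfin : 6 * √(N : ℝ) ≤ 6 * √(N : ℝ) * √(Nat.gcd m.val N : ℝ) :=
      le_mul_of_one_le_right (by positivity) hgcd
    rcases natCast_or_isUnit_of_prime_pow hp hN m with hm | ⟨a, rfl⟩
    · exact (hcore m n hm).trans hfin
    rcases natCast_or_isUnit_of_prime_pow hp hN n with hn | ⟨b, rfl⟩
    · rw [kloosterman_comm]
      exact (hcore _ _ hn).trans hfin
    -- By symmetry only the case where `p` divides both parameters is left. Passing to modulus `p ^
    -- k` costs a factor `p`, which is `√p` from the modulus times `√p` from the gcd.
    have hN' : N = p * p ^ k := by rw [hN, pow_succ, mul_comm]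
    refine (norm_kloosterman_mul_le hN' _ _).trans ?_
    rw [map_natCast, map_natCast]
    have h1 := ih (N := p ^ k) rfl a b
    rw [gcd_val_natCast] at h1
    have h2 : Nat.gcd ((p : ZMod N) * (a : ZMod N)).val N = p * Nat.gcd a (p ^ k) := by
      rw [← Nat.cast_mul, gcd_val_natCast, hN', Nat.gcd_mul_left]
    rw [h2, hN']
    have hpR : (0 : ℝ) ≤ p := p.cast_nonneg
    calc (p : ℝ) * ‖kloosterman (p ^ k) a b‖
        ≤ p * (6 * √((p ^ k : ℕ) : ℝ) * √(Nat.gcd a (p ^ k) : ℝ)) := by gcongr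
      _ = 6 * √((p * p ^ k : ℕ) : ℝ) * √((p * Nat.gcd a (p ^ k) : ℕ) : ℝ) := by
          rw [Nat.cast_mul, Nat.cast_mul, Real.sqrt_mul hpR, Real.sqrt_mul hpR]
          have := Real.mul_self_sqrt hpR
          linear_combination (-6 * √((p ^ k : ℕ) : ℝ) * √(Nat.gcd a (p ^ k) : ℝ)) * this

theorem stdAddChar_eq_mul_of_coprime {a b N : ℕ} [NeZero a] [NeZero b] [NeZero N] (hN : N = a * b)
    {r s : ℤ} (hrs : r * b + s * a = 1) (x : ZMod N) :
    (ZMod.stdAddChar x : ℂ) =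
      ZMod.stdAddChar ((r : ZMod a) * ZMod.castHom (Dvd.intro b hN.symm) (ZMod a) x) *
      ZMod.stdAddChar ((s : ZMod b) * ZMod.castHom (Dvd.intro_left a hN.symm) (ZMod b) x) := by
  have h1 := stdAddChar_natCast_mul (e := b) (d := a) (hN.trans (mul_comm a b)) ((r : ZMod N) * x)
  have h2 := stdAddChar_natCast_mul (e := a) (d := b) hN ((s : ZMod N) * x)
  rw [map_mul (ZMod.castHom _ _), map_intCast (ZMod.castHom _ (ZMod a))] at h1
  rw [map_mul (ZMod.castHom _ _), map_intCast (ZMod.castHom _ (ZMod b))] at h2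
  rw [← h1, ← h2, ← AddChar.map_add_eq_mul]
  congr 1
  have h3 : (r : ZMod N) * b + s * a = 1 := by exact_mod_cast congrArg (Int.cast (R := ZMod N)) hrs
  linear_combination (-x) * h3

/-- Modulo `1`, `x / (a b) = r x / a + s x / b`, and the Chinese remainder theorem separates the
units. -/
theorem kloosterman_mul_of_coprime {a b N : ℕ} [NeZero a] [NeZero b] [NeZero N] (hN : N = a * b)
    (hab : a.Coprime b) {r s : ℤ} (hrs : r * b + s * a = 1) (m n : ZMod N) :
    kloosterman N m n =
      kloosterman a ((r : ZMod a) * ZMod.castHom (Dvd.intro b hN.symm) (ZMod a) m)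
        ((r : ZMod a) * ZMod.castHom (Dvd.intro b hN.symm) (ZMod a) n) *
      kloosterman b ((s : ZMod b) * ZMod.castHom (Dvd.intro_left a hN.symm) (ZMod b) m)
        ((s : ZMod b) * ZMod.castHom (Dvd.intro_left a hN.symm) (ZMod b) n) := by
  subst hN
  set e : (ZMod (a * b))ˣ ≃ (ZMod a)ˣ × (ZMod b)ˣ :=
    ((Units.mapEquiv (ZMod.chineseRemainder hab).toMulEquiv).trans MulEquiv.prodUnits).toEquiv
    with he
  have he1 : ∀ u, (((e u).1 : (ZMod a)ˣ) : ZMod a) =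
      ZMod.castHom (Dvd.intro b rfl : a ∣ a * b) (ZMod a) u := fun u => by
    obtain ⟨z, hz⟩ := ZMod.intCast_surjective (u : ZMod (a * b))
    change (ZMod.chineseRemainder hab (u : ZMod (a * b))).1 = _
    rw [← hz, map_intCast, map_intCast]; rfl
  have he2 : ∀ u, (((e u).2 : (ZMod b)ˣ) : ZMod b) =
      ZMod.castHom (Dvd.intro_left a rfl : b ∣ a * b) (ZMod b) u := fun u => by
    obtain ⟨z, hz⟩ := ZMod.intCast_surjective (u : ZMod (a * b))
    change (ZMod.chineseRemainder hab (u : ZMod (a * b))).2 = _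
    rw [← hz, map_intCast, map_intCast]; rfl
  have hinv : ∀ u, e u⁻¹ = (e u)⁻¹ := fun u => by
    rw [he]; exact map_inv ((Units.mapEquiv
      (ZMod.chineseRemainder hab).toMulEquiv).trans MulEquiv.prodUnits) u
  rw [kloosterman, kloosterman, kloosterman, Finset.sum_mul_sum, ← Fintype.sum_prod_type']
  refine Fintype.sum_equiv e _ _ fun u => ?_
  rw [stdAddChar_eq_mul_of_coprime rfl hrs, ← Prod.fst_inv, ← Prod.snd_inv, ← hinv, he1, he2, he1,
    he2]
  simp only [map_add, map_mul]
  congr 2 <;> ring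

theorem gcd_val_mul_castHom {a N : ℕ} [NeZero a] [NeZero N] (h : a ∣ N) {r : ℤ}
    (hr : IsCoprime r a) (m : ZMod N) :
    Nat.gcd ((r : ZMod a) * ZMod.castHom h (ZMod a) m).val a = Nat.gcd m.val a := by
  obtain ⟨z, rfl⟩ := ZMod.natCast_zmod_surjective m
  obtain ⟨w, hw⟩ := ZMod.natCast_zmod_surjective (r : ZMod a)
  have hwa : w.Coprime a := by
    rw [← ZMod.isUnit_iff_coprime, hw]
    obtain ⟨u, v, huv⟩ := hr
    refine IsUnit.of_mul_eq_one (u : ZMod a) ?_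
    have := congrArg (Int.cast (R := ZMod a)) huv
    push_cast at this
    rw [ZMod.natCast_self, mul_zero, add_zero] at this
    rw [mul_comm, this]
  rw [map_natCast, ← hw, ← Nat.cast_mul, gcd_val_natCast, hwa.gcd_mul_left_cancel]
  rw [ZMod.val_natCast]
  conv_lhs => rw [Nat.gcd_comm, Nat.gcd_rec]
  conv_rhs => rw [Nat.gcd_comm, Nat.gcd_rec, Nat.mod_mod_of_dvd _ h]

/-- **Weil's bound** for Kloosterman sums of arbitrary modulus. -/
theorem norm_kloosterman_le (N : ℕ) [NeZero N] (m n : ZMod N) :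
    ‖kloosterman N m n‖ ≤ 6 ^ N.primeFactors.card * √(N : ℝ) * √(Nat.gcd m.val N : ℝ) := by
  have key : ∀ N : ℕ, ∀ h : N ≠ 0, ∀ m n : ZMod N, haveI : NeZero N := ⟨h⟩
      ‖kloosterman N m n‖ ≤ 6 ^ N.primeFactors.card * √(N : ℝ) * √(Nat.gcd m.val N : ℝ) := by
    intro N
    induction N using Nat.recOnPosPrimePosCoprime with
    | prime_pow p k hp hk =>
      intro h m n
      have : NeZero (p ^ k) := ⟨h⟩
      rw [Nat.primeFactors_prime_pow hk.ne' hp, Finset.card_singleton, pow_one]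
      exact norm_kloosterman_of_prime_pow_le hp k rfl m n
    | zero => intro h; exact absurd rfl h
    | one =>
      intro h m n
      have := norm_kloosterman_of_prime_pow_le Nat.prime_two 0 (N := 1) rfl m n
      rw [kloosterman]
      refine (norm_sum_le _ _).trans ?_
      simp only [AddChar.norm_apply, Finset.sum_const, Finset.card_univ,
        ZMod.card_units_eq_totient]
      simp
    | coprime a b ha hb hab iha ihb =>
      intro h m n
      have i1 : NeZero a := ⟨by omega⟩
      have i2 : NeZero b := ⟨by omega⟩
      have i3 : NeZero (a * b) := ⟨h⟩
      obtain ⟨s, r, hrs⟩ : IsCoprime (a : ℤ) b := Nat.isCoprime_iff_coprime.2 hab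
      have hrs' : r * b + s * a = 1 := by linarith
      rw [kloosterman_mul_of_coprime rfl hab hrs', norm_mul]
      have h1 := iha i1.1 ((r : ZMod a) * ZMod.castHom (Dvd.intro b rfl : a ∣ a * b) (ZMod a) m)
        ((r : ZMod a) * ZMod.castHom (Dvd.intro b rfl : a ∣ a * b) (ZMod a) n)
      have h2 := ihb i2.1
        ((s : ZMod b) * ZMod.castHom (Dvd.intro_left a rfl : b ∣ a * b) (ZMod b) m)
        ((s : ZMod b) * ZMod.castHom (Dvd.intro_left a rfl : b ∣ a * b) (ZMod b) n)
      rw [gcd_val_mul_castHom _ ⟨b, s, by linarith⟩] at h1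
      rw [gcd_val_mul_castHom _ ⟨a, r, by linarith⟩] at h2
      refine (mul_le_mul h1 h2 (norm_nonneg _) (by positivity)).trans_eq ?_
      rw [hab.primeFactors_mul, Finset.card_union_of_disjoint hab.disjoint_primeFactors,
        Nat.Coprime.gcd_mul _ hab, Nat.cast_mul, Nat.cast_mul, Real.sqrt_mul (by positivity),
        Real.sqrt_mul (by positivity), pow_add]
      ring
  exact key N (NeZero.ne N) m n

end GeneralModulus

/-! ### Majorants of geometric sums and their averages. -/

section HarmonicSums

theorem sum_inv_filter_dvd_le (q : ℕ) {e : ℕ} (he : 0 < e) :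
    ∑ n ∈ (Finset.Icc 1 q).filter (e ∣ ·), (1 / n : ℝ) ≤ (1 / e) * (1 + Real.log q) := by
  have h1 : ∑ n ∈ (Finset.Icc 1 q).filter (e ∣ ·), (1 / n : ℝ) ≤
      ∑ l ∈ Finset.Icc 1 q, (1 / (e * l : ℕ) : ℝ) := by
    rw [← Finset.sum_image (s := Finset.Icc 1 q) (g := fun l => e * l)
      (f := fun n : ℕ => (1 / n : ℝ)) (fun a _ b _ h => Nat.eq_of_mul_eq_mul_left he h)]
    refine Finset.sum_le_sum_of_subset_of_nonneg (fun n hn => ?_) (fun _ _ _ => by positivity)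
    obtain ⟨h1, l, rfl⟩ := Finset.mem_filter.1 hn
    rw [Finset.mem_Icc] at h1
    refine Finset.mem_image.2 ⟨l, Finset.mem_Icc.2 ⟨Nat.pos_of_mul_pos_left h1.1, ?_⟩, rfl⟩
    exact (Nat.le_mul_of_pos_left l he).trans h1.2
  refine h1.trans ?_
  have h2 := harmonic_le_one_add_log q
  rw [harmonic_eq_sum_Icc] at h2
  push_cast at h2
  calc _ = (1 / e : ℝ) * ∑ l ∈ Finset.Icc 1 q, ((l : ℝ))⁻¹ := by
        rw [Finset.mul_sum]
        refine Finset.sum_congr rfl fun l _ => ?_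
        push_cast
        rw [one_div_mul_eq_div, one_div, mul_inv, div_eq_mul_inv, mul_comm]
    _ ≤ _ := by gcongr

variable {q : ℕ}

/-- A majorant for incomplete geometric sums of `e(x / q)`; zero at `x = 0`. -/
noncomputable def geomMajorant (x : ZMod q) : ℝ := q / 2 * (1 / x.val + 1 / (-x).val)

theorem geomMajorant_neg (x : ZMod q) : geomMajorant (-x) = geomMajorant x := by
  rw [geomMajorant, geomMajorant, neg_neg, add_comm]

theorem geomMajorant_zero : geomMajorant (0 : ZMod q) = 0 := by simp [geomMajorant]

theorem geomMajorant_nonneg (x : ZMod q) : 0 ≤ geomMajorant x := by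
  unfold geomMajorant; positivity

variable [NeZero q]

theorem norm_one_sub_stdAddChar (x : ZMod q) :
    ‖1 - (ZMod.stdAddChar x : ℂ)‖ = 2 * Real.sin (Real.pi * x.val / q) := by
  have hx : (x.val : ℝ) ≤ q := by exact_mod_cast (ZMod.val_lt x).le
  have hq : (0 : ℝ) < q := by exact_mod_cast Nat.pos_of_ne_zero (NeZero.ne q)
  have h1 : (ZMod.stdAddChar x : ℂ) =
      Complex.exp (Complex.I * ((2 * Real.pi * x.val / q : ℝ) : ℂ)) := by
    have h2 : x = ((x.val : ℤ) : ZMod q) := by simp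
    conv_lhs => rw [h2]
    rw [ZMod.stdAddChar_coe]
    congr 1
    push_cast
    ring
  rw [← norm_neg, neg_sub, h1, Complex.norm_exp_I_mul_ofReal_sub_one, norm_mul,
    Real.norm_of_nonneg zero_le_two, show 2 * Real.pi * x.val / q / 2 = Real.pi * x.val / q by ring,
    Real.norm_of_nonneg]
  apply Real.sin_nonneg_of_nonneg_of_le_pi (by positivity)
  rw [div_le_iff₀ hq]
  gcongr

/-- Jordan's inequality bounds the sine below by a multiple of the distance from `x / q` to the
nearest integer. Adding both candidate reciprocals in `geomMajorant` avoids a minimum. -/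
theorem two_div_norm_one_sub_stdAddChar_le {x : ZMod q} (hx : x ≠ 0) :
    0 < ‖1 - (ZMod.stdAddChar x : ℂ)‖ ∧
      2 / ‖1 - (ZMod.stdAddChar x : ℂ)‖ ≤ geomMajorant x := by
  have hq : (0 : ℝ) < q := by exact_mod_cast Nat.pos_of_ne_zero (NeZero.ne q)
  have hxlt : (x.val : ℝ) < q := by exact_mod_cast ZMod.val_lt x
  have hx0 : (0 : ℝ) < x.val := by
    have : x.val ≠ 0 := (ZMod.val_ne_zero x).2 hx
    exact_mod_cast Nat.pos_of_ne_zero this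
  have hneg : ((-x).val : ℝ) = q - x.val := by
    have : NeZero x := ⟨hx⟩
    rw [ZMod.val_neg_of_ne_zero x, Nat.cast_sub (ZMod.val_lt x).le]
  have key : ∀ y : ℝ, 0 < y → y ≤ q / 2 → Real.sin (Real.pi * x.val / q) = Real.sin (Real.pi * y / q) →
      4 * y / q ≤ ‖1 - (ZMod.stdAddChar x : ℂ)‖ := by
    intro y hy hyq hs
    rw [norm_one_sub_stdAddChar, hs]
    have h1 := Real.mul_le_sin (x := Real.pi * y / q) (by positivity) (by
      rw [div_le_iff₀ hq]
      have := Real.pi_pos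
      nlinarith)
    have h2 : 2 / Real.pi * (Real.pi * y / q) = 2 * y / q := by
      field_simp
    rw [h2] at h1
    calc 4 * y / q = 2 * (2 * y / q) := by ring
      _ ≤ _ := by gcongr
  have fin : ∀ y : ℝ, 0 < y → 4 * y / q ≤ ‖1 - (ZMod.stdAddChar x : ℂ)‖ →
      q / 2 * (1 / y) ≤ geomMajorant x → 0 < ‖1 - (ZMod.stdAddChar x : ℂ)‖ ∧
      2 / ‖1 - (ZMod.stdAddChar x : ℂ)‖ ≤ geomMajorant x := by
    intro y hy h1 h2
    have h3 : 0 < 4 * y / q := by positivity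
    refine ⟨h3.trans_le h1, le_trans ?_ h2⟩
    calc 2 / ‖1 - (ZMod.stdAddChar x : ℂ)‖ ≤ 2 / (4 * y / q) := by gcongr
      _ = q / 2 * (1 / y) := by field_simp; norm_num
  rcases le_total (x.val : ℝ) (q / 2) with h | h
  · refine fin _ hx0 (key _ hx0 h rfl) ?_
    unfold geomMajorant
    gcongr
    simp only [le_add_iff_nonneg_right]
    positivity
  · refine fin (q - x.val) (by linarith) (key _ (by linarith) (by linarith) ?_) ?_
    · rw [← Real.sin_pi_sub]
      congr 1
      field_simp
    · unfold geomMajorant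
      rw [hneg]
      gcongr
      simp only [le_add_iff_nonneg_left]
      positivity

theorem norm_sum_stdAddChar_pow_le {x : ZMod q} (hx : x ≠ 0) (u v : ℕ) :
    ‖∑ t ∈ Finset.Ico u v, (ZMod.stdAddChar x : ℂ) ^ t‖ ≤ geomMajorant x := by
  obtain ⟨h1, h2⟩ := two_div_norm_one_sub_stdAddChar_le hx
  rcases le_total v u with huv | huv
  · rw [Finset.Ico_eq_empty_of_le huv, Finset.sum_empty, norm_zero]
    exact geomMajorant_nonneg x
  have hne : (ZMod.stdAddChar x : ℂ) ≠ 1 := fun h => by simp [h] at h1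
  refine le_trans ?_ h2
  rw [geom_sum_Ico hne huv, norm_div, norm_sub_rev (ZMod.stdAddChar x : ℂ) 1]
  gcongr
  refine (norm_sub_le _ _).trans ?_
  rw [norm_pow, norm_pow, AddChar.norm_apply, one_pow, one_pow]
  norm_num

theorem sum_geomMajorant_mul_le (f : ℕ → ℝ) (hf : ∀ n, 0 ≤ f n)
    (hsymm : ∀ x : ZMod q, f (-x).val = f x.val) :
    ∑ x : ZMod q, geomMajorant x * f x.val ≤ q * ∑ n ∈ Finset.Icc 1 q, 1 / n * f n := by
  have h1 : ∑ x : ZMod q, (1 / x.val : ℝ) * f x.val ≤ ∑ n ∈ Finset.Icc 1 q, 1 / n * f n := by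
    have h3 : ∑ x : ZMod q, (1 / x.val : ℝ) * f x.val =
        ∑ x ∈ Finset.univ.erase (0 : ZMod q), (1 / x.val : ℝ) * f x.val := by
      rw [Finset.sum_erase]; simp
    rw [h3, ← Finset.sum_image (s := Finset.univ.erase (0 : ZMod q)) (g := ZMod.val)
      (f := fun n : ℕ => (1 / n : ℝ) * f n) (fun a _ b _ h => ZMod.val_injective q h)]
    refine Finset.sum_le_sum_of_subset_of_nonneg (fun n hn => ?_)
      (fun n _ _ => mul_nonneg (by positivity) (hf n))
    obtain ⟨x, hx, rfl⟩ := Finset.mem_image.1 hn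
    have : x.val ≠ 0 := (ZMod.val_ne_zero x).2 (Finset.ne_of_mem_erase hx)
    exact Finset.mem_Icc.2 ⟨Nat.pos_of_ne_zero this, (ZMod.val_lt x).le⟩
  have h2 : ∑ x : ZMod q, (1 / (-x).val : ℝ) * f x.val =
      ∑ x : ZMod q, (1 / x.val : ℝ) * f x.val :=
    Fintype.sum_equiv (Equiv.neg _) _ _ fun x => by rw [Equiv.neg_apply, hsymm]
  have h3 : ∑ x : ZMod q, geomMajorant x * f x.val =
      q / 2 * (∑ x : ZMod q, (1 / x.val : ℝ) * f x.val +
        ∑ x : ZMod q, (1 / (-x).val : ℝ) * f x.val) := by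
    rw [← Finset.sum_add_distrib, Finset.mul_sum]
    refine Finset.sum_congr rfl fun x _ => ?_
    unfold geomMajorant
    ring
  rw [h3, h2]
  calc _ = q * ∑ x : ZMod q, (1 / x.val : ℝ) * f x.val := by ring
    _ ≤ _ := by gcongr

theorem gcd_val_neg (x : ZMod q) : Nat.gcd (-x).val q = Nat.gcd x.val q := by
  rcases eq_or_ne x 0 with rfl | hx
  · simp
  have : NeZero x := ⟨hx⟩
  rw [ZMod.val_neg_of_ne_zero x, Nat.gcd_comm, Nat.gcd_comm x.val,
    Nat.gcd_self_sub_right (ZMod.val_lt x).le]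

/-- Sorting by the divisor `e = gcd(n, q)`, the multiples of `e` carry `√e / e ≤ 1` times a harmonic
sum, so each divisor of `q` costs one logarithm. -/
theorem sum_geomMajorant_mul_sqrt_gcd_le :
    ∑ x : ZMod q, geomMajorant x * √(Nat.gcd x.val q : ℝ) ≤
      q * (q.divisors.card * (1 + Real.log q)) := by
  refine (sum_geomMajorant_mul_le (fun n => √(Nat.gcd n q : ℝ)) (fun _ => by positivity)
    (fun x => by simp only [gcd_val_neg])).trans ?_
  gcongr
  have hq0 : q ≠ 0 := NeZero.ne q
  have h1 : ∀ n ∈ Finset.Icc 1 q, (1 / n : ℝ) * √(Nat.gcd n q : ℝ) ≤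
      ∑ e ∈ q.divisors, if e ∣ n then (1 / n : ℝ) * √(e : ℝ) else 0 := by
    intro n hn
    have h2 := Finset.single_le_sum (s := q.divisors)
      (f := fun e => if e ∣ n then (1 / n : ℝ) * √(e : ℝ) else 0)
      (fun e _ => by split_ifs <;> positivity)
      (Nat.mem_divisors.2 ⟨Nat.gcd_dvd_right n q, hq0⟩)
    simpa only [Nat.gcd_dvd_left, if_true] using h2
  refine (Finset.sum_le_sum h1).trans ?_
  rw [Finset.sum_comm, ← nsmul_eq_mul]
  refine Finset.sum_le_card_nsmul _ _ _ fun e he => ?_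
  have he0 : 0 < e := Nat.pos_of_mem_divisors he
  rw [← Finset.sum_filter, ← Finset.sum_mul]
  have h3 := sum_inv_filter_dvd_le q he0
  have hlog : 0 ≤ 1 + Real.log q := by
    have := Real.log_natCast_nonneg q; linarith
  have he1 : (1 : ℝ) ≤ e := by exact_mod_cast he0
  calc _ ≤ (1 / e) * (1 + Real.log q) * √(e : ℝ) := by gcongr
    _ ≤ (1 / e) * (1 + Real.log q) * e := by
        gcongr
        exact Real.sqrt_le_iff.2 ⟨by positivity, by nlinarith⟩
    _ = _ := by field_simp

/-- Multiplication by `D` has image in the multiples of `g = gcd(D, q)` and fibres of size at most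
`g`; the harmonic sum over multiples of `g` gains `1 / g`, so `g` cancels. -/
theorem sum_geomMajorant_mul_natCast_le (D : ℕ) :
    ∑ k : ZMod q, geomMajorant (k * (D : ZMod q)) ≤ q * (1 + Real.log q) := by
  classical
  set g := Nat.gcd D q with hg
  have hg0 : 0 < g := Nat.gcd_pos_of_pos_right _ (Nat.pos_of_ne_zero (NeZero.ne q))
  have hfib : ∀ x : ZMod q, ((Finset.univ.filter fun k : ZMod q => k * D = x).card : ℝ) ≤
      if g ∣ x.val then (g : ℝ) else 0 := by
    intro x
    rcases (Finset.univ.filter fun k : ZMod q => k * D = x).eq_empty_or_nonempty with h | ⟨k₀, hk₀⟩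
    · rw [h]; split_ifs <;> simp
    have hk : k₀ * D = x := (Finset.mem_filter.1 hk₀).2
    have hdvd : g ∣ x.val := by
      rw [← hk]
      obtain ⟨z, rfl⟩ := ZMod.natCast_zmod_surjective k₀
      rw [← Nat.cast_mul, ZMod.val_natCast, Nat.dvd_mod_iff (Nat.gcd_dvd_right D q)]
      exact (Nat.gcd_dvd_left D q).mul_left z
    rw [if_pos hdvd]
    norm_cast
    refine le_trans (Finset.card_le_card_of_injOn (fun k => k - k₀) (fun k hk' => ?_)
      (fun a _ b _ h => sub_left_injective h)) (card_filter_natCast_mul_eq_zero_le (N := q) hg0)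
    have h1 : k * D = x := (Finset.mem_filter.1 hk').2
    simp only [Finset.coe_filter, Finset.mem_univ, true_and, Set.mem_ofPred_eq]
    have h2 : (k - k₀) * D = 0 := by rw [sub_mul, h1, hk, sub_self]
    have h3 : ((g : ℤ) : ZMod q) = D * (Nat.gcdA D q : ℤ) := by
      rw [hg, Nat.gcd_eq_gcd_ab]; push_cast; rw [ZMod.natCast_self]; ring
    rw [Int.cast_natCast] at h3
    rw [h3]
    linear_combination ((Nat.gcdA D q : ℤ) : ZMod q) * h2
  have h1 : ∑ k : ZMod q, geomMajorant (k * (D : ZMod q)) =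
      ∑ x : ZMod q, ((Finset.univ.filter fun k : ZMod q => k * D = x).card : ℝ) *
        geomMajorant x := by
    rw [← Finset.sum_fiberwise_of_maps_to (t := Finset.univ) (g := fun k : ZMod q => k * (D : ZMod q))
      (fun _ _ => Finset.mem_univ _)]
    refine Finset.sum_congr rfl fun x _ => ?_
    rw [← nsmul_eq_mul, ← Finset.sum_const]
    exact Finset.sum_congr rfl fun k hk => by rw [(Finset.mem_filter.1 hk).2]
  have hdvd_neg : ∀ x : ZMod q, g ∣ (-x).val ↔ g ∣ x.val := by
    intro x
    have hgq : g ∣ q := Nat.gcd_dvd_right D q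
    have h4 : ∀ y : ZMod q, g ∣ y.val ↔ g ∣ Nat.gcd y.val q := fun y =>
      ⟨fun h => Nat.dvd_gcd h hgq, fun h => h.trans (Nat.gcd_dvd_left _ _)⟩
    rw [h4, h4 x, gcd_val_neg]
  rw [h1]
  calc _ ≤ ∑ x : ZMod q, geomMajorant x * (if g ∣ x.val then (g : ℝ) else 0) := by
        refine Finset.sum_le_sum fun x _ => ?_
        rw [mul_comm]
        exact mul_le_mul_of_nonneg_left (hfib x) (geomMajorant_nonneg x)
    _ ≤ q * ∑ n ∈ Finset.Icc 1 q, 1 / n * (if g ∣ n then (g : ℝ) else 0) :=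
        sum_geomMajorant_mul_le (fun n => if g ∣ n then (g : ℝ) else 0)
          (fun n => by split_ifs <;> positivity) (fun x => by simp only [hdvd_neg])
    _ = q * (g * ∑ n ∈ (Finset.Icc 1 q).filter (g ∣ ·), (1 / n : ℝ)) := by
        congr 1
        rw [Finset.mul_sum, Finset.sum_filter]
        refine Finset.sum_congr rfl fun n _ => ?_
        split_ifs <;> ring
    _ ≤ q * (g * ((1 / g) * (1 + Real.log q))) := by
        gcongr
        exact sum_inv_filter_dvd_le q hg0
    _ = _ := by
        have : (g : ℝ) ≠ 0 := by positivity
        field_simp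

end HarmonicSums

/-! ### Fourier analysis on a modular hyperbola in a box. -/

section BoxLemma

variable {q : ℕ} [NeZero q]

/-- The error term in counting points of a modular hyperbola in a box. -/
noncomputable def boxError (q : ℕ) : ℝ :=
  6 ^ q.primeFactors.card * √(q : ℝ) * q.divisors.card * (1 + Real.log q) ^ 2

theorem boxError_nonneg (q : ℕ) : 0 ≤ boxError q := by
  have := Real.log_natCast_nonneg q
  unfold boxError
  positivity

theorem eq_inv_mul_sum_dft (F : ZMod q → ℂ) (r : ZMod q) :
    F r = (q : ℂ)⁻¹ * ∑ k : ZMod q, ZMod.stdAddChar (k * r) * ZMod.dft F k := by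
  have h1 : ZMod.dft.symm (ZMod.dft F) r = F r := by rw [LinearEquiv.symm_apply_apply]
  rw [← h1, ZMod.invDFT_apply]
  simp only [smul_eq_mul]

theorem sum_units_mul_eq_sum_kloosterman (F G : ZMod q → ℂ) (a : ZMod q) :
    ∑ u : (ZMod q)ˣ, F u * G (a * ((u⁻¹ : (ZMod q)ˣ) : ZMod q)) =
      (q : ℂ)⁻¹ ^ 2 * ∑ k : ZMod q, ∑ h : ZMod q,
        ZMod.dft F k * ZMod.dft G h * kloosterman q k (h * a) := by
  have h1 : ∀ u : (ZMod q)ˣ, F u * G (a * ((u⁻¹ : (ZMod q)ˣ) : ZMod q)) =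
      (q : ℂ)⁻¹ ^ 2 * ∑ k : ZMod q, ∑ h : ZMod q, ZMod.dft F k * ZMod.dft G h *
        ZMod.stdAddChar (k * (u : ZMod q) + h * a * ((u⁻¹ : (ZMod q)ˣ) : ZMod q)) := by
    intro u
    rw [eq_inv_mul_sum_dft F, eq_inv_mul_sum_dft G, mul_mul_mul_comm, ← pow_two,
      Finset.sum_mul_sum]
    congr 1
    refine Finset.sum_congr rfl fun k _ => Finset.sum_congr rfl fun h _ => ?_
    rw [AddChar.map_add_eq_mul, mul_assoc h]
    ring
  simp_rw [h1, kloosterman, ← Finset.mul_sum]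
  congr 1
  rw [Finset.sum_comm]
  refine Finset.sum_congr rfl fun k _ => ?_
  rw [Finset.sum_comm]
  simp_rw [Finset.mul_sum]

theorem gcd_val_mul_of_isUnit {a : ZMod q} (ha : IsUnit a) (h : ZMod q) :
    Nat.gcd (h * a).val q = Nat.gcd h.val q := by
  obtain ⟨z, rfl⟩ := ZMod.natCast_zmod_surjective a
  obtain ⟨w, rfl⟩ := ZMod.natCast_zmod_surjective h
  rw [ZMod.isUnit_iff_coprime] at ha
  rw [← Nat.cast_mul, gcd_val_natCast, gcd_val_natCast, ha.gcd_mul_right_cancel]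

/-- By symmetry the gcd in Weil's bound can be taken with `h * a`, hence with `h`. The sums over `k`
and `h` then separate, and each contributes a factor `q` against the `q⁻¹ ^ 2` of Fourier inversion.
-/
theorem norm_sum_units_mul_le {F G : ZMod q → ℂ} {a : ZMod q} (ha : IsUnit a) (D : ℕ)
    (hF : ∀ k, ‖ZMod.dft F k‖ ≤ D * geomMajorant (k * (D : ZMod q)))
    (hG : ∀ h, ‖ZMod.dft G h‖ ≤ geomMajorant h) :
    ‖∑ u : (ZMod q)ˣ, F u * G (a * ((u⁻¹ : (ZMod q)ˣ) : ZMod q))‖ ≤ D * boxError q := by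
  have hq : (0 : ℝ) < q := by exact_mod_cast Nat.pos_of_ne_zero (NeZero.ne q)
  have hlog := Real.log_natCast_nonneg q
  set W : ℝ := 6 ^ q.primeFactors.card * √(q : ℝ) with hW
  have hK : ∀ k h : ZMod q, ‖kloosterman q k (h * a)‖ ≤ W * √(Nat.gcd h.val q : ℝ) := by
    intro k h
    rw [kloosterman_comm, ← gcd_val_mul_of_isUnit ha]
    exact norm_kloosterman_le q _ _
  rw [sum_units_mul_eq_sum_kloosterman, norm_mul, norm_pow, norm_inv, Complex.norm_natCast]
  have h1 : ‖∑ k : ZMod q, ∑ h : ZMod q, ZMod.dft F k * ZMod.dft G h * kloosterman q k (h * a)‖ ≤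
      (∑ k : ZMod q, D * geomMajorant (k * (D : ZMod q))) *
        (W * ∑ h : ZMod q, geomMajorant h * √(Nat.gcd h.val q : ℝ)) := by
    rw [Finset.mul_sum, Finset.sum_mul_sum]
    refine (norm_sum_le _ _).trans (Finset.sum_le_sum fun k _ => ?_)
    refine (norm_sum_le _ _).trans (Finset.sum_le_sum fun h _ => ?_)
    rw [norm_mul, norm_mul]
    have i1 := geomMajorant_nonneg h
    have i2 : 0 ≤ D * geomMajorant (k * (D : ZMod q)) :=
      mul_nonneg (Nat.cast_nonneg _) (geomMajorant_nonneg _)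
    calc _ ≤ D * geomMajorant (k * (D : ZMod q)) * geomMajorant h *
          (W * √(Nat.gcd h.val q : ℝ)) := by
          gcongr
          · exact hF k
          · exact hG h
          · exact hK k h
      _ = _ := by ring
  calc _ ≤ (q : ℝ)⁻¹ ^ 2 * ((D * (q * (1 + Real.log q))) *
        (W * (q * (q.divisors.card * (1 + Real.log q))))) := by
        refine mul_le_mul_of_nonneg_left (h1.trans ?_) (by positivity)
        rw [← Finset.mul_sum]
        gcongr
        · exact mul_nonneg (by positivity) (Finset.sum_nonneg fun h _ =>
            mul_nonneg (geomMajorant_nonneg h) (Real.sqrt_nonneg _))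
        · exact sum_geomMajorant_mul_natCast_le D
        · exact sum_geomMajorant_mul_sqrt_gcd_le
    _ = _ := by
        unfold boxError
        rw [hW]
        field_simp

theorem sum_Ioc_mul_eq {M : Type*} [AddCommMonoid M] (D : ℕ) {u v : ℕ} (huv : u ≤ v) (f : ℕ → M) :
    ∑ d ∈ Finset.Ioc (D * u) (D * v), f d =
      ∑ t ∈ Finset.Ico u v, ∑ c ∈ Finset.Icc 1 D, f (D * t + c) := by
  induction v, huv using Nat.le_induction with
  | base => simp
  | succ v hv ih =>
    rw [Finset.sum_Ico_succ_top hv, ← ih, ← Finset.sum_Ioc_consecutive f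
      (Nat.mul_le_mul_left D hv)
      (Nat.mul_le_mul_left D (Nat.le_add_right v 1))]
    congr 1
    refine Finset.sum_bij' (fun d _ => d - D * v) (fun c _ => D * v + c) ?_ ?_ ?_ ?_ ?_
    · intro d hd
      simp only [Finset.mem_Ioc, Finset.mem_Icc, mul_add, mul_one] at hd ⊢
      omega
    · intro c hc
      simp only [Finset.mem_Ioc, Finset.mem_Icc, mul_add, mul_one] at hc ⊢
      omega
    · intro d hd
      simp only [Finset.mem_Ioc] at hd
      omega
    · intro c hc; simp
    · intro d hd
      simp only [Finset.mem_Ioc] at hd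
      congr 1
      omega

/-- The distribution modulo `q` of a weight `c` on a finite set of integers. -/
noncomputable def residueSum (q : ℕ) (s : Finset ℕ) (c : ℕ → ℂ) (r : ZMod q) : ℂ :=
  ∑ d ∈ s, if (d : ZMod q) = r then c d else 0

theorem dft_residueSum (s : Finset ℕ) (c : ℕ → ℂ) (k : ZMod q) :
    ZMod.dft (residueSum q s c) k = ∑ d ∈ s, ZMod.stdAddChar (-((d : ZMod q) * k)) * c d := by
  rw [ZMod.dft_apply]
  simp only [residueSum, smul_eq_mul, Finset.mul_sum]
  rw [Finset.sum_comm]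
  refine Finset.sum_congr rfl fun d _ => ?_
  simp

theorem sum_units_residueSum_mul (s t : Finset ℕ) (c : ℕ → ℂ) {a : ZMod q} (ha : IsUnit a) :
    ∑ u : (ZMod q)ˣ, residueSum q s c u *
      residueSum q t (fun _ => 1) (a * ((u⁻¹ : (ZMod q)ˣ) : ZMod q)) =
      ∑ d ∈ s, ∑ m ∈ t, if (d : ZMod q) * m = a then c d else 0 := by
  simp only [residueSum, Finset.sum_mul_sum]
  rw [Finset.sum_comm]
  refine Finset.sum_congr rfl fun d _ => ?_
  rw [Finset.sum_comm]
  refine Finset.sum_congr rfl fun m _ => ?_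
  split_ifs with h
  · have hd : IsUnit (d : ZMod q) := isUnit_of_mul_isUnit_left (h ▸ ha)
    rw [Finset.sum_eq_single hd.unit]
    · rw [if_pos (by simp), if_pos, mul_one]
      rw [← h, mul_comm (d : ZMod q), mul_assoc]
      have := hd.unit.mul_inv
      rw [hd.unit_spec] at this
      rw [this, mul_one]
    · intro u _ hu
      rw [if_neg, zero_mul]
      intro h2
      exact hu (Units.ext (by rw [hd.unit_spec, h2]))
    · simp
  · refine Finset.sum_eq_zero fun u _ => ?_
    by_cases h1 : (d : ZMod q) = u
    · rw [if_neg (c := (m : ZMod q) = _), mul_zero]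
      intro h2
      apply h
      rw [h1, h2, mul_left_comm, Units.mul_inv, mul_one]
    · rw [if_neg h1, zero_mul]

theorem sum_units_residueSum (s : Finset ℕ) (c : ℕ → ℂ) :
    ∑ u : (ZMod q)ˣ, residueSum q s c u = ∑ d ∈ s, if d.Coprime q then c d else 0 := by
  simp only [residueSum]
  rw [Finset.sum_comm]
  refine Finset.sum_congr rfl fun d _ => ?_
  split_ifs with h
  · have hd : IsUnit (d : ZMod q) := (ZMod.isUnit_iff_coprime d q).2 h
    rw [Finset.sum_eq_single hd.unit]
    · rw [if_pos (by simp)]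
    · intro u _ hu
      rw [if_neg]
      intro h2
      exact hu (Units.ext (by rw [hd.unit_spec, h2]))
    · simp
  · refine Finset.sum_eq_zero fun u _ => if_neg fun h1 => h ?_
    rw [← ZMod.isUnit_iff_coprime, h1]
    exact u.isUnit

variable {D : ℕ} (χ : DirichletCharacter ℂ D)

theorem sum_Icc_natCast_eq_sum_zmod [NeZero D] (f : ZMod D → ℂ) :
    ∑ c ∈ Finset.Icc 1 D, f c = ∑ x : ZMod D, f x := by
  symm
  have hD : 0 < D := Nat.pos_of_ne_zero (NeZero.ne D)
  refine Finset.sum_bij' (fun x _ => if x = 0 then D else x.val) (fun c _ => (c : ZMod D))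
    ?_ ?_ ?_ ?_ ?_
  · intro x _
    have := ZMod.val_lt x
    split_ifs with h
    · simp; omega
    · have : x.val ≠ 0 := (ZMod.val_ne_zero x).2 h
      rw [Finset.mem_Icc]; omega
  · intro c _; simp
  · intro x _
    split_ifs with h <;> simp [h]
  · intro c hc
    rw [Finset.mem_Icc] at hc
    rcases hc.2.eq_or_lt with rfl | h
    · simp
    · rw [if_neg, ZMod.val_natCast_of_lt h]
      rw [ZMod.natCast_eq_zero_iff]
      exact fun h2 => by have := Nat.le_of_dvd (by omega) h2; omega
  · intro x _
    split_ifs with h <;> simp [h]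

/-- One block of the exponential sum twisted by `χ`. -/
noncomputable def charBlock (k : ZMod q) : ℂ :=
  ∑ c ∈ Finset.Icc 1 D, ZMod.stdAddChar (-((c : ZMod q) * k)) * χ c

theorem norm_charBlock_le (k : ZMod q) : ‖charBlock χ k‖ ≤ D := by
  refine (norm_sum_le_of_le _ (n := fun _ => 1) fun c _ => ?_).trans (by simp)
  rw [norm_mul, AddChar.norm_apply, one_mul]
  exact χ.norm_le_one _

theorem dft_residueSum_Ioc {u v : ℕ} (huv : u ≤ v) (k : ZMod q) :
    ZMod.dft (residueSum q (Finset.Ioc (D * u) (D * v)) fun d => χ d) k =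
      (∑ t ∈ Finset.Ico u v, (ZMod.stdAddChar (-(k * (D : ZMod q))) : ℂ) ^ t) * charBlock χ k := by
  rw [dft_residueSum, sum_Ioc_mul_eq D huv, Finset.sum_mul]
  refine Finset.sum_congr rfl fun t _ => ?_
  rw [charBlock, Finset.mul_sum]
  refine Finset.sum_congr rfl fun c _ => ?_
  rw [← AddChar.map_nsmul_eq_pow, ← mul_assoc, ← AddChar.map_add_eq_mul]
  congr 2
  · push_cast
    simp only [nsmul_eq_mul]
    ring
  · push_cast
    simp

/-- When `k * D = 0` the additive character descends to `ZMod D`, where it can be primitive only if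
`D ∣ q`. The Gauss sum of a primitive `χ` against a non-primitive additive character vanishes. -/
theorem charBlock_eq_zero [NeZero D] {χ : DirichletCharacter ℂ D} (hχ : χ.IsPrimitive) (hD : ¬ D ∣ q)
    {k : ZMod q} (hk : k * (D : ZMod q) = 0) : charBlock χ k = 0 := by
  have hζ : (ZMod.stdAddChar (-k) : ℂ) ^ D = 1 := by
    rw [← AddChar.map_nsmul_eq_pow, nsmul_eq_mul]
    have : (D : ZMod q) * -k = 0 := by linear_combination -hk
    rw [this, AddChar.map_zero_eq_one]
  set ψ := AddChar.zmodChar D hζ with hψ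
  have h1 : charBlock χ k = gaussSum χ ψ := by
    rw [charBlock, gaussSum, ← sum_Icc_natCast_eq_sum_zmod]
    refine Finset.sum_congr rfl fun c _ => ?_
    rw [hψ, AddChar.zmodChar_apply', ← AddChar.map_nsmul_eq_pow, nsmul_eq_mul, mul_comm,
      ← mul_neg]
  rw [h1]
  refine gaussSum_eq_zero_of_isPrimitive_of_not_isPrimitive ψ hχ fun hprim => hD ?_
  rw [← ZMod.natCast_eq_zero_iff]
  by_contra hq
  refine hprim hq (DFunLike.ext _ _ fun x => ?_)
  obtain ⟨y, rfl⟩ := ZMod.natCast_zmod_surjective x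
  rw [AddChar.mulShift_apply, AddChar.one_apply, ← Nat.cast_mul, hψ, AddChar.zmodChar_apply',
    ← AddChar.map_nsmul_eq_pow, nsmul_eq_mul, Nat.cast_mul, ZMod.natCast_self, zero_mul, zero_mul,
    AddChar.map_zero_eq_one]

/-- The part of the residue distribution of `χ` on a long interval with frequencies killed by
`D`. -/
noncomputable def residueMain (q : ℕ) (L : ℕ) : ZMod q → ℂ :=
  if D ∣ q then ((L : ℂ) / (q / D : ℕ)) •
    residueSum q (Finset.Ioc (D * 0) (D * (q / D))) (fun d => χ d) else 0

theorem norm_dft_residueSum_sub_residueMain_le [NeZero D] {χ : DirichletCharacter ℂ D} (hχ : χ.IsPrimitive)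
    {u v : ℕ} (huv : u ≤ v) (k : ZMod q) :
    ‖ZMod.dft (residueSum q (Finset.Ioc (D * u) (D * v)) (fun d => χ d) -
      residueMain χ q (v - u)) k‖ ≤ D * geomMajorant (k * (D : ZMod q)) := by
  have hmain : ZMod.dft (residueMain χ q (v - u)) k = if D ∣ q then ((v - u : ℕ) : ℂ) / (q / D : ℕ) *
      ((∑ t ∈ Finset.Ico 0 (q / D), (ZMod.stdAddChar (-(k * (D : ZMod q))) : ℂ) ^ t) *
        charBlock χ k) else 0 := by
    unfold residueMain
    split_ifs with h
    · rw [map_smul, Pi.smul_apply, dft_residueSum_Ioc χ (Nat.zero_le _), smul_eq_mul]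
    · simp
  rw [map_sub, Pi.sub_apply, dft_residueSum_Ioc χ huv, hmain]
  -- At these frequencies the majorant is zero, so exact cancellation is required: for `D ∣ q` both
  -- geometric sums just count blocks, otherwise `charBlock` vanishes.
  by_cases hk : k * (D : ZMod q) = 0
  · rw [hk, geomMajorant_zero, mul_zero, neg_zero, AddChar.map_zero_eq_one]
    apply le_of_eq
    rw [norm_eq_zero]
    split_ifs with h
    · simp only [one_pow, Finset.sum_const, Nat.card_Ico, nsmul_eq_mul, mul_one, Nat.sub_zero]
      have h2 : ((q / D : ℕ) : ℂ) ≠ 0 := by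
        have : 0 < q / D := Nat.div_pos (Nat.le_of_dvd (Nat.pos_of_ne_zero (NeZero.ne q)) h)
          (Nat.pos_of_ne_zero (NeZero.ne D))
        exact_mod_cast this.ne'
      field_simp
      ring
    · rw [charBlock_eq_zero hχ h hk]
      ring
  · have hzero : (if D ∣ q then ((v - u : ℕ) : ℂ) / (q / D : ℕ) *
      ((∑ t ∈ Finset.Ico 0 (q / D), (ZMod.stdAddChar (-(k * (D : ZMod q))) : ℂ) ^ t) *
        charBlock χ k) else 0) = 0 := by
      split_ifs with h
      · have hne : (ZMod.stdAddChar (-(k * (D : ZMod q))) : ℂ) ≠ 1 := by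
          rw [← AddChar.map_zero_eq_one (ZMod.stdAddChar (N := q))]
          exact fun h2 => hk (neg_eq_zero.1 (ZMod.injective_stdAddChar h2))
        rw [geom_sum_Ico hne (Nat.zero_le _), ← AddChar.map_nsmul_eq_pow, nsmul_eq_mul]
        have : ((q / D : ℕ) : ZMod q) * -(k * (D : ZMod q)) = 0 := by
          have h3 : ((q / D : ℕ) : ZMod q) * (D : ZMod q) = 0 := by
            rw [← Nat.cast_mul, Nat.div_mul_cancel h, ZMod.natCast_self]
          linear_combination (-k) * h3
        rw [this, AddChar.map_zero_eq_one]
        simp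
      · rfl
    rw [hzero, sub_zero, norm_mul, mul_comm, ← geomMajorant_neg]
    exact mul_le_mul (norm_charBlock_le χ k)
      (norm_sum_stdAddChar_pow_le (neg_ne_zero.2 hk) u v) (norm_nonneg _) (Nat.cast_nonneg _)

theorem norm_dft_residueSum_sub_const_le (y z : ℕ) (h : ZMod q) :
    ‖ZMod.dft (residueSum q (Finset.Ioc y z) (fun _ => 1) - fun _ => ((z - y : ℕ) : ℂ) / q) h‖ ≤
      geomMajorant h := by
  have hq : (q : ℂ) ≠ 0 := Nat.cast_ne_zero.2 (NeZero.ne q)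
  have h1 : ZMod.dft (fun _ : ZMod q => ((z - y : ℕ) : ℂ) / q) h =
      if h = 0 then ((z - y : ℕ) : ℂ) else 0 := by
    rw [ZMod.dft_apply]
    simp_rw [← mul_neg, smul_eq_mul]
    rw [← Finset.sum_mul, AddChar.sum_mulShift _ (ZMod.isPrimitive_stdAddChar q), ZMod.card]
    simp only [neg_eq_zero]
    split_ifs
    · field_simp
    · simp
  rw [map_sub, Pi.sub_apply, h1, dft_residueSum]
  by_cases hh : h = 0
  · subst hh
    simp [geomMajorant_zero]
  · rw [if_neg hh, sub_zero, ← geomMajorant_neg]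
    have h2 := norm_sum_stdAddChar_pow_le (neg_ne_zero.2 hh) (y + 1) (z + 1)
    convert h2 using 2
    rw [← Finset.Ico_add_one_add_one_eq_Ioc]
    refine Finset.sum_congr rfl fun d _ => ?_
    rw [mul_one, ← AddChar.map_nsmul_eq_pow, nsmul_eq_mul, mul_neg]

end BoxLemma

/-! ### Equidistribution of the weighted hyperbola in boxes. -/

section BoxCount

theorem changeLevel_natCast {D M : ℕ} (χ : DirichletCharacter ℂ D) (h : D ∣ M) (n : ℕ) :
    DirichletCharacter.changeLevel h χ (n : ZMod M) = if n.Coprime M then χ n else 0 := by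
  split_ifs with hn
  · have hu := (ZMod.isUnit_iff_coprime n M).2 hn
    have h1 := DirichletCharacter.changeLevel_eq_cast_of_dvd χ h hu.unit
    rw [hu.unit_spec] at h1
    rw [h1, ZMod.cast_natCast h]
  · exact MulChar.map_nonunit _ fun hu => hn ((ZMod.isUnit_iff_coprime n M).1 hu)

theorem DirichletCharacter.IsReal.mul_self_eq_one {D : ℕ} [NeZero D] {χ : DirichletCharacter ℂ D}
    (hχ : χ.IsReal) {x : ZMod D} (hx : IsUnit x) : χ x * χ x = 1 := by
  have h1 : ‖χ x‖ = 1 := by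
    have := χ.unit_norm_eq_one hx.unit
    rwa [hx.unit_spec] at this
  have h2 : (starRingEnd ℂ) (χ x) = χ x := Complex.conj_eq_iff_im.2 (hχ x)
  have h3 := Complex.mul_conj' (χ x)
  rw [h2, h1] at h3
  simpa using h3

theorem DirichletCharacter.IsPrimitive.ne_one {D : ℕ} {χ : DirichletCharacter ℂ D}
    (hχ : χ.IsPrimitive) (hD : 2 ≤ D) : χ ≠ 1 := by
  rintro rfl
  have h1 : (1 : DirichletCharacter ℂ D).conductor = D := hχ
  have : NeZero D := ⟨by omega⟩
  rw [DirichletCharacter.conductor_one] at h1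
  omega

variable {q : ℕ} [NeZero q] {D : ℕ}

open Classical in
/-- The indicator of the modular hyperbola `d m ≡ a`, weighted by `χ(d)`, minus its expected
value. -/
noncomputable def hyperbolaWeight (χ : DirichletCharacter ℂ D) (q a d m : ℕ) : ℂ :=
  (if (d : ZMod q) * m = a then χ d else 0) - (if d.Coprime q then χ d else 0) / q -
    (if D ∣ q then if m.Coprime q then χ a * χ m else 0 else 0) / q

theorem sum_Ioc_coprime_eq_zero {χ : DirichletCharacter ℂ D} (hχ : χ ≠ 1) (h : D ∣ q) :
    ∑ d ∈ Finset.Ioc (D * 0) (D * (q / D)), (if d.Coprime q then χ d else 0) = 0 := by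
  rw [mul_zero, Nat.mul_div_cancel' h]
  have h1 : Finset.Ioc 0 q = Finset.Icc 1 q := rfl
  rw [h1]
  simp_rw [← changeLevel_natCast χ h]
  rw [sum_Icc_natCast_eq_sum_zmod (fun x => DirichletCharacter.changeLevel h χ x)]
  refine MulChar.sum_eq_zero_of_ne_one ?_
  rwa [ne_eq, DirichletCharacter.changeLevel_eq_one_iff]

/-- Here `χ` is a function modulo `q`, the only residue is `d = a / m`, and `χ(m)⁻¹ = χ(m)` for real
`χ`. -/
theorem sum_Ioc_ite_mul_eq [NeZero D] {χ : DirichletCharacter ℂ D} (hχ : χ.IsReal) (h : D ∣ q) {a : ℕ}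
    (ha : a.Coprime q) (m : ℕ) :
    ∑ d ∈ Finset.Ioc (D * 0) (D * (q / D)), (if (d : ZMod q) * m = a then χ d else 0) =
      if m.Coprime q then χ a * χ m else 0 := by
  have hau := (ZMod.isUnit_iff_coprime a q).2 ha
  set χ' := DirichletCharacter.changeLevel h χ with hχ'
  rw [mul_zero, Nat.mul_div_cancel' h]
  have h1 : Finset.Ioc 0 q = Finset.Icc 1 q := rfl
  have h2 : ∀ d ∈ Finset.Icc 1 q, (if (d : ZMod q) * m = a then χ d else 0) =
      (fun x : ZMod q => if x * m = a then χ' x else 0) d := by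
    intro d _
    simp only []
    split_ifs with h3
    · rw [hχ', changeLevel_natCast, if_pos]
      exact (ZMod.isUnit_iff_coprime d q).1 (isUnit_of_mul_isUnit_left (h3 ▸ hau))
    · rfl
  rw [h1, Finset.sum_congr rfl h2,
    sum_Icc_natCast_eq_sum_zmod (fun x : ZMod q => if x * m = a then χ' x else 0)]
  split_ifs with hm
  · have hmu := (ZMod.isUnit_iff_coprime m q).2 hm
    have h4 : χ' a = χ a := by rw [hχ', changeLevel_natCast, if_pos ha]
    have h5 : χ' m = χ m := by rw [hχ', changeLevel_natCast, if_pos hm]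
    have hmD : IsUnit (m : ZMod D) :=
      (ZMod.isUnit_iff_coprime m D).2 (Nat.Coprime.coprime_dvd_right h hm)
    set x₀ : ZMod q := a * ((hmu.unit⁻¹ : (ZMod q)ˣ) : ZMod q) with hx₀
    have hinv : (m : ZMod q) * ((hmu.unit⁻¹ : (ZMod q)ˣ) : ZMod q) = 1 := hmu.mul_val_inv
    have hx₀m : x₀ * m = a := by rw [hx₀]; linear_combination (a : ZMod q) * hinv
    rw [Finset.sum_eq_single x₀]
    · rw [if_pos hx₀m]
      have h6 : χ' x₀ * χ' m = χ' a := by rw [← map_mul, hx₀m]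
      rw [h4, h5] at h6
      have h7 := hχ.mul_self_eq_one hmD
      linear_combination (χ (m : ZMod D)) * h6 - (χ' x₀) * h7
    · intro x _ hx
      rw [if_neg]
      intro h8
      exact hx (hmu.mul_left_injective (h8.trans hx₀m.symm))
    · simp
  · refine Finset.sum_eq_zero fun x _ => if_neg fun h3 => hm ?_
    rw [← ZMod.isUnit_iff_coprime]
    exact isUnit_of_mul_isUnit_right (h3 ▸ hau)

/-- Equidistribution of the modular hyperbola `d m ≡ a (mod q)` in boxes, with weight `χ(d)`. -/
theorem norm_sum_box_hyperbolaWeight_le [NeZero D] {χ : DirichletCharacter ℂ D} (hD : 2 ≤ D)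
    (hχ : χ.IsPrimitive) (hreal : χ.IsReal) {a : ℕ} (ha : a.Coprime q) {u v : ℕ} (huv : u ≤ v)
    (y z : ℕ) :
    ‖∑ d ∈ Finset.Ioc (D * u) (D * v), ∑ m ∈ Finset.Ioc y z, hyperbolaWeight χ q a d m‖ ≤
      D * boxError q := by
  classical
  have hau := (ZMod.isUnit_iff_coprime a q).2 ha
  have hqC : (q : ℂ) ≠ 0 := Nat.cast_ne_zero.2 (NeZero.ne q)
  have hDC : (D : ℂ) ≠ 0 := Nat.cast_ne_zero.2 (NeZero.ne D)
  set f := residueSum q (Finset.Ioc (D * u) (D * v)) (fun d => χ d) with hf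
  set g := residueSum q (Finset.Ioc y z) (fun _ => 1) with hg
  set f₁ := residueMain χ q (v - u) with hf₁
  set c : ℂ := ((z - y : ℕ) : ℂ) / q with hc
  set g₀ : ZMod q → ℂ := g - fun _ => c with hg₀
  have hbound := norm_sum_units_mul_le hau D (F := f - f₁) (G := g₀)
    (norm_dft_residueSum_sub_residueMain_le hχ huv) (norm_dft_residueSum_sub_const_le y z)
  have e1 := sum_units_residueSum_mul (Finset.Ioc (D * u) (D * v)) (Finset.Ioc y z)
    (fun d => χ d) hau
  rw [← hf, ← hg] at e1
  have e2 := sum_units_residueSum (q := q) (Finset.Ioc (D * u) (D * v)) (fun d => χ d)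
  rw [← hf] at e2
  -- `f₁` has sum zero over the units, and paired with `g` it gives the second expected value in
  -- `hyperbolaWeight`. Expanding `(f - f₁) * (g - c)` therefore reproduces the weight exactly.
  have e3 : ∑ r : (ZMod q)ˣ, f₁ r = 0 := by
    rw [hf₁, residueMain]
    split_ifs with h
    · simp only [Pi.smul_apply, smul_eq_mul, ← Finset.mul_sum]
      rw [sum_units_residueSum, sum_Ioc_coprime_eq_zero (hχ.ne_one hD) h, mul_zero]
    · simp
  have e4 : ∑ r : (ZMod q)ˣ, f₁ r * g (a * ((r⁻¹ : (ZMod q)ˣ) : ZMod q)) =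
      ∑ d ∈ Finset.Ioc (D * u) (D * v), ∑ m ∈ Finset.Ioc y z,
        (if D ∣ q then if m.Coprime q then χ a * χ m else 0 else 0) / (q : ℂ) := by
    rw [hf₁, residueMain]
    by_cases h : D ∣ q
    · simp only [if_pos h]
      simp only [Pi.smul_apply, smul_eq_mul, mul_assoc, ← Finset.mul_sum]
      rw [hg, sum_units_residueSum_mul _ _ _ hau, Finset.sum_comm]
      simp_rw [sum_Ioc_ite_mul_eq hreal h ha]
      rw [← Finset.sum_div, Finset.sum_const, Nat.card_Ioc, nsmul_eq_mul]
      have h2 : (D * v - D * u : ℕ) = D * (v - u) := (Nat.mul_sub D v u).symm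
      have h3 : ((q / D : ℕ) : ℂ) = q / D := by rw [Nat.cast_div h hDC]
      rw [h2, h3]
      push_cast
      field_simp
    · simp [if_neg h]
  have hid : ∑ d ∈ Finset.Ioc (D * u) (D * v), ∑ m ∈ Finset.Ioc y z, hyperbolaWeight χ q a d m =
      ∑ r : (ZMod q)ˣ, (f - f₁) r * g₀ (a * ((r⁻¹ : (ZMod q)ˣ) : ZMod q)) := by
    simp only [hyperbolaWeight, Finset.sum_sub_distrib]
    rw [← e4, ← e1]
    have e5 : ∑ d ∈ Finset.Ioc (D * u) (D * v), ∑ m ∈ Finset.Ioc y z,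
        (if d.Coprime q then χ d else 0) / (q : ℂ) = c * ∑ r : (ZMod q)ˣ, f r := by
      rw [e2, Finset.mul_sum]
      refine Finset.sum_congr rfl fun d _ => ?_
      rw [Finset.sum_const, Nat.card_Ioc, nsmul_eq_mul, hc]
      ring
    rw [e5]
    have e6 : ∑ r : (ZMod q)ˣ, (f - f₁) r *
        g₀ (a * ((r⁻¹ : (ZMod q)ˣ) : ZMod q)) =
        ∑ r : (ZMod q)ˣ, f r * g (a * ((r⁻¹ : (ZMod q)ˣ) : ZMod q)) -
        c * ∑ r : (ZMod q)ˣ, f r -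
        ∑ r : (ZMod q)ˣ, f₁ r * g (a * ((r⁻¹ : (ZMod q)ˣ) : ZMod q)) +
        c * ∑ r : (ZMod q)ˣ, f₁ r := by
      rw [Finset.mul_sum, Finset.mul_sum, ← Finset.sum_sub_distrib, ← Finset.sum_sub_distrib,
        ← Finset.sum_add_distrib]
      refine Finset.sum_congr rfl fun r _ => ?_
      simp only [hg₀, Pi.sub_apply]
      ring
    rw [e6, e3]
    ring
  rw [hid]
  exact hbound

end BoxCount

/-! ### From boxes to the region under a hyperbola. -/

section HyperbolaSum

open scoped Finset

theorem sum_Ioc_divisorsAntidiagonal {M : Type*} [AddCommMonoid M] (F : ℕ → ℕ → M) (N : ℕ) :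
    ∑ n ∈ Finset.Ioc 0 N, ∑ p ∈ n.divisorsAntidiagonal, F p.1 p.2 =
      ∑ d ∈ Finset.Ioc 0 N, ∑ m ∈ Finset.Ioc 0 (N / d), F d m := by
  trans ∑ x ∈ Finset.Ioc 0 N ×ˢ Finset.Ioc 0 N with x.1 * x.2 ≤ N, F x.1 x.2
  · trans ∑ n ∈ Finset.Ioc 0 N,
      ∑ x ∈ Finset.Ioc 0 N ×ˢ Finset.Ioc 0 N with x.1 * x.2 = n, F x.1 x.2
    · refine Finset.sum_congr rfl fun n hn => ?_
      rw [Finset.mem_Ioc] at hn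
      rw [Nat.divisorsAntidiagonal_eq_prod_filter_of_le hn.1.ne' hn.2]
    · simp_rw [Finset.sum_filter]
      rw [Finset.sum_comm]
      refine Finset.sum_congr rfl fun x hx => ?_
      simp only [Finset.mem_product, Finset.mem_Ioc] at hx
      have : 0 < x.1 * x.2 := Nat.mul_pos hx.1.1 hx.2.1
      simp [this]
  · rw [Finset.sum_filter, Finset.sum_product]
    refine Finset.sum_congr rfl fun d hd => ?_
    rw [← Finset.sum_filter]
    refine Finset.sum_congr ?_ fun _ _ => rfl
    ext m
    simp only [Finset.mem_filter, Finset.mem_Ioc] at hd ⊢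
    rw [Nat.le_div_iff_mul_le hd.1, mul_comm m d]
    constructor
    · rintro ⟨⟨h1, -⟩, h2⟩
      exact ⟨h1, h2⟩
    · rintro ⟨h1, h2⟩
      exact ⟨⟨h1, (Nat.le_mul_of_pos_left m hd.1).trans h2⟩, h2⟩

theorem abs_card_filter_modEq_sub_le {q : ℕ} (hq : 0 < q) {y z : ℕ} (hyz : y ≤ z) (c : ℕ) :
    |(#{m ∈ Finset.Ioc y z | m ≡ c [MOD q]} : ℝ) - ((z - y : ℕ) : ℝ) / q| ≤ 1 := by
  have h1 := Nat.Ioc_filter_modEq_card y z hq c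
  have hq' : (0 : ℚ) < q := by exact_mod_cast hq
  have hyz' : (y : ℚ) ≤ z := by exact_mod_cast hyz
  have h2 : |(#{m ∈ Finset.Ioc y z | m ≡ c [MOD q]} : ℚ) - ((z - y : ℕ) : ℚ) / q| ≤ 1 := by
    have h3 : (#{m ∈ Finset.Ioc y z | m ≡ c [MOD q]} : ℚ) =
        max (⌊((z : ℚ) - c) / (q : ℚ)⌋ - ⌊((y : ℚ) - c) / (q : ℚ)⌋ : ℚ) 0 := by
      exact_mod_cast h1
    have h4 : ((z - y : ℕ) : ℚ) / q = ((z : ℚ) - c) / q - ((y : ℚ) - c) / q := by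
      rw [Nat.cast_sub hyz]; ring
    have h5 : ((y : ℚ) - c) / q ≤ ((z : ℚ) - c) / q := by gcongr
    have h6 : (⌊((y : ℚ) - c) / (q : ℚ)⌋ : ℚ) ≤ ⌊((z : ℚ) - c) / (q : ℚ)⌋ := by
      exact_mod_cast Int.floor_mono h5
    rw [h3, h4, max_eq_left (by linarith), abs_le]
    have i1 := Int.floor_le (((y : ℚ) - c) / q)
    have i2 := Int.lt_floor_add_one (((y : ℚ) - c) / q)
    have i3 := Int.floor_le (((z : ℚ) - c) / q)
    have i4 := Int.lt_floor_add_one (((z : ℚ) - c) / q)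
    constructor <;> linarith
  have h7 := (Rat.cast_le (K := ℝ)).2 h2
  simpa only [Rat.cast_abs, Rat.cast_sub, Rat.cast_div, Rat.cast_natCast, Rat.cast_one] using h7

variable {q : ℕ} [NeZero q] {D : ℕ} {χ : DirichletCharacter ℂ D}

theorem norm_sum_Ioc_coprime_le (hχ : χ ≠ 1) (h : D ∣ q) (y : ℕ) :
    ‖∑ m ∈ Finset.Ioc 0 y, (if m.Coprime q then χ m else 0)‖ ≤ q := by
  have hq := Nat.pos_of_ne_zero (NeZero.ne q)
  have h0 : ∑ d ∈ Finset.Icc 1 q, (if d.Coprime q then χ d else 0) = 0 := by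
    have := sum_Ioc_coprime_eq_zero hχ h
    rwa [mul_zero, Nat.mul_div_cancel' h] at this
  have hterm : ∀ m : ℕ, ‖(if m.Coprime q then χ m else 0)‖ ≤ 1 := by
    intro m
    split_ifs
    · exact χ.norm_le_one _
    · simp
  rw [← Finset.sum_Ioc_consecutive _ (Nat.zero_le (q * (y / q))) (Nat.mul_div_le y q)]
  have h1 : ∑ m ∈ Finset.Ioc 0 (q * (y / q)), (if m.Coprime q then χ m else 0) = 0 := by
    have h2 := sum_Ioc_mul_eq q (Nat.zero_le (y / q)) fun m => if m.Coprime q then χ m else 0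
    rw [mul_zero] at h2
    rw [h2]
    refine Finset.sum_eq_zero fun t _ => ?_
    refine (Finset.sum_congr rfl fun c _ => ?_).trans h0
    have h3 : (q : ZMod D) = 0 := (ZMod.natCast_eq_zero_iff q D).2 h
    have h4 : (q * t + c).Coprime q ↔ c.Coprime q := by
      rw [add_comm, Nat.coprime_add_mul_left_left]
    simp only [h4, Nat.cast_add, Nat.cast_mul, h3, zero_mul, zero_add]
  rw [h1, zero_add]
  refine (norm_sum_le_of_le _ fun m _ => hterm m).trans ?_
  rw [Finset.sum_const, Nat.card_Ioc, nsmul_eq_mul, mul_one]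
  have := Nat.mod_lt y hq
  have h5 := Nat.div_add_mod y q
  exact_mod_cast (by omega : y - q * (y / q) ≤ q)

/-- For fixed `d` coprime to `q`, `m` runs through one residue class, whose count is within `1` of
its mean. The `χ(m)` term is `1 / q` times a sum bounded by one period `q`. -/
theorem norm_sum_row_hyperbolaWeight_le (hχ : χ ≠ 1) {a : ℕ} (ha : a.Coprime q) (d y : ℕ) :
    ‖∑ m ∈ Finset.Ioc 0 y, hyperbolaWeight χ q a d m‖ ≤ 2 := by
  have hq := Nat.pos_of_ne_zero (NeZero.ne q)
  have hqR : (0 : ℝ) < q := by exact_mod_cast hq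
  have hau := (ZMod.isUnit_iff_coprime a q).2 ha
  simp only [hyperbolaWeight, Finset.sum_sub_distrib]
  have h1 : ‖∑ m ∈ Finset.Ioc 0 y,
      (if D ∣ q then if m.Coprime q then χ a * χ m else 0 else 0) / (q : ℂ)‖ ≤ 1 := by
    by_cases h : D ∣ q
    · simp only [if_pos h, ← Finset.sum_div]
      have h2 : ∀ m : ℕ, (if m.Coprime q then χ a * χ m else 0) =
          χ a * if m.Coprime q then χ m else 0 := by
        intro m; rw [mul_ite, mul_zero]
      simp_rw [h2, ← Finset.mul_sum]
      rw [norm_div, norm_mul, Complex.norm_natCast, div_le_one hqR]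
      calc _ ≤ 1 * (q : ℝ) := by
            gcongr
            · exact χ.norm_le_one _
            · exact norm_sum_Ioc_coprime_le hχ h y
        _ = q := one_mul _
    · simp [if_neg h]
  have h2 : ‖∑ m ∈ Finset.Ioc 0 y, (if (d : ZMod q) * m = a then χ d else 0) -
      ∑ m ∈ Finset.Ioc 0 y, (if d.Coprime q then χ d else 0) / (q : ℂ)‖ ≤ 1 := by
    by_cases hd : d.Coprime q
    · have hdu := (ZMod.isUnit_iff_coprime d q).2 hd
      obtain ⟨c, hc⟩ := ZMod.natCast_zmod_surjective
        ((a : ZMod q) * ((hdu.unit⁻¹ : (ZMod q)ˣ) : ZMod q))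
      have hinv : (d : ZMod q) * ((hdu.unit⁻¹ : (ZMod q)ˣ) : ZMod q) = 1 := hdu.mul_val_inv
      have h3 : ∀ m : ℕ, (d : ZMod q) * m = a ↔ m ≡ c [MOD q] := by
        intro m
        rw [← ZMod.natCast_eq_natCast_iff, hc]
        constructor
        · intro h4
          linear_combination ((hdu.unit⁻¹ : (ZMod q)ˣ) : ZMod q) * h4 - (m : ZMod q) * hinv
        · intro h4
          linear_combination (d : ZMod q) * h4 + (a : ZMod q) * hinv
      simp only [h3, if_pos hd]
      rw [← Finset.sum_filter, Finset.sum_const, Finset.sum_const, Nat.card_Ioc, nsmul_eq_mul,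
        nsmul_eq_mul]
      have h5 := abs_card_filter_modEq_sub_le hq (Nat.zero_le y) c
      have h6 : ((#{m ∈ Finset.Ioc 0 y | m ≡ c [MOD q]} : ℕ) : ℂ) * χ d -
          ((y - 0 : ℕ) : ℂ) * (χ d / q) =
          (((#{m ∈ Finset.Ioc 0 y | m ≡ c [MOD q]} : ℝ) - ((y - 0 : ℕ) : ℝ) / q : ℝ) : ℂ) *
            χ d := by
        push_cast
        ring
      rw [h6, norm_mul, Complex.norm_real, Real.norm_eq_abs]
      calc _ ≤ (1 : ℝ) * 1 := by
            gcongr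
            exact χ.norm_le_one _
        _ = 1 := one_mul _
    · have h3 : ∀ m : ℕ, ¬ (d : ZMod q) * m = a := fun m h4 =>
        hd ((ZMod.isUnit_iff_coprime d q).1 (isUnit_of_mul_isUnit_left (h4 ▸ hau)))
      simp [h3, if_neg hd]
  calc _ ≤ (1 : ℝ) + 1 := (norm_sub_le _ _).trans (add_le_add h2 h1)
    _ = 2 := by norm_num

theorem norm_hyperbolaWeight_le (a d m : ℕ) :
    ‖hyperbolaWeight χ q a d m‖ ≤ (if d * m ≡ a [MOD q] then 1 else 0) + 2 / q := by
  have hqR : (0 : ℝ) < q := by exact_mod_cast Nat.pos_of_ne_zero (NeZero.ne q)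
  have h1 : ‖(if (d : ZMod q) * m = a then χ d else 0)‖ ≤ if d * m ≡ a [MOD q] then 1 else 0 := by
    simp only [← ZMod.natCast_eq_natCast_iff, Nat.cast_mul]
    split_ifs
    · exact χ.norm_le_one _
    · simp
  have h2 : ‖(if d.Coprime q then χ d else 0) / (q : ℂ)‖ ≤ 1 / q := by
    rw [norm_div, Complex.norm_natCast]
    gcongr
    split_ifs
    · exact χ.norm_le_one _
    · simp
  have h3 : ‖(if D ∣ q then if m.Coprime q then χ a * χ m else 0 else 0) / (q : ℂ)‖ ≤ 1 / q := by
    rw [norm_div, Complex.norm_natCast]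
    gcongr
    split_ifs
    · rw [norm_mul]
      exact mul_le_one₀ (χ.norm_le_one _) (norm_nonneg _) (χ.norm_le_one _)
    · simp
    · simp
  calc _ ≤ (if d * m ≡ a [MOD q] then (1 : ℝ) else 0) + 1 / q + 1 / q :=
        (norm_sub_le _ _).trans (add_le_add ((norm_sub_le _ _).trans (add_le_add h1 h2)) h3)
    _ = _ := by ring

/-- A sequence of natural numbers growing by a factor of about `1 + 1/k` at each step. -/
def geomNat (k : ℕ) : ℕ → ℕ
  | 0 => k
  | i + 1 => geomNat k i + geomNat k i / k

theorem geomNat_le_succ (k i : ℕ) : geomNat k i ≤ geomNat k (i + 1) := Nat.le_add_right _ _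

theorem geomNat_monotone (k : ℕ) : Monotone (geomNat k) := monotone_nat_of_le_succ (geomNat_le_succ k)

theorem mul_geomNat_succ_le (k i : ℕ) : k * geomNat k (i + 1) ≤ (k + 1) * geomNat k i := by
  have := Nat.mul_div_le (geomNat k i) k
  rw [geomNat]
  linarith

/-- Since `geomNat k i ≥ k`, the floor at most halves the increment, so each step gains `1 + 1 / (2
k)` and, by Bernoulli, `2 k` steps gain a factor `2`. -/
theorem le_geomNat {k : ℕ} (hk : 0 < k) (L : ℕ) : 2 ^ L ≤ geomNat k (2 * k * L) := by
  have hkR : (0 : ℝ) < k := by exact_mod_cast hk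
  have h1 : ∀ i, k ≤ geomNat k i := fun i => geomNat_monotone k (Nat.zero_le i)
  have h2 : ∀ i, (1 + 1 / (2 * k : ℝ)) ^ i ≤ geomNat k i := by
    intro i
    induction i with
    | zero => simpa [geomNat] using (by exact_mod_cast hk : (1 : ℝ) ≤ k)
    | succ i ih =>
      have h3 : geomNat k i ≤ 2 * k * (geomNat k i / k) := by
        have i1 := Nat.div_add_mod (geomNat k i) k
        have i2 := Nat.mod_lt (geomNat k i) hk
        have i3 : 1 ≤ geomNat k i / k := (Nat.one_le_div_iff hk).2 (h1 i)
        nlinarith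
      have h4 : (geomNat k i : ℝ) / (2 * k) ≤ (geomNat k i / k : ℕ) := by
        rw [div_le_iff₀ (by positivity), mul_comm]
        exact_mod_cast h3
      calc (1 + 1 / (2 * k : ℝ)) ^ (i + 1) ≤ geomNat k i * (1 + 1 / (2 * k : ℝ)) := by
            rw [pow_succ]; gcongr
        _ = geomNat k i + (geomNat k i : ℝ) / (2 * k) := by ring
        _ ≤ geomNat k i + (geomNat k i / k : ℕ) := by gcongr
        _ = (geomNat k (i + 1) : ℕ) := by rw [geomNat]; push_cast; ring
  have h5 : (2 : ℝ) ≤ (1 + 1 / (2 * k : ℝ)) ^ (2 * k) := by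
    have h6 := one_add_mul_le_pow (a := 1 / (2 * k : ℝ)) (by
      have : (0 : ℝ) ≤ 1 / (2 * k : ℝ) := by positivity
      linarith) (2 * k)
    have h7 : 1 + ((2 * k : ℕ) : ℝ) * (1 / (2 * k : ℝ)) = 2 := by
      push_cast
      field_simp
      norm_num
    linarith
  have h8 : (2 : ℝ) ^ L ≤ geomNat k (2 * k * L) :=
    (pow_le_pow_left₀ (by norm_num) h5 L).trans (by rw [← pow_mul]; exact h2 _)
  exact_mod_cast h8

/-- Splitting the region under a hyperbola into boxes. -/
theorem norm_sum_hyperbola_le (w : ℕ → ℕ → ℂ) (D : ℕ) {k : ℕ} (hk : 0 < k) {B : ℝ} {N L : ℕ}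
    (hN : N ≤ D * 2 ^ L)
    (hrow : ∀ d y, ‖∑ m ∈ Finset.Ioc 0 y, w d m‖ ≤ 2)
    (hbox : ∀ u v y z, u ≤ v →
      ‖∑ d ∈ Finset.Ioc (D * u) (D * v), ∑ m ∈ Finset.Ioc y z, w d m‖ ≤ B) :
    ‖∑ n ∈ Finset.Ioc 0 N, ∑ p ∈ n.divisorsAntidiagonal, w p.1 p.2‖ ≤
      2 * (D * k) + 2 * k * L * B +
        ∑ n ∈ Finset.Ioc (k * N / (k + 1)) N, ∑ p ∈ n.divisorsAntidiagonal, ‖w p.1 p.2‖ := by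
  set J := 2 * k * L with hJ
  set b : ℕ → ℕ → ℝ := fun d m => if k * N < (k + 1) * (d * m) then ‖w d m‖ else 0 with hb
  have hb0 : ∀ d m, 0 ≤ b d m := by
    intro d m
    simp only [hb]
    split_ifs <;> simp
  have hNJ : N ≤ D * geomNat k J := hN.trans (Nat.mul_le_mul_left _ (le_geomNat hk L))
  have hext : ∀ {M : Type} [AddCommMonoid M] (F : ℕ → ℕ → M),
      ∑ d ∈ Finset.Ioc 0 N, ∑ m ∈ Finset.Ioc 0 (N / d), F d m =
        ∑ d ∈ Finset.Ioc 0 (D * geomNat k J), ∑ m ∈ Finset.Ioc 0 (N / d), F d m := by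
    intro M _ F
    refine Finset.sum_subset (Finset.Ioc_subset_Ioc_right hNJ) fun d hd hd2 => ?_
    rw [Finset.mem_Ioc] at hd hd2
    rw [Nat.div_eq_of_lt (by omega), Finset.Ioc_self, Finset.sum_empty]
  have hleft : ∑ n ∈ Finset.Ioc (k * N / (k + 1)) N, ∑ p ∈ n.divisorsAntidiagonal, ‖w p.1 p.2‖ =
      ∑ d ∈ Finset.Ioc 0 (D * geomNat k J), ∑ m ∈ Finset.Ioc 0 (N / d), b d m := by
    rw [← hext, ← sum_Ioc_divisorsAntidiagonal]
    have h1 : Finset.Ioc (k * N / (k + 1)) N ⊆ Finset.Ioc 0 N :=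
      Finset.Ioc_subset_Ioc_left (Nat.zero_le _)
    have h3 : ∀ n, ∀ p ∈ n.divisorsAntidiagonal,
        b p.1 p.2 = if k * N < (k + 1) * n then ‖w p.1 p.2‖ else 0 := by
      intro n p hp
      simp only [hb, (Nat.mem_divisorsAntidiagonal.1 hp).1]
    rw [← Finset.sum_subset h1]
    · refine Finset.sum_congr rfl fun n hn => Finset.sum_congr rfl fun p hp => ?_
      rw [h3 n p hp, if_pos]
      rw [Finset.mem_Ioc, Nat.div_lt_iff_lt_mul (by omega)] at hn
      linarith [hn.1]
    · intro n hn hn2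
      refine Finset.sum_eq_zero fun p hp => ?_
      rw [h3 n p hp, if_neg]
      rw [Finset.mem_Ioc] at hn hn2
      rw [Nat.div_lt_iff_lt_mul (by omega)] at hn2
      intro h4
      exact hn2 ⟨by linarith, hn.2⟩
  have hcons : ∀ {M : Type} [AddCommMonoid M] (f : ℕ → M),
      ∑ d ∈ Finset.Ioc 0 (D * geomNat k J), f d = ∑ d ∈ Finset.Ioc 0 (D * k), f d +
        ∑ i ∈ Finset.range J,
          ∑ d ∈ Finset.Ioc (D * geomNat k i) (D * geomNat k (i + 1)), f d := by
    intro M _ f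
    generalize J = j
    induction j with
    | zero => simp [geomNat]
    | succ j ih =>
      rw [Finset.sum_range_succ, ← add_assoc, ← ih]
      exact (Finset.sum_Ioc_consecutive f (Nat.zero_le _)
        (Nat.mul_le_mul_left D (geomNat_le_succ k j))).symm
  have hblock : ∀ i, ‖∑ d ∈ Finset.Ioc (D * geomNat k i) (D * geomNat k (i + 1)),
      ∑ m ∈ Finset.Ioc 0 (N / d), w d m‖ ≤ B +
        ∑ d ∈ Finset.Ioc (D * geomNat k i) (D * geomNat k (i + 1)),
          ∑ m ∈ Finset.Ioc 0 (N / d), b d m := by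
    intro i
    -- The greatest height at which the whole block stays under the hyperbola.
    set z := N / (D * geomNat k (i + 1)) with hz
    have h1 : ∀ d ∈ Finset.Ioc (D * geomNat k i) (D * geomNat k (i + 1)), z ≤ N / d := by
      intro d hd
      rw [Finset.mem_Ioc] at hd
      exact Nat.div_le_div_left hd.2 (by omega)
    have h2 : ∑ d ∈ Finset.Ioc (D * geomNat k i) (D * geomNat k (i + 1)),
        ∑ m ∈ Finset.Ioc 0 (N / d), w d m =
        ∑ d ∈ Finset.Ioc (D * geomNat k i) (D * geomNat k (i + 1)),
          ∑ m ∈ Finset.Ioc 0 z, w d m +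
        ∑ d ∈ Finset.Ioc (D * geomNat k i) (D * geomNat k (i + 1)),
          ∑ m ∈ Finset.Ioc z (N / d), w d m := by
      rw [← Finset.sum_add_distrib]
      exact Finset.sum_congr rfl fun d hd =>
        (Finset.sum_Ioc_consecutive _ (Nat.zero_le _) (h1 d hd)).symm
    rw [h2]
    refine (norm_add_le _ _).trans (add_le_add (hbox _ _ _ _ (geomNat_le_succ k i)) ?_)
    refine norm_sum_le_of_le _ fun d hd => ?_
    calc _ ≤ ∑ m ∈ Finset.Ioc z (N / d), b d m := by
          refine norm_sum_le_of_le _ fun m hm => ?_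
          simp only [hb]
          rw [if_pos]
          rw [Finset.mem_Ioc] at hd hm
          have h3 : 0 < D * geomNat k (i + 1) := by omega
          have h4 : N < m * (D * geomNat k (i + 1)) := (Nat.div_lt_iff_lt_mul h3).1 hm.1
          -- A point above the box is close to the hyperbola, because consecutive terms of `geomNat`
          -- have ratio at most `(k + 1) / k`.
          calc k * N < k * (m * (D * geomNat k (i + 1))) := Nat.mul_lt_mul_of_pos_left h4 hk
            _ = m * D * (k * geomNat k (i + 1)) := by ring
            _ ≤ m * D * ((k + 1) * geomNat k i) :=
                Nat.mul_le_mul_left _ (mul_geomNat_succ_le k i)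
            _ = (k + 1) * ((D * geomNat k i) * m) := by ring
            _ ≤ _ := Nat.mul_le_mul_left _ (Nat.mul_le_mul_right _ hd.1.le)
      _ ≤ _ := Finset.sum_le_sum_of_subset_of_nonneg
          (Finset.Ioc_subset_Ioc_left (Nat.zero_le _)) fun m _ _ => hb0 d m
  rw [hleft, sum_Ioc_divisorsAntidiagonal, hext, hcons, hcons]
  have h1 : ‖∑ d ∈ Finset.Ioc 0 (D * k), ∑ m ∈ Finset.Ioc 0 (N / d), w d m‖ ≤ 2 * (D * k) := by
    refine (norm_sum_le_of_le _ fun d _ => hrow d _).trans (le_of_eq ?_)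
    rw [Finset.sum_const, Nat.card_Ioc, nsmul_eq_mul, Nat.sub_zero]
    push_cast
    ring
  have h2 : ‖∑ i ∈ Finset.range J, ∑ d ∈ Finset.Ioc (D * geomNat k i) (D * geomNat k (i + 1)),
      ∑ m ∈ Finset.Ioc 0 (N / d), w d m‖ ≤ 2 * k * L * B + ∑ i ∈ Finset.range J,
        ∑ d ∈ Finset.Ioc (D * geomNat k i) (D * geomNat k (i + 1)),
          ∑ m ∈ Finset.Ioc 0 (N / d), b d m := by
    refine (norm_sum_le_of_le _ fun i _ => hblock i).trans (le_of_eq ?_)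
    rw [Finset.sum_add_distrib, Finset.sum_const, Finset.card_range, nsmul_eq_mul, hJ]
    push_cast
    ring
  have h3 : 0 ≤ ∑ d ∈ Finset.Ioc 0 (D * k), ∑ m ∈ Finset.Ioc 0 (N / d), b d m :=
    Finset.sum_nonneg fun d _ => Finset.sum_nonneg fun m _ => hb0 d m
  linarith [norm_add_le (∑ d ∈ Finset.Ioc 0 (D * k), ∑ m ∈ Finset.Ioc 0 (N / d), w d m)
    (∑ i ∈ Finset.range J, ∑ d ∈ Finset.Ioc (D * geomNat k i) (D * geomNat k (i + 1)),
      ∑ m ∈ Finset.Ioc 0 (N / d), w d m)]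

/-- Equidistribution of `d m ≡ a (mod q)` with weight `χ(d)` under the hyperbola `d m ≤ N`. -/
theorem norm_sum_hyperbolaWeight_le [NeZero D] (hD : 2 ≤ D) (hχ : χ.IsPrimitive)
    (hreal : χ.IsReal) {a : ℕ} (ha : a.Coprime q) {k N L : ℕ} (hk : 0 < k) (hN : N ≤ 2 ^ L)
    {T : ℝ} (hT : ∀ n ∈ Finset.Ioc 0 N, (n.divisors.card : ℝ) ≤ T) (hT0 : 0 ≤ T) :
    ‖∑ n ∈ Finset.Ioc 0 N, ∑ p ∈ n.divisorsAntidiagonal, hyperbolaWeight χ q a p.1 p.2‖ ≤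
      2 * (D * k) + 2 * k * L * (D * boxError q) + T * (3 * N / (k * q) + 6) := by
  have hq := Nat.pos_of_ne_zero (NeZero.ne q)
  have hqR : (1 : ℝ) ≤ q := by exact_mod_cast hq
  have hkR : (0 : ℝ) < k := by exact_mod_cast hk
  refine (norm_sum_hyperbola_le _ D hk (hN.trans (Nat.le_mul_of_pos_left _ (by omega)))
    (norm_sum_row_hyperbolaWeight_le (hχ.ne_one hD) ha)
    (fun u v y z huv => norm_sum_box_hyperbolaWeight_le hD hχ hreal ha huv y z)).trans ?_
  gcongr
  set s := k * N / (k + 1) with hs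
  have hsN : s ≤ N := by
    rw [hs]
    refine Nat.div_le_of_le_mul ?_
    gcongr
    omega
  have hcard : ((N - s : ℕ) : ℝ) ≤ N / k + 1 := by
    have h1 : k * N < (s + 1) * (k + 1) := Nat.lt_mul_of_div_lt (Nat.lt_succ_self _) (by omega)
    have h2 : (k : ℝ) * N < (s + 1) * (k + 1) := by exact_mod_cast h1
    have h3 : (N : ℝ) / (k + 1) ≤ N / k := by
      gcongr
      linarith
    rw [Nat.cast_sub hsN]
    have h4 : (N : ℝ) - N / (k + 1) < s + 1 := by
      have : (N : ℝ) - N / (k + 1) = k * N / (k + 1) := by field_simp; ring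
      rw [this, div_lt_iff₀ (by positivity)]
      exact h2
    linarith
  -- The tail is bounded absolutely: each `n` has at most `T` factorisations, and `n` lies in an
  -- interval of length at most `N / k + 1`.
  calc ∑ n ∈ Finset.Ioc s N, ∑ p ∈ n.divisorsAntidiagonal, ‖hyperbolaWeight χ q a p.1 p.2‖
      ≤ ∑ n ∈ Finset.Ioc s N, T * ((if n ≡ a [MOD q] then 1 else 0) + 2 / q) := by
        refine Finset.sum_le_sum fun n hn => ?_
        have h1 : ∀ p ∈ n.divisorsAntidiagonal, ‖hyperbolaWeight χ q a p.1 p.2‖ ≤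
            (if n ≡ a [MOD q] then 1 else 0) + 2 / q := by
          intro p hp
          rw [← (Nat.mem_divisorsAntidiagonal.1 hp).1]
          exact norm_hyperbolaWeight_le a p.1 p.2
        refine (Finset.sum_le_sum h1).trans ?_
        rw [Finset.sum_const, nsmul_eq_mul, ← Nat.map_div_right_divisors, Finset.card_map]
        refine mul_le_mul_of_nonneg_right (hT n ?_) ?_
        · exact Finset.Ioc_subset_Ioc_left (Nat.zero_le _) hn
        · split_ifs <;> positivity
    _ = T * (#{n ∈ Finset.Ioc s N | n ≡ a [MOD q]} + (N - s : ℕ) * (2 / q)) := by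
        rw [← Finset.mul_sum, Finset.sum_add_distrib, Finset.sum_boole, Finset.sum_const,
          Nat.card_Ioc, nsmul_eq_mul]
    _ ≤ T * (((N - s : ℕ) / q + 1) + (N - s : ℕ) * (2 / q)) := by
        gcongr
        linarith [(abs_le.1 (abs_card_filter_modEq_sub_le hq hsN a)).2]
    _ = T * ((N - s : ℕ) * (3 / q) + 1) := by ring
    _ ≤ T * ((N / k + 1) * (3 / q) + 1) := by gcongr
    _ ≤ T * (3 * N / (k * q) + 6) := by
        refine mul_le_mul_of_nonneg_left ?_ hT0
        have h1 : (N / k + 1) * (3 / q : ℝ) = 3 * N / (k * q) + 3 / q := by field_simp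
        have h2 : (3 : ℝ) / q ≤ 3 := div_le_self (by norm_num) hqR
        rw [h1]
        linarith

end HyperbolaSum

/-! ### The divisor bound and the size of the box error. -/

section DivisorBound

theorem add_one_le_mul_two_rpow {η : ℝ} (hη : 0 < η) (v : ℕ) :
    (v + 1 : ℝ) ≤ (1 / (η * Real.log 2) + 1) * (2 : ℝ) ^ (v * η) := by
  have hlog : 0 < Real.log 2 := Real.log_pos (by norm_num)
  have h1 : 1 + v * (η * Real.log 2) ≤ (2 : ℝ) ^ (v * η) := by
    rw [Real.rpow_def_of_pos (by norm_num)]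
    have := Real.add_one_le_exp (Real.log 2 * (v * η))
    linarith
  have h2 : 0 ≤ 1 / (η * Real.log 2) + 1 := by positivity
  calc (v + 1 : ℝ) ≤ (1 / (η * Real.log 2) + 1) * (1 + v * (η * Real.log 2)) := by
        have h3 : (1 / (η * Real.log 2) + 1) * (1 + v * (η * Real.log 2)) =
            v + 1 + (1 / (η * Real.log 2) + v * (η * Real.log 2)) := by
          field_simp
          ring
        rw [h3]
        have : 0 ≤ 1 / (η * Real.log 2) + v * (η * Real.log 2) := by positivity
        linarith
    _ ≤ _ := mul_le_mul_of_nonneg_left h1 h2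

theorem add_one_le_rpow_of_two_le {η p : ℝ} (hp : 2 ≤ p ^ η) (hp0 : 0 ≤ p) (v : ℕ) :
    (v + 1 : ℝ) ≤ p ^ (v * η) := by
  have h1 : (v + 1 : ℝ) ≤ 2 ^ v := by exact_mod_cast Nat.lt_two_pow_self (n := v)
  rw [mul_comm, Real.rpow_mul_natCast hp0]
  exact h1.trans (pow_le_pow_left₀ (by norm_num) hp v)

theorem prod_primeFactors_rpow {n : ℕ} (hn : n ≠ 0) (η : ℝ) :
    ∏ p ∈ n.primeFactors, (p : ℝ) ^ (n.factorization p * η) = (n : ℝ) ^ η := by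
  have h1 : (n : ℝ) = ∏ p ∈ n.primeFactors, (p : ℝ) ^ n.factorization p := by
    conv_lhs => rw [← Nat.prod_factorization_pow_eq_self hn]
    rw [Nat.prod_factorization_eq_prod_primeFactors]
    push_cast
    rfl
  conv_rhs => rw [h1]
  rw [← Real.finsetProd_rpow _ _ fun p _ => by positivity]
  refine Finset.prod_congr rfl fun p _ => ?_
  rw [Real.rpow_natCast_mul (Nat.cast_nonneg p)]

/-- The divisor bound: `d(n) ≪ n ^ η` for every `η > 0`. -/
theorem exists_card_divisors_le {η : ℝ} (hη : 0 < η) :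
    ∃ C : ℝ, 1 ≤ C ∧ ∀ n : ℕ, n ≠ 0 → (n.divisors.card : ℝ) ≤ C * (n : ℝ) ^ η := by
  have hlog : 0 < Real.log 2 := Real.log_pos (by norm_num)
  set A : ℝ := 1 / (η * Real.log 2) + 1 with hA
  have hA1 : 1 ≤ A := le_add_of_nonneg_left (by positivity)
  -- Primes `p ≥ P` have `p ^ η ≥ 2`, so `v + 1 ≤ 2 ^ v ≤ p ^ (v η)`; the fewer than `P` smaller
  -- primes cost a factor `A` each.
  set P : ℕ := ⌈(2 : ℝ) ^ (1 / η)⌉₊ with hP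
  refine ⟨A ^ P, one_le_pow₀ hA1, fun n hn => ?_⟩
  have hlarge : ∀ p : ℕ, P ≤ p → (2 : ℝ) ≤ (p : ℝ) ^ η := by
    intro p hp
    have h1 : (2 : ℝ) ^ (1 / η) ≤ p := (Nat.le_ceil _).trans (by exact_mod_cast hp)
    calc (2 : ℝ) = ((2 : ℝ) ^ (1 / η)) ^ η := by
          rw [← Real.rpow_mul (by norm_num), one_div_mul_cancel hη.ne', Real.rpow_one]
      _ ≤ _ := Real.rpow_le_rpow (by positivity) h1 hη.le
  rw [Nat.card_divisors hn]
  push_cast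
  calc ∏ p ∈ n.primeFactors, ((n.factorization p : ℝ) + 1)
      ≤ ∏ p ∈ n.primeFactors, ((if p < P then A else 1) * (p : ℝ) ^ (n.factorization p * η)) := by
        refine Finset.prod_le_prod (fun p _ => by positivity) fun p hp => ?_
        split_ifs with h
        · refine (add_one_le_mul_two_rpow hη _).trans ?_
          have h2 : (2 : ℝ) ≤ p := by exact_mod_cast (Nat.prime_of_mem_primeFactors hp).two_le
          gcongr
        · rw [one_mul]
          exact add_one_le_rpow_of_two_le (hlarge p (not_lt.1 h)) (Nat.cast_nonneg _) _
    _ ≤ A ^ P * (n : ℝ) ^ η := by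
        rw [Finset.prod_mul_distrib, prod_primeFactors_rpow hn, Finset.prod_ite,
          Finset.prod_const_one, mul_one, Finset.prod_const]
        gcongr
        refine (Finset.card_le_card (t := Finset.range P) fun p hp => ?_).trans
          (Finset.card_range P).le
        rw [Finset.mem_filter] at hp
        exact Finset.mem_range.2 hp.2

theorem six_pow_card_primeFactors_le {n : ℕ} (hn : n ≠ 0) :
    6 ^ n.primeFactors.card ≤ n.divisors.card ^ 3 := by
  have h1 : 2 ^ n.primeFactors.card ≤ n.divisors.card := by
    rw [Nat.card_divisors hn]
    refine Finset.pow_card_le_prod _ _ _ fun p hp => ?_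
    have := (Nat.prime_of_mem_primeFactors hp).factorization_pos_of_dvd hn
      (Nat.dvd_of_mem_primeFactors hp)
    omega
  calc 6 ^ n.primeFactors.card ≤ (2 ^ 3) ^ n.primeFactors.card :=
        Nat.pow_le_pow_left (by norm_num) _
    _ = (2 ^ n.primeFactors.card) ^ 3 := by rw [← pow_mul, ← pow_mul, mul_comm]
    _ ≤ _ := Nat.pow_le_pow_left h1 3

theorem exists_boxError_le {η : ℝ} (hη : 0 < η) :
    ∃ C : ℝ, 0 < C ∧ ∀ q : ℕ, q ≠ 0 → boxError q ≤ C * (q : ℝ) ^ (1 / 2 + η) := by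
  -- Six factors `q ^ (η / 6)` are spent: three on `6 ^ ω(q)`, one on the divisor count and two on
  -- logarithms.
  have hη6 : 0 < η / 6 := by positivity
  obtain ⟨A, hA, hdiv⟩ := exists_card_divisors_le hη6
  refine ⟨A ^ 4 * (1 + 1 / (η / 6)) ^ 2, by positivity, fun q hq => ?_⟩
  have hqR : (1 : ℝ) ≤ q := by exact_mod_cast Nat.one_le_iff_ne_zero.2 hq
  set y : ℝ := (q : ℝ) ^ (η / 6) with hy
  have hy1 : 1 ≤ y := Real.one_le_rpow hqR hη6.le
  have hτ := hdiv q hq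
  have h6 : (6 : ℝ) ^ q.primeFactors.card ≤ (A * y) ^ 3 := by
    calc (6 : ℝ) ^ q.primeFactors.card ≤ (q.divisors.card : ℝ) ^ 3 := by
          exact_mod_cast six_pow_card_primeFactors_le hq
      _ ≤ _ := by gcongr
  have hlog : 1 + Real.log q ≤ (1 + 1 / (η / 6)) * y := by
    have := Real.log_le_rpow_div (zero_le_one.trans hqR) hη6
    have h1 : (1 + 1 / (η / 6)) * y = y + y / (η / 6) := by ring
    rw [h1]
    exact add_le_add hy1 this
  have hlog0 : 0 ≤ 1 + Real.log q := by linarith [Real.log_nonneg hqR]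
  calc boxError q ≤ (A * y) ^ 3 * √(q : ℝ) * (A * y) * ((1 + 1 / (η / 6)) * y) ^ 2 := by
        unfold boxError
        gcongr
    _ = A ^ 4 * (1 + 1 / (η / 6)) ^ 2 * (√(q : ℝ) * y ^ 6) := by ring
    _ = _ := by
        congr 1
        rw [Real.sqrt_eq_rpow, hy, ← Real.rpow_mul_natCast (by positivity),
          ← Real.rpow_add (by positivity)]
        congr 1
        push_cast
        ring

end DivisorBound

/-! ### The main term and `L(1, χ)`. -/

section MainTerm

open ArithmeticFunction in
theorem ite_coprime_eq_sum_moebius (d q : ℕ) (hq : q ≠ 0) :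
    (if d.Coprime q then (1 : ℤ) else 0) = ∑ e ∈ q.divisors, if e ∣ d then moebius e else 0 := by
  have h1 : ∑ e ∈ (d.gcd q).divisors, moebius e = if d.gcd q = 1 then 1 else 0 := by
    rw [← coe_zeta_mul_apply, coe_zeta_mul_moebius, one_apply]
  rw [← Finset.sum_filter]
  have h2 : q.divisors.filter (· ∣ d) = (d.gcd q).divisors := by
    ext e
    simp only [Finset.mem_filter, Nat.mem_divisors, Nat.dvd_gcd_iff, ne_eq, Nat.gcd_eq_zero_iff]
    tauto
  rw [h2, h1]

theorem sum_Ioc_filter_dvd {M : Type*} [AddCommMonoid M] {e : ℕ} (he : 0 < e) (y : ℕ) (f : ℕ → M) :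
    ∑ d ∈ Finset.Ioc 0 y, (if e ∣ d then f d else 0) = ∑ d ∈ Finset.Ioc 0 (y / e), f (e * d) := by
  rw [← Finset.sum_filter]
  symm
  refine Finset.sum_bij' (fun d _ => e * d) (fun d _ => d / e) ?_ ?_ ?_ ?_ ?_
  · intro d hd
    rw [Finset.mem_Ioc, Nat.le_div_iff_mul_le he] at hd
    rw [Finset.mem_filter, Finset.mem_Ioc, mul_comm e d]
    exact ⟨⟨Nat.mul_pos hd.1 he, hd.2⟩, dvd_mul_left _ _⟩
  · intro d hd
    rw [Finset.mem_filter, Finset.mem_Ioc] at hd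
    rw [Finset.mem_Ioc]
    exact ⟨Nat.div_pos (Nat.le_of_dvd hd.1.1 hd.2) he, Nat.div_le_div_right hd.1.2⟩
  · intro d _
    exact Nat.mul_div_cancel_left d he
  · intro d hd
    rw [Finset.mem_filter] at hd
    exact Nat.mul_div_cancel' hd.2
  · intro d _
    rfl

variable {D : ℕ} {χ : DirichletCharacter ℂ D}

theorem norm_sum_Ioc_character_le [NeZero D] (hχ : χ ≠ 1) (y : ℕ) :
    ‖∑ d ∈ Finset.Ioc 0 y, χ d‖ ≤ D := by
  have h1 : ∀ d : ℕ, χ d = if d.Coprime D then χ d else 0 := by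
    intro d
    split_ifs with h
    · rfl
    · exact MulChar.map_nonunit _ fun hu => h ((ZMod.isUnit_iff_coprime d D).1 hu)
  rw [Finset.sum_congr rfl fun d _ => h1 d]
  exact norm_sum_Ioc_coprime_le hχ dvd_rfl y

/-- Möbius inversion of the coprimality condition: each divisor of `q` costs one sum of `χ`, at most
`D`. -/
theorem norm_sum_Ioc_ite_coprime_le [NeZero D] (hχ : χ ≠ 1) {q : ℕ} (hq : q ≠ 0) (y : ℕ) :
    ‖∑ d ∈ Finset.Ioc 0 y, (if d.Coprime q then χ d else 0)‖ ≤ D * q.divisors.card := by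
  have h1 : ∀ d : ℕ, (if d.Coprime q then χ d else 0) =
      ∑ e ∈ q.divisors, (ArithmeticFunction.moebius e : ℂ) * (if e ∣ d then χ d else 0) := by
    intro d
    have h2 : ((if d.Coprime q then (1 : ℤ) else 0 : ℤ) : ℂ) * χ d =
        ((∑ e ∈ q.divisors, if e ∣ d then ArithmeticFunction.moebius e else 0 : ℤ) : ℂ) * χ d := by
      rw [ite_coprime_eq_sum_moebius d q hq]
    push_cast at h2
    rw [ite_mul, one_mul, zero_mul, Finset.sum_mul] at h2
    rw [h2]
    refine Finset.sum_congr rfl fun e _ => ?_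
    split_ifs <;> simp
  rw [Finset.sum_congr rfl fun d _ => h1 d, Finset.sum_comm]
  refine (norm_sum_le_of_le _ (n := fun _ => (D : ℝ)) fun e he => ?_).trans (le_of_eq ?_)
  · have he0 : 0 < e := Nat.pos_of_mem_divisors he
    rw [← Finset.mul_sum, sum_Ioc_filter_dvd he0, norm_mul]
    simp only [Nat.cast_mul, map_mul, ← Finset.mul_sum]
    rw [norm_mul]
    have i1 : ‖((ArithmeticFunction.moebius e : ℤ) : ℂ)‖ ≤ 1 := by
      rw [Complex.norm_intCast]
      exact_mod_cast ArithmeticFunction.abs_moebius_le_one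
    calc _ ≤ 1 * (1 * (D : ℝ)) := by
          gcongr
          · exact χ.norm_le_one _
          · exact norm_sum_Ioc_character_le hχ _
      _ = D := by ring
  · rw [Finset.sum_const, nsmul_eq_mul, mul_comm]

/-- Abel's inequality: a sum of `c` with bounded partial sums against a nonnegative decreasing
weight. -/
theorem norm_sum_Ioc_mul_antitone_le {c : ℕ → ℂ} {B : ℝ}
    (hc : ∀ y, ‖∑ d ∈ Finset.Ioc 0 y, c d‖ ≤ B) {g : ℕ → ℝ} {u v : ℕ}
    (hg : ∀ i, u < i → g (i + 1) ≤ g i) (hg0 : ∀ i, u < i → 0 ≤ g i) :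
    ‖∑ d ∈ Finset.Ioc u v, c d * g d‖ ≤ 2 * B * g (u + 1) := by
  have hB : 0 ≤ B := (norm_nonneg _).trans (hc 0)
  rcases le_total v u with hvu | huv
  · rw [Finset.Ioc_eq_empty (by omega), Finset.sum_empty, norm_zero]
    have := hg0 (u + 1) (by omega)
    positivity
  have hT : ∀ j, u ≤ j → ‖∑ d ∈ Finset.Ioc u j, c d‖ ≤ 2 * B := by
    intro j hj
    have h1 := Finset.sum_Ioc_consecutive c (Nat.zero_le u) hj
    rw [← eq_sub_iff_add_eq'] at h1
    rw [h1]
    calc _ ≤ B + B := (norm_sub_le _ _).trans (add_le_add (hc _) (hc _))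
      _ = 2 * B := by ring
  have key : ∀ j, u ≤ j → ‖∑ d ∈ Finset.Ioc u j, c d * g d -
      (∑ d ∈ Finset.Ioc u j, c d) * g (j + 1)‖ ≤ 2 * B * (g (u + 1) - g (j + 1)) := by
    intro j hj
    induction j, hj using Nat.le_induction with
    | base => simp
    | succ j hj ih =>
      have h2 : ∑ d ∈ Finset.Ioc u (j + 1), c d * g d -
          (∑ d ∈ Finset.Ioc u (j + 1), c d) * g (j + 1 + 1) =
          (∑ d ∈ Finset.Ioc u j, c d * g d - (∑ d ∈ Finset.Ioc u j, c d) * g (j + 1)) +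
          (∑ d ∈ Finset.Ioc u (j + 1), c d) * ((g (j + 1) - g (j + 1 + 1) : ℝ) : ℂ) := by
        rw [Finset.sum_Ioc_succ_top hj, Finset.sum_Ioc_succ_top hj]
        push_cast
        ring
      rw [h2]
      have h3 := hg (j + 1) (by omega)
      have h4 : ‖(∑ d ∈ Finset.Ioc u (j + 1), c d) * ((g (j + 1) - g (j + 1 + 1) : ℝ) : ℂ)‖ ≤
          2 * B * (g (j + 1) - g (j + 1 + 1)) := by
        rw [norm_mul, Complex.norm_real, Real.norm_eq_abs, abs_of_nonneg (sub_nonneg.2 h3)]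
        exact mul_le_mul_of_nonneg_right (hT (j + 1) (by omega)) (sub_nonneg.2 h3)
      calc _ ≤ 2 * B * (g (u + 1) - g (j + 1)) + 2 * B * (g (j + 1) - g (j + 1 + 1)) :=
            (norm_add_le _ _).trans (add_le_add ih h4)
        _ = _ := by ring
  have h5 : ‖(∑ d ∈ Finset.Ioc u v, c d) * (g (v + 1) : ℂ)‖ ≤ 2 * B * g (v + 1) := by
    have h6 := hg0 (v + 1) (by omega)
    rw [norm_mul, Complex.norm_real, Real.norm_eq_abs, abs_of_nonneg h6]
    exact mul_le_mul_of_nonneg_right (hT v huv) h6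
  have h7 := norm_sub_norm_le (∑ d ∈ Finset.Ioc u v, c d * g d)
    ((∑ d ∈ Finset.Ioc u v, c d) * (g (v + 1) : ℂ))
  linarith [key v huv]

-- For real `s > 1` the L-series converges and Abel's inequality bounds its tail; both sides are
-- continuous in `s`, so the bound survives `s → 1`.
open Filter Topology in
theorem norm_sum_div_sub_LFunction_one_le {M : ℕ} [NeZero M] {ψ : DirichletCharacter ℂ M}
    (hψ : ψ ≠ 1) {B : ℝ} (hB : ∀ y : ℕ, ‖∑ d ∈ Finset.Ioc 0 y, ψ d‖ ≤ B) (y : ℕ) :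
    ‖∑ d ∈ Finset.Ioc 0 y, ψ d / d - ψ.LFunction 1‖ ≤ 2 * B / (y + 1) := by
  have hpos : (0 : ℝ) < y + 1 := by positivity
  have hs : ∀ s : ℝ, 1 < s →
      ‖∑ d ∈ Finset.Ioc 0 y, ψ d / (d : ℂ) ^ (s : ℂ) - ψ.LFunction s‖ ≤
        2 * B * ((y + 1 : ℕ) : ℝ) ^ (-s) := by
    intro s hs
    have hsre : 1 < (s : ℂ).re := by simpa using hs
    have hsum : Summable (LSeries.term (fun n => ψ n) s) :=
      LSeriesSummable_of_bounded_of_one_lt_re (m := 1) (fun n _ => ψ.norm_le_one _) hsre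
    have h1 := hsum.hasSum.tendsto_sum_nat
    change Tendsto _ _ (𝓝 (LSeries (fun n => ψ n) s)) at h1
    rw [← DirichletCharacter.LFunction_eq_LSeries ψ hsre] at h1
    have h1' := (tendsto_add_atTop_iff_nat 1).2 h1
    have h2 : ∀ v, ∑ i ∈ Finset.range (v + 1), LSeries.term (fun n => ψ n) s i =
        ∑ d ∈ Finset.Ioc 0 v, ψ d / (d : ℂ) ^ (s : ℂ) := by
      intro v
      rw [Finset.range_eq_Ico, Finset.sum_eq_sum_Ico_succ_bot (by omega), LSeries.term_zero,
        zero_add]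
      refine Finset.sum_congr ?_ fun d hd => ?_
      · ext d; simp; omega
      · rw [Finset.mem_Ioc] at hd
        rw [LSeries.term_of_ne_zero (by omega)]
    have h3 := (tendsto_const_nhds (x := ∑ d ∈ Finset.Ioc 0 y, ψ d / (d : ℂ) ^ (s : ℂ))).sub h1'
    refine le_of_tendsto h3.norm ?_
    filter_upwards [eventually_ge_atTop y] with v hv
    rw [h2, ← Finset.sum_Ioc_consecutive _ (Nat.zero_le y) hv, sub_add_cancel_left, norm_neg]
    have h4 : ∀ d ∈ Finset.Ioc y v, ψ d / (d : ℂ) ^ (s : ℂ) = ψ d * (((d : ℝ) ^ (-s) : ℝ) : ℂ) := by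
      intro d _
      rw [Complex.ofReal_cpow (Nat.cast_nonneg d), Complex.ofReal_natCast, Complex.ofReal_neg,
        Complex.cpow_neg, div_eq_mul_inv]
    rw [Finset.sum_congr rfl h4]
    refine norm_sum_Ioc_mul_antitone_le (g := fun d => (d : ℝ) ^ (-s)) hB ?_ ?_
    · intro i hi
      have : (0 : ℝ) < i := by exact_mod_cast (by omega : 0 < i)
      refine Real.rpow_le_rpow_of_nonpos this ?_ (by linarith)
      push_cast
      linarith
    · intro i _
      positivity
  have hcont : Continuous fun s : ℝ =>
      ‖∑ d ∈ Finset.Ioc 0 y, ψ d / (d : ℂ) ^ (s : ℂ) - ψ.LFunction s‖ := by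
    refine (Continuous.sub ?_ ?_).norm
    · refine continuous_finsetSum _ fun d hd => ?_
      have hd0 : (d : ℂ) ≠ 0 := by
        rw [Finset.mem_Ioc] at hd
        exact_mod_cast (by omega : d ≠ 0)
      refine Continuous.div continuous_const ?_ fun s => ?_
      · exact Complex.continuous_ofReal.const_cpow (Or.inl hd0)
      · rw [Complex.cpow_def_of_ne_zero hd0]
        exact Complex.exp_ne_zero _
    · exact (DirichletCharacter.differentiable_LFunction hψ).continuous.comp
        Complex.continuous_ofReal
  have hcont2 : Continuous fun s : ℝ => 2 * B * ((y + 1 : ℕ) : ℝ) ^ (-s) := by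
    refine continuous_const.mul ?_
    refine Continuous.rpow continuous_const continuous_neg fun s => Or.inl ?_
    positivity
  have h5 := le_of_tendsto_of_tendsto (b := 𝓝[>] (1 : ℝ)) (hcont.tendsto' 1 _ rfl |>.mono_left nhdsWithin_le_nhds)
    (hcont2.tendsto' 1 _ rfl |>.mono_left nhdsWithin_le_nhds)
    (eventually_nhdsWithin_of_forall fun s hs1 => hs s hs1)
  rw [Real.rpow_neg_one, ← div_eq_mul_inv] at h5
  simpa using h5

/-- The coprimality condition turns `χ` into a character modulo `D * q`, whose L-value differs by
Euler factors; those at primes dividing `D` are `1`, as `χ(p) = 0`. -/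
theorem norm_sum_ite_div_sub_LFunction_le [NeZero D] (hχ : χ ≠ 1) {q : ℕ} (hq : q ≠ 0) (y : ℕ) :
    ‖∑ d ∈ Finset.Ioc 0 y, (if d.Coprime q then χ d else 0) / d -
      (∏ p ∈ q.primeFactors, (1 - χ p / p)) * χ.LFunction 1‖ ≤
        2 * (D * q.divisors.card) / (y + 1) := by
  have : NeZero q := ⟨hq⟩
  set ψ := DirichletCharacter.changeLevel (dvd_mul_right D q) χ with hψ
  have hψ1 : ψ ≠ 1 := by rwa [hψ, ne_eq, DirichletCharacter.changeLevel_eq_one_iff]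
  have hval : ∀ d : ℕ, ψ d = if d.Coprime q then χ d else 0 := by
    intro d
    rw [hψ, changeLevel_natCast]
    by_cases h : d.Coprime D
    · have h' : d.Coprime (D * q) ↔ d.Coprime q :=
        Nat.coprime_mul_iff_right.trans (and_iff_right h)
      simp only [h']
    · have h0 := MulChar.map_nonunit χ fun hu => h ((ZMod.isUnit_iff_coprime d D).1 hu)
      simp only [h0, ite_self]
  have hprod : ψ.LFunction 1 = (∏ p ∈ q.primeFactors, (1 - χ p / p)) * χ.LFunction 1 := by
    rw [hψ, DirichletCharacter.LFunction_changeLevel _ χ (Or.inl hχ), mul_comm]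
    congr 1
    simp only [Complex.cpow_neg_one, ← div_eq_mul_inv]
    symm
    refine Finset.prod_subset (Nat.primeFactors_mono (dvd_mul_left q D)
      (NeZero.ne _)) fun p hp hpq => ?_
    have hpp := Nat.prime_of_mem_primeFactors hp
    have h1 : ¬ p ∣ q := fun h => hpq (Nat.mem_primeFactors.2 ⟨hpp, h, hq⟩)
    have h2 : p ∣ D := (hpp.dvd_mul.1 (Nat.dvd_of_mem_primeFactors hp)).resolve_right h1
    rw [MulChar.map_nonunit, zero_div, sub_zero]
    rw [ZMod.isUnit_iff_coprime, hpp.coprime_iff_not_dvd]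
    exact not_not.2 h2
  rw [← hprod]
  simp_rw [← hval]
  refine norm_sum_div_sub_LFunction_one_le hψ1 (fun z => ?_) y
  simp_rw [hval]
  exact norm_sum_Ioc_ite_coprime_le hχ hq z

/-- The sum is cut at `√N`. Below, `N / d` is `x / d` up to `1`, and the tail of the series for
`L(1, χ)` enters; above, `N / d` decreases and is at most `√x`, so Abel's inequality applies. The
three errors give `5 = 1 + 2 + 2`. -/
theorem norm_sum_mul_div_sub_le [NeZero D] (hχ : χ ≠ 1) {q : ℕ} (hq : q ≠ 0) {x : ℝ} (hx : 1 < x) :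
    ‖∑ d ∈ Finset.Ioc 0 ⌊x⌋₊, (if d.Coprime q then χ d else 0) * ((⌊x⌋₊ / d : ℕ) : ℂ) -
      x * ((∏ p ∈ q.primeFactors, (1 - χ p / p)) * χ.LFunction 1)‖ ≤
        5 * (D * q.divisors.card) * √x := by
  set c : ℕ → ℂ := fun d => if d.Coprime q then χ d else 0 with hc
  set B : ℝ := D * q.divisors.card with hB
  set N := ⌊x⌋₊ with hN
  set y := Nat.sqrt N with hy
  set L := (∏ p ∈ q.primeFactors, (1 - χ p / p)) * χ.LFunction 1 with hL
  have hx0 : 0 ≤ x := by linarith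
  have hB1 : 1 ≤ B := by
    have h1 : 0 < D := Nat.pos_of_ne_zero (NeZero.ne D)
    have h2 : 0 < q.divisors.card := Finset.card_pos.2 ⟨1, Nat.one_mem_divisors.2 hq⟩
    rw [hB]
    exact_mod_cast Nat.mul_pos h1 h2
  have hyx : (y : ℝ) ≤ √x := by
    refine Real.le_sqrt_of_sq_le ?_
    have h1 : y ^ 2 ≤ N := Nat.sqrt_le' N
    calc (y : ℝ) ^ 2 ≤ N := by exact_mod_cast h1
      _ ≤ x := Nat.floor_le hx0
  have hxy : √x ≤ y + 1 := by
    refine Real.sqrt_le_iff.2 ⟨by positivity, ?_⟩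
    have h1 : N + 1 ≤ (y + 1) ^ 2 := Nat.succ_le_succ_sqrt' N
    calc x ≤ N + 1 := (Nat.lt_floor_add_one x).le
      _ ≤ _ := by exact_mod_cast h1
  have hyN : y ≤ N := Nat.sqrt_le_self N
  have hcn : ∀ d, ‖c d‖ ≤ 1 := by
    intro d
    simp only [hc]
    split_ifs
    · exact χ.norm_le_one _
    · simp
  have hpart : ∀ z, ‖∑ d ∈ Finset.Ioc 0 z, c d‖ ≤ B := norm_sum_Ioc_ite_coprime_le hχ hq
  have h1 : ‖∑ d ∈ Finset.Ioc y N, c d * ((N / d : ℕ) : ℂ)‖ ≤ 2 * B * √x := by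
    have h2 := norm_sum_Ioc_mul_antitone_le (g := fun d => ((N / d : ℕ) : ℝ)) (u := y) (v := N)
      hpart (fun i hi => by
        exact_mod_cast Nat.div_le_div_left (Nat.le_add_right i 1) (by omega))
      (fun i _ => Nat.cast_nonneg _)
    simp only [Complex.ofReal_natCast] at h2
    refine h2.trans ?_
    gcongr
    refine le_trans ?_ hyx
    have h3 : N < (y + 1) * (y + 1) := Nat.lt_succ_sqrt N
    exact_mod_cast Nat.lt_succ_iff.1 ((Nat.div_lt_iff_lt_mul (by omega)).2 h3)
  have h4 : ‖∑ d ∈ Finset.Ioc 0 y, c d * ((N / d : ℕ) : ℂ) -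
      x * ∑ d ∈ Finset.Ioc 0 y, c d / d‖ ≤ √x := by
    rw [Finset.mul_sum, ← Finset.sum_sub_distrib]
    refine (norm_sum_le_of_le _ (n := fun _ => (1 : ℝ)) fun d hd => ?_).trans ?_
    · have h5 : c d * ((N / d : ℕ) : ℂ) - x * (c d / d) =
          c d * (((N / d : ℕ) - x / d : ℝ) : ℂ) := by
        push_cast
        ring
      rw [h5, norm_mul, Complex.norm_real, Real.norm_eq_abs]
      have h6 : |((N / d : ℕ) - x / d : ℝ)| ≤ 1 := by
        rw [hN, ← Nat.floor_div_natCast, abs_le]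
        have i1 := Nat.floor_le (div_nonneg hx0 (Nat.cast_nonneg d))
        have i2 := Nat.lt_floor_add_one (x / d)
        constructor <;> linarith
      exact mul_le_one₀ (hcn d) (abs_nonneg _) h6
    · simpa using hyx
  have h7 : ‖(x : ℂ) * (∑ d ∈ Finset.Ioc 0 y, c d / d - L)‖ ≤ 2 * B * √x := by
    rw [norm_mul, Complex.norm_real, Real.norm_eq_abs, abs_of_nonneg hx0]
    calc x * ‖∑ d ∈ Finset.Ioc 0 y, c d / d - L‖ ≤ x * (2 * B / √x) := by
          refine mul_le_mul_of_nonneg_left ?_ hx0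
          refine (norm_sum_ite_div_sub_LFunction_le hχ hq y).trans ?_
          have : 0 < √x := Real.sqrt_pos.2 (by linarith)
          gcongr
      _ = 2 * B * √x := by
          have : x / √x = √x := Real.div_sqrt
          rw [mul_div_assoc', mul_comm x, mul_div_assoc, this]
  rw [← Finset.sum_Ioc_consecutive _ (Nat.zero_le y) hyN]
  have h8 : ∑ d ∈ Finset.Ioc 0 y, c d * ((N / d : ℕ) : ℂ) +
      ∑ d ∈ Finset.Ioc y N, c d * ((N / d : ℕ) : ℂ) - x * L =
      (∑ d ∈ Finset.Ioc 0 y, c d * ((N / d : ℕ) : ℂ) - x * ∑ d ∈ Finset.Ioc 0 y, c d / d) +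
      x * (∑ d ∈ Finset.Ioc 0 y, c d / d - L) +
      ∑ d ∈ Finset.Ioc y N, c d * ((N / d : ℕ) : ℂ) := by ring
  rw [h8]
  have h9 : √x ≤ B * √x := le_mul_of_one_le_left (Real.sqrt_nonneg x) hB1
  refine (norm_add₃_le).trans ?_
  linarith

end MainTerm

/-! ### Assembly and choice of parameters. -/

section FinalEstimate

variable {D : ℕ} {χ : DirichletCharacter ℂ D}

theorem lamSumAP_eq_sum_divisorsAntidiagonal (χ : DirichletCharacter ℂ D) (x : ℝ) (q a : ℕ) :
    lamSumAP χ x q a = ∑ n ∈ Finset.Ioc 0 ⌊x⌋₊, ∑ p ∈ n.divisorsAntidiagonal,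
      if (p.1 : ZMod q) * p.2 = a then χ p.1 else 0 := by
  rw [lamSumAP, Finset.sum_filter]
  refine Finset.sum_congr rfl fun n _ => ?_
  have h1 : ∀ p ∈ n.divisorsAntidiagonal, (if (p.1 : ZMod q) * p.2 = a then χ p.1 else 0) =
      if n ≡ a [MOD q] then χ p.1 else 0 := by
    intro p hp
    have h2 : (p.1 : ZMod q) * p.2 = a ↔ n ≡ a [MOD q] := by
      rw [← ZMod.natCast_eq_natCast_iff, ← (Nat.mem_divisorsAntidiagonal.1 hp).1, Nat.cast_mul]
    simp only [h2]
  rw [Finset.sum_congr rfl h1]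
  split_ifs with h
  · rw [DirichletCharacter.zetaMul, ArithmeticFunction.coe_zeta_mul_apply,
      Nat.sum_divisorsAntidiagonal (fun d _ => χ d)]
    refine Finset.sum_congr rfl fun d hd => ?_
    exact if_neg (Nat.pos_of_mem_divisors hd).ne'
  · simp

/-- The two expected values in `hyperbolaWeight` have the same sum after exchanging `d` and `m`,
whence the factor `1 + χ(a)` when `D ∣ q`. -/
theorem lamSumAP_eq_main_add (χ : DirichletCharacter ℂ D) (x : ℝ) (q a : ℕ) :
    lamSumAP χ x q a = (1 + if D ∣ q then χ a else 0) / q *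
        ∑ d ∈ Finset.Ioc 0 ⌊x⌋₊, (if d.Coprime q then χ d else 0) * ((⌊x⌋₊ / d : ℕ) : ℂ) +
      ∑ n ∈ Finset.Ioc 0 ⌊x⌋₊, ∑ p ∈ n.divisorsAntidiagonal, hyperbolaWeight χ q a p.1 p.2 := by
  set c : ℕ → ℂ := fun d => if d.Coprime q then χ d else 0 with hc
  set N := ⌊x⌋₊ with hN
  have h1 : ∑ n ∈ Finset.Ioc 0 N, ∑ p ∈ n.divisorsAntidiagonal, c p.1 =
      ∑ d ∈ Finset.Ioc 0 N, c d * ((N / d : ℕ) : ℂ) := by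
    rw [sum_Ioc_divisorsAntidiagonal (fun d _ => c d)]
    refine Finset.sum_congr rfl fun d _ => ?_
    rw [Finset.sum_const, Nat.card_Ioc, nsmul_eq_mul, Nat.sub_zero, mul_comm]
  have h2 : ∑ n ∈ Finset.Ioc 0 N, ∑ p ∈ n.divisorsAntidiagonal, c p.2 =
      ∑ d ∈ Finset.Ioc 0 N, c d * ((N / d : ℕ) : ℂ) := by
    rw [← h1]
    refine Finset.sum_congr rfl fun n _ => ?_
    conv_lhs => rw [← Nat.map_swap_divisorsAntidiagonal, Finset.sum_map]
    rfl
  have h3 : ∀ d m : ℕ, (if (d : ZMod q) * m = a then χ d else 0) =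
      hyperbolaWeight χ q a d m + c d / q + (if D ∣ q then χ a else 0) / q * c m := by
    intro d m
    have h4 : (if D ∣ q then if m.Coprime q then χ a * χ m else 0 else 0) =
        (if D ∣ q then χ a else 0) * c m := by
      simp only [hc]
      split_ifs <;> simp
    rw [hyperbolaWeight, h4]
    ring
  rw [lamSumAP_eq_sum_divisorsAntidiagonal]
  simp_rw [h3, Finset.sum_add_distrib, ← Finset.sum_div, ← Finset.mul_sum]
  rw [h1, h2]
  ring

theorem norm_lamSumAP_sub_main_le [NeZero D] (hD : 2 ≤ D) (hχ : χ.IsPrimitive)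
    (hreal : χ.IsReal) {q a : ℕ} (hq : 0 < q) (ha : a.Coprime q) {x : ℝ} (hx : 1 < x)
    {k L : ℕ} (hk : 0 < k) (hN : ⌊x⌋₊ ≤ 2 ^ L)
    {T : ℝ} (hT : ∀ n ∈ Finset.Ioc 0 ⌊x⌋₊, (n.divisors.card : ℝ) ≤ T) (hT0 : 0 ≤ T) :
    ‖lamSumAP χ x q a - (x : ℂ) * (1 + if D ∣ q then χ (a : ZMod D) else 0) / (q : ℂ) *
        (∏ p ∈ q.primeFactors, (1 - χ (p : ZMod D) / (p : ℂ))) * χ.LFunction 1‖ ≤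
      10 * (D * q.divisors.card) * √x / q +
        (2 * (D * k) + 2 * k * L * (D * boxError q) + T * (3 * x / (k * q) + 6)) := by
  have : NeZero q := ⟨hq.ne'⟩
  have hqR : (0 : ℝ) < q := by exact_mod_cast hq
  have hkR : (0 : ℝ) < k := by exact_mod_cast hk
  set P := (∏ p ∈ q.primeFactors, (1 - χ (p : ZMod D) / (p : ℂ))) * χ.LFunction 1 with hP
  set S := ∑ d ∈ Finset.Ioc 0 ⌊x⌋₊, (if d.Coprime q then χ d else 0) * ((⌊x⌋₊ / d : ℕ) : ℂ)
    with hS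
  set W := ∑ n ∈ Finset.Ioc 0 ⌊x⌋₊, ∑ p ∈ n.divisorsAntidiagonal, hyperbolaWeight χ q a p.1 p.2
    with hW
  set t : ℂ := 1 + if D ∣ q then χ (a : ZMod D) else 0 with ht
  have ht2 : ‖t‖ ≤ 2 := by
    have h1 : ‖(if D ∣ q then χ (a : ZMod D) else 0)‖ ≤ 1 := by
      split_ifs
      · exact χ.norm_le_one _
      · simp
    calc ‖t‖ ≤ ‖(1 : ℂ)‖ + 1 := (norm_add_le _ _).trans (by gcongr)
      _ = 2 := by rw [norm_one]; norm_num
  have h1 : lamSumAP χ x q a - (x : ℂ) * t / (q : ℂ) *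
      (∏ p ∈ q.primeFactors, (1 - χ (p : ZMod D) / (p : ℂ))) * χ.LFunction 1 =
      t / q * (S - x * P) + W := by
    rw [lamSumAP_eq_main_add, ← hS, ← hW, ← ht, hP]
    ring
  rw [h1]
  refine (norm_add_le _ _).trans (add_le_add ?_ ?_)
  · rw [norm_mul, norm_div, Complex.norm_natCast]
    calc ‖t‖ / q * ‖S - x * P‖ ≤ 2 / q * (5 * (D * q.divisors.card) * √x) := by
          gcongr
          exact norm_sum_mul_div_sub_le (hχ.ne_one hD) hq.ne' hx
      _ = _ := by ring
  · refine (norm_sum_hyperbolaWeight_le hD hχ hreal ha hk hN hT hT0).trans ?_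
    gcongr
    exact Nat.floor_le (by linarith)

theorem log_two_add_one_le {η : ℝ} (hη : 0 < η) {x : ℝ} (hx : 1 < x) :
    ((Nat.log 2 ⌊x⌋₊ + 1 : ℕ) : ℝ) ≤ (1 + 1 / (η * Real.log 2)) * x ^ η := by
  have hlog : 0 < Real.log 2 := Real.log_pos (by norm_num)
  have hx0 : 0 ≤ x := by linarith
  have h1 : (2 : ℝ) ^ Nat.log 2 ⌊x⌋₊ ≤ x := by
    have h2 : 2 ^ Nat.log 2 ⌊x⌋₊ ≤ ⌊x⌋₊ := Nat.pow_log_le_self 2 (Nat.floor_pos.2 hx.le).ne'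
    exact le_trans (by exact_mod_cast h2) (Nat.floor_le hx0)
  have h3 : Nat.log 2 ⌊x⌋₊ * Real.log 2 ≤ x ^ η / η := by
    rw [← Real.log_pow]
    exact (Real.log_le_log (by positivity) h1).trans (Real.log_le_rpow_div hx0 hη)
  have h4 : (Nat.log 2 ⌊x⌋₊ : ℝ) ≤ x ^ η / (η * Real.log 2) := by
    rw [← div_div, le_div_iff₀ hlog]
    exact h3
  have h5 : 1 ≤ x ^ η := Real.one_le_rpow hx.le hη.le
  have h6 : (1 + 1 / (η * Real.log 2)) * x ^ η = x ^ η + x ^ η / (η * Real.log 2) := by ring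
  rw [h6]
  push_cast
  linarith

end FinalEstimate

theorem proposition4p1 (ε : ℝ) (hε0 : 0 < ε) (hε1 : ε < 1 / 15) :
    ∃ C : ℝ, 0 < C ∧
      ∀ (x : ℝ) (a q D : ℕ) [NeZero D] (χ : DirichletCharacter ℂ D),
        1 < x → 0 < a → 0 < q → Nat.Coprime a q → (q : ℝ) ≤ x ^ (2 / 3 - ε) →
        2 ≤ D → χ.IsPrimitive → χ.IsReal →
        ‖lamSumAP χ x q a -
            (x : ℂ) * (1 + if D ∣ q then χ (a : ZMod D) else 0) / (q : ℂ) *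
              (∏ p ∈ q.primeFactors, (1 - χ (p : ZMod D) / (p : ℂ))) *
              DirichletCharacter.LFunction χ 1‖
          ≤ C * ((D : ℝ) * x ^ (1 - ε / 2) / (q : ℝ)) := by
  set η := ε / 6 with hη
  have hη0 : 0 < η := by positivity
  have hlog : 0 < Real.log 2 := Real.log_pos (by norm_num)
  obtain ⟨A, hA1, hA⟩ := exists_card_divisors_le hη0
  obtain ⟨B, hB0, hB⟩ := exists_boxError_le hη0
  set G : ℝ := 1 + 1 / (η * Real.log 2) with hG
  have hG0 : 0 < G := by positivity
  -- The four summands come from `e1` to `e4`: main-term error, initial rows, boxes, and points near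
  -- the hyperbola.
  refine ⟨10 * A + 4 + 4 * G * B + 9 * A, by positivity, ?_⟩
  intro x a q D _ χ hx _ hq ha hqx hD hχ hreal
  have hx0 : 0 < x := by linarith
  have hqR : (1 : ℝ) ≤ q := by exact_mod_cast hq
  have hq0 : (0 : ℝ) < q := by linarith
  have hDR : (1 : ℝ) ≤ D := by exact_mod_cast (by omega : 1 ≤ D)
  have hmono : ∀ {s t : ℝ}, s ≤ t → x ^ s ≤ x ^ t := fun h =>
    Real.rpow_le_rpow_of_exponent_le hx.le h
  -- With this `k` the tail `x ^ (1 + η) / (k q)` is at most `x ^ (1 - ε / 2) / q`; the extra `η`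
  -- pays for the divisor bound.
  set k : ℕ := ⌈x ^ (ε / 2 + η)⌉₊ with hk
  have hk1 : x ^ (ε / 2 + η) ≤ k := Nat.le_ceil _
  have hxk : 1 ≤ x ^ (ε / 2 + η) := Real.one_le_rpow hx.le (by positivity)
  have hk2 : (k : ℝ) ≤ 2 * x ^ (ε / 2 + η) := by
    have := (Nat.ceil_lt_add_one (zero_le_one.trans hxk)).le
    linarith
  have hk0 : 0 < k := Nat.ceil_pos.2 (by positivity)
  have hpow : ∀ {s : ℝ}, s ≤ 1 / 3 → x ^ s ≤ x ^ (1 - ε / 2) / q := by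
    intro s hs
    rw [le_div_iff₀ hq0]
    calc x ^ s * q ≤ x ^ (1 / 3 : ℝ) * x ^ (2 / 3 - ε) :=
          mul_le_mul (hmono hs) hqx hq0.le (by positivity)
      _ = x ^ (1 - ε) := by rw [← Real.rpow_add hx0]; congr 1; ring
      _ ≤ x ^ (1 - ε / 2) := hmono (by linarith)
  set R : ℝ := D * x ^ (1 - ε / 2) / q with hR
  have hRle : x ^ (1 - ε / 2) / q ≤ R := by
    rw [hR, mul_div_assoc]
    exact le_mul_of_one_le_left (by positivity) hDR
  have hqpow : ∀ {s : ℝ}, 0 ≤ s → (q : ℝ) ^ s ≤ x ^ ((2 / 3 - ε) * s) := by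
    intro s hs
    rw [Real.rpow_mul hx0.le]
    exact Real.rpow_le_rpow hq0.le hqx hs
  have hT : ∀ n ∈ Finset.Ioc 0 ⌊x⌋₊, (n.divisors.card : ℝ) ≤ A * x ^ η := by
    intro n hn
    rw [Finset.mem_Ioc] at hn
    refine (hA n hn.1.ne').trans ?_
    have h1 : (n : ℝ) ≤ x := (Nat.le_floor_iff hx0.le).1 hn.2
    gcongr
  refine (norm_lamSumAP_sub_main_le hD hχ hreal hq ha hx hk0
    (Nat.lt_pow_succ_log_self (by norm_num) ⌊x⌋₊).le hT (by positivity)).trans ?_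
  have e1 : 10 * (D * q.divisors.card) * √x / q ≤ 10 * A * R := by
    have h1 : (q.divisors.card : ℝ) * √x ≤ A * x ^ (1 - ε / 2) := by
      calc (q.divisors.card : ℝ) * √x ≤ (A * x ^ ((2 / 3 - ε) * η)) * x ^ (1 / 2 : ℝ) := by
            rw [Real.sqrt_eq_rpow]
            gcongr
            refine (hA q hq.ne').trans ?_
            gcongr
            exact hqpow hη0.le
        _ = A * x ^ ((2 / 3 - ε) * η + 1 / 2) := by rw [mul_assoc, ← Real.rpow_add hx0]
        _ ≤ _ := by
            gcongr
            exact hx.le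
            rw [hη]
            nlinarith
    calc 10 * (D * q.divisors.card) * √x / q = 10 * D / q * (q.divisors.card * √x) := by ring
      _ ≤ 10 * D / q * (A * x ^ (1 - ε / 2)) := by gcongr
      _ = _ := by rw [hR]; ring
  have e2 : 2 * (D * k) ≤ 4 * R := by
    have h1 : x ^ (ε / 2 + η) ≤ x ^ (1 - ε / 2) / q := hpow (by rw [hη]; linarith)
    calc (2 : ℝ) * (D * k) ≤ 2 * (D * (2 * x ^ (ε / 2 + η))) := by gcongr
      _ = 4 * (D * x ^ (ε / 2 + η)) := by ring
      _ ≤ 4 * (D * (x ^ (1 - ε / 2) / q)) := by gcongr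
      _ = 4 * R := by rw [hR, mul_div_assoc]
  have e3 : 2 * k * ((Nat.log 2 ⌊x⌋₊ + 1 : ℕ) : ℝ) * (D * boxError q) ≤ 4 * G * B * R := by
    -- The decisive use of `q ≤ x ^ (2 / 3 - ε)`: after multiplication by `q` the exponent of `x` is
    -- `1 - 5 ε / 9 - ε ^ 2 / 6`, below `1 - ε / 2`.
    have h1 : x ^ (ε / 2 + η) * x ^ η * (q : ℝ) ^ (1 / 2 + η) ≤ x ^ (1 - ε / 2) / q := by
      rw [le_div_iff₀ hq0]
      calc x ^ (ε / 2 + η) * x ^ η * (q : ℝ) ^ (1 / 2 + η) * q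
          = x ^ (ε / 2 + η) * x ^ η * (q : ℝ) ^ (3 / 2 + η) := by
            rw [mul_assoc, ← Real.rpow_add_one hq0.ne']
            congr 2
            ring
        _ ≤ x ^ (ε / 2 + η) * x ^ η * x ^ ((2 / 3 - ε) * (3 / 2 + η)) := by
            gcongr
            exact hqpow (by positivity)
        _ = x ^ (ε / 2 + η + η + (2 / 3 - ε) * (3 / 2 + η)) := by
            rw [← Real.rpow_add hx0, ← Real.rpow_add hx0]
        _ ≤ _ := hmono (by rw [hη]; nlinarith)
    have hL := log_two_add_one_le hη0 hx
    rw [← hG] at hL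
    calc 2 * k * ((Nat.log 2 ⌊x⌋₊ + 1 : ℕ) : ℝ) * (D * boxError q)
        ≤ 2 * (2 * x ^ (ε / 2 + η)) * (G * x ^ η) * (D * (B * (q : ℝ) ^ (1 / 2 + η))) := by
          gcongr
          · exact mul_nonneg (by positivity) (boxError_nonneg q)
          · exact hB q hq.ne'
      _ = 4 * G * B * D * (x ^ (ε / 2 + η) * x ^ η * (q : ℝ) ^ (1 / 2 + η)) := by ring
      _ ≤ 4 * G * B * D * (x ^ (1 - ε / 2) / q) := by gcongr
      _ = _ := by rw [hR]; ring
  have e4 : A * x ^ η * (3 * x / (k * q) + 6) ≤ 9 * A * R := by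
    have h1 : x ^ η * (x / (k * q)) ≤ R := by
      calc x ^ η * (x / (k * q)) ≤ x ^ η * (x / (x ^ (ε / 2 + η) * q)) := by gcongr
        _ = x ^ (1 - ε / 2) / q := by
            have h2 : x ^ (1 - ε / 2) * x ^ (ε / 2 + η) = x ^ η * x := by
              rw [← Real.rpow_add hx0, ← Real.rpow_add_one hx0.ne']
              congr 1
              ring
            have h3 : x ^ (ε / 2 + η) ≠ 0 := by positivity
            rw [mul_div_assoc', div_eq_div_iff (by positivity) (by positivity), ← h2]
            ring
        _ ≤ R := hRle
    have h3 : x ^ η ≤ R := (hpow (by rw [hη]; linarith)).trans hRle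
    calc A * x ^ η * (3 * x / (k * q) + 6) = A * (3 * (x ^ η * (x / (k * q))) + 6 * x ^ η) := by
          ring
      _ ≤ A * (3 * R + 6 * R) := by gcongr
      _ = _ := by ring
  linarith
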